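/- Let $M$ be a smooth $7$-manifold with a real $G_2$-structure $(\varphi,g)$: at every point there is a frame of the tangent space in which $g$ is Euclidean and $\varphi=e^{123}+e^{145}+e^{167}+e^{246}-e^{257}-e^{347}-e^{356}$; orient $M$ by such frames and let $\nabla$ be the Levi-Civita connection of $g$. All tensors are extended complex-linearly, and $\wedge$, $d$ have their standard normalisations. On $\mathbb O_{\mathbb C}M=(\Lambda^0\oplus TM)\otimes\mathbb C$ use the octonion product $(a,\alpha)(b,\beta)=(ab-g(\alpha,\beta),\,a\beta+b\alpha+\alpha\times\beta)$, with $g(\alpha\times\beta,\gamma)=\varphi(\alpha,\beta,\gamma)$, and $N(Z)=\zeta_0^2+g(\zeta,\zeta)$ for $Z=(\zeta_0,\zeta)$. Let $\delta_a$ be the $a$-th frame vector regarded as an imaginary octonion and $\delta^a=g^{ab}\delta_b$. For a real or complex $3$-form $\varphi'$ in the metric class of $g$, with $\psi'=*\varphi'$, the torsion tensor is $T_a{}^m=\frac1{48}(\nabla_a\varphi'_{bcd})\,\psi'^{mbcd}$ (so $\nabla_a\varphi'_{bcd}=2T_a{}^e\psi'_{ebcd}$), and it decomposes uniquely as $T=\tau_1g+\tau_7\lrcorner\varphi'+\tau_{14}+\tau_{27}$,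 where $\tau_1$ is a function, $\tau_7$ a $1$-form, $(\tau_7\lrcorner\varphi')_{ab}=\tau_7^c\varphi'_{cab}$, $\tau_{14}$ is a $2$-form with $(\tau_{14})_{ab}\varphi'^{ab}{}_c=0$, and $\tau_{27}$ is symmetric and trace-free. With $T$ the torsion of $\varphi$, put $D_aA=\nabla_aA-A\,T_a$, where $T_a=(0,T_a{}^m)$. Let $Z=(\zeta_0,\zeta)$ be a smooth section of $\mathbb O_{\mathbb C}M$ that is nowhere a zero divisor (equivalently $N(Z)$ vanishes nowhere), and put $$\varphi_Z=\sigma_Z(\varphi)=\frac1{N(Z)}\Big(\big(\zeta_0^2-g(\zeta,\zeta)\big)\varphi-2\zeta_0\,\zeta\lrcorner{*\varphi}+2\,\zeta^\flat\wedge(\zeta\lrcorner\varphi)\Big),\qquad \psi_Z=*\varphi_Z,$$ with torsion $T^{(Z)}$ and components $\tau_j^{(Z)}$. Let $\mu\in\mathbb R$ and let $\Delta$ be a smooth real function on $M$. For a real $4$-form $G$, let $G^{(4)}(A)=-\frac1{144}G_{bcde}\,\delta^b(\delta^c(\delta^d(\delta^eA)))$ and $G^{(3)}_a(A)=-\frac1{144}G_{abcd}\,\delta^b(\delta^c(\delta^dA))$.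 The internal Killing equation for $(Z,G,\mu,\Delta)$ is $$D_aZ=-\tfrac12\mu e^{-4\Delta}\delta_aZ+i\,\delta_aG^{(4)}(Z)+12\,i\,G^{(3)}_a(Z).\qquad(\mathrm K)$$ Decompose $G=Q_0\psi_Z+Q_1\wedge\varphi_Z+\iota_{\psi_Z}(4Q_2)$, where $Q_0$ is a complex function, $Q_1$ a complex $1$-form, $Q_2$ a trace-free symmetric complex $2$-tensor, and $\iota_\psi(h)_{abcd}=h_{[a}{}^m\psi_{|m|bcd]}$ (antisymmetrisation of total weight one). Write $d\log N(Z)$ for the $1$-form $N(Z)^{-1}dN(Z)$. (0) $d\log N(Z)$ is locally exact: near each point it is the differential of a smooth branch of $\log N(Z)$. (1) For every real $4$-form $G$, equation $(\mathrm K)$ holds if and only if $G$ and $T^{(Z)}$ decompose as above with components satisfying $$\tau_1^{(Z)}=\tfrac12\mu e^{-4\Delta}+\tfrac56\,i\,Q_0,\quad \tau_7^{(Z)}=-\tfrac i3Q_1=-\tfrac18\,d\log N(Z),\quad \tau_{14}^{(Z)}=0,\quad \tau_{27}^{(Z)}=i\,Q_2 .$$ (2) Conversely, suppose only that $\tau_{14}^{(Z)}=0$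 and $\tau_7^{(Z)}=-\frac18\,d\log N(Z)$, and that the complex $4$-form $$G=-\tfrac i2\,d\varphi_Z+\tfrac i5\big(14\,\tau_1^{(Z)}+3\mu e^{-4\Delta}\big)\psi_Z$$ is real. Then $(\mathrm K)$ holds for this $G$, $\mu$ and $\Delta$. -/

import Mathlib

open scoped Manifold ContDiff

noncomputable section

namespace G2Flux

/-! ## Tensor algebra in a frame

Tensors at a point are complexified and given by their components in a frame of the
(7-dimensional) tangent space; `g` is the matrix of the (complex bilinearly extended) metric in
that frame and `g⁻¹` is the inverse metric. Unless said otherwise indices are lower indices. -/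

abbrev E7 := EuclideanSpace ℝ (Fin 7)

abbrev Mat := Matrix (Fin 7) (Fin 7) ℂ
abbrev T1 := Fin 7 → ℂ
abbrev T2 := Fin 7 → Fin 7 → ℂ
abbrev T3 := Fin 7 → Fin 7 → Fin 7 → ℂ
abbrev T4 := Fin 7 → Fin 7 → Fin 7 → Fin 7 → ℂ

/-- A bioctonion in a frame: its octonion-real part and the (upper) components of its
octonion-imaginary part. -/
abbrev Bioct := ℂ × (Fin 7 → ℂ)

/-- Component `(i, j, k)` of `e^{abc} = e^a ∧ e^b ∧ e^c`. -/
def wedgeBasis (a b c i j k : Fin 7) : ℝ :=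
  Matrix.det !![if a = i then (1 : ℝ) else 0, if a = j then 1 else 0, if a = k then 1 else 0;
    if b = i then 1 else 0, if b = j then 1 else 0, if b = k then 1 else 0;
    if c = i then 1 else 0, if c = j then 1 else 0, if c = k then 1 else 0]

/-- The standard 3-form `e¹²³ + e¹⁴⁵ + e¹⁶⁷ + e²⁴⁶ - e²⁵⁷ - e³⁴⁷ - e³⁵⁶` on `ℝ⁷`
(indices are shifted to `0, …, 6`). -/
def phi0 (i j k : Fin 7) : ℝ :=
  wedgeBasis 0 1 2 i j k + wedgeBasis 0 3 4 i j k + wedgeBasis 0 5 6 i j k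
    + wedgeBasis 1 3 5 i j k - wedgeBasis 1 4 6 i j k - wedgeBasis 2 3 6 i j k
    - wedgeBasis 2 4 5 i j k

/-- The metric pairing of two vectors given by upper components. -/
def pair (g : Mat) (α β : T1) : ℂ := ∑ i, ∑ j, g i j * α i * β j

/-- The cross product `(α × β)^a = φ^a_{bc} α^b β^c` of two vectors. -/
def cross (g : Mat) (φ : T3) (α β : T1) : T1 := fun a =>
  ∑ d, ∑ b, ∑ c, g⁻¹ a d * φ d b c * α b * β c

/-- The octonion product defined by the metric and the 3-form `φ`. -/
def octMul (g : Mat) (φ : T3) (A B : Bioct) : Bioct :=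
  (A.1 * B.1 - pair g A.2 B.2,
    fun a => A.1 * B.2 a + B.1 * A.2 a + cross g φ A.2 B.2 a)

/-- The quadratic form `N(A) = ⟨A, A⟩` (complex bilinear). -/
def quadN (g : Mat) (A : Bioct) : ℂ := A.1 ^ 2 + pair g A.2 A.2

/-- The imaginary octonion `δ_a`. -/
def deltaLow (a : Fin 7) : Bioct := (0, fun i => if i = a then 1 else 0)

/-- The imaginary octonion `δ^a = g^{ab} δ_b`. -/
def deltaUp (g : Mat) (a : Fin 7) : Bioct := (0, fun i => g⁻¹ a i)

/-- Hodge star of a 3-form: `(∗w)_{defh} = (1/3!) w^{abc} vol_{abcdefh}`. -/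
def hodge (g : Mat) (vol : (Fin 7 → Fin 7) → ℂ) (w : T3) : T4 := fun d e f h =>
  (1 / 6 : ℂ) * ∑ a, ∑ b, ∑ c, ∑ a', ∑ b', ∑ c',
    g⁻¹ a a' * g⁻¹ b b' * g⁻¹ c c' * w a' b' c' * vol ![a, b, c, d, e, f, h]

/-- `σ_A(φ) = N(A)⁻¹ ((a² - ⟨α,α⟩) φ - 2 a α ⌟ ∗φ + 2 α♭ ∧ (α ⌟ φ))` for `A = (a, α)`. -/
def sigma (g : Mat) (vol : (Fin 7 → Fin 7) → ℂ) (A : Bioct) (φ : T3) : T3 := fun b c d =>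
  let low : T1 := fun i => ∑ j, g i j * A.2 j
  let con : T2 := fun i j => ∑ a, A.2 a * φ a i j
  (quadN g A)⁻¹ * ((A.1 ^ 2 - pair g A.2 A.2) * φ b c d
    - 2 * A.1 * ∑ a, A.2 a * hodge g vol φ a b c d
    + 2 * (low b * con c d - low c * con b d + low d * con b c))

/-- `α ∧ φ` for a 1-form `α` and a 3-form `φ`. -/
def wedge13 (α : T1) (φ : T3) : T4 := fun a b c d =>
  α a * φ b c d - α b * φ a c d + α c * φ a b d - α d * φ a b c

/-- `(q ⌟ φ)_{ab} = q^c φ_{cab}` for a 1-form `q`, whose index is raised with the metric. -/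
def contract (g : Mat) (q : T1) (φ : T3) : T2 := fun a b =>
  ∑ c, ∑ d, g⁻¹ c d * q d * φ c a b

/-- `ι_ψ(h)_{abcd} = h_{[a}{}^m ψ_{|m|bcd]}` (antisymmetrisation with weight one) for a
4-form `ψ`. -/
def iota (g : Mat) (ψ : T4) (h : T2) : T4 := fun a b c d =>
  let up : T2 := fun a m => ∑ n, g⁻¹ m n * h a n
  (1 / 4 : ℂ) * ∑ m, (up a m * ψ m b c d - up b m * ψ m a c d
    + up c m * ψ m a b d - up d m * ψ m a b c)

/-- The operator `G⁽⁴⁾(A) = -(1/144) G_{bcde} δ^b (δ^c (δ^d (δ^e A)))`. -/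
def opG4 (g : Mat) (φ : T3) (G : T4) (A : Bioct) : Bioct :=
  (-(1 / 144) : ℂ) • ∑ b, ∑ c, ∑ d, ∑ e, G b c d e •
    octMul g φ (deltaUp g b) (octMul g φ (deltaUp g c)
      (octMul g φ (deltaUp g d) (octMul g φ (deltaUp g e) A)))

/-- The operator `G⁽³⁾_a(A) = -(1/144) G_{abcd} δ^b (δ^c (δ^d A))`. -/
def opG3 (g : Mat) (φ : T3) (G : T4) (a : Fin 7) (A : Bioct) : Bioct :=
  (-(1 / 144) : ℂ) • ∑ b, ∑ c, ∑ d, G a b c d •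
    octMul g φ (deltaUp g b) (octMul g φ (deltaUp g c) (octMul g φ (deltaUp g d) A))

/-- `T = τ₁ g + τ₇ ⌟ φ + τ₁₄ + τ₂₇` is the decomposition of a 2-tensor into its components in
the representations `1, 7, 14, 27` with respect to `(φ, g)`: `τ₁₄` is a 2-form in
`Λ²₁₄ = {w | w_{ab} φ^{ab}{}_c = 0}`, and `τ₂₇` is symmetric and trace-free. -/
structure IsTorsionDecomposition (g : Mat) (φ : T3) (T : T2) (τ₁ : ℂ) (τ₇ : T1)
    (τ₁₄ τ₂₇ : T2) : Prop where
  sum_eq : ∀ a b, T a b = τ₁ * g a b + contract g τ₇ φ a b + τ₁₄ a b + τ₂₇ a b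
  skew : ∀ a b, τ₁₄ a b = -τ₁₄ b a
  mem_fourteen : ∀ c, ∑ a, ∑ b, ∑ a', ∑ b', g⁻¹ a a' * g⁻¹ b b' * τ₁₄ a' b' * φ a b c = 0
  symm : ∀ a b, τ₂₇ a b = τ₂₇ b a
  traceless : ∑ a, ∑ b, g⁻¹ a b * τ₂₇ a b = 0

/-- `G = Q₀ ψ + Q₁ ∧ φ + ι_ψ(4 Q₂) = ι_ψ(Q₀ g - (4/3) Q₁ ⌟ φ + 4 Q₂)` is the decomposition of a
4-form into its components in the representations `1, 7, 27` with respect to `(φ, ψ, g)`;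
`Q₁` is regarded as a 1-form, and `Q₂` is symmetric and trace-free. -/
structure IsFluxDecomposition (g : Mat) (φ : T3) (ψ : T4) (G : T4) (Q₀ : ℂ) (Q₁ : T1)
    (Q₂ : T2) : Prop where
  sum_eq : ∀ a b c d, G a b c d =
    Q₀ * ψ a b c d + wedge13 Q₁ φ a b c d + iota g ψ (fun i j => 4 * Q₂ i j) a b c d
  symm : ∀ a b, Q₂ a b = Q₂ b a
  traceless : ∑ a, ∑ b, g⁻¹ a b * Q₂ a b = 0

/-! ## Tensor calculus in coordinates on `ℝ⁷`

Fields are given by their components in the coordinate frame, as functions of the coordinates. -/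

/-- The partial derivative `∂_a f`. -/
def partialD (a : Fin 7) (f : E7 → ℂ) (x : E7) : ℂ :=
  fderiv ℝ f x (EuclideanSpace.single a 1)

/-- The Christoffel symbol `Γ^k_{ij}` of the metric `g`. -/
def christoffel (g : E7 → Mat) (x : E7) (k i j : Fin 7) : ℂ :=
  (1 / 2 : ℂ) * ∑ l, (g x)⁻¹ k l *
    (partialD i (fun y => g y j l) x + partialD j (fun y => g y i l) x
      - partialD l (fun y => g y i j) x)

/-- The Levi-Civita covariant derivative `∇_a w_{bcd}`. -/
def nablaForm (g : E7 → Mat) (w : E7 → T3) (x : E7) : T4 := fun a b c d =>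
  partialD a (fun y => w y b c d) x
    - ∑ e, (christoffel g x e a b * w x e c d + christoffel g x e a c * w x b e d
      + christoffel g x e a d * w x b c e)

/-- The Levi-Civita covariant derivative `∇_a A` of a section of `Λ⁰ ⊕ T`. -/
def nablaOct (g : E7 → Mat) (A : E7 → Bioct) (x : E7) (a : Fin 7) : Bioct :=
  (partialD a (fun y => (A y).1) x,
    fun m => partialD a (fun y => (A y).2 m) x + ∑ b, christoffel g x m a b * (A x).2 b)

/-- The exterior derivative `(dw)_{abcd}` of a 3-form. -/
def extD (w : E7 → T3) (x : E7) : T4 := fun a b c d =>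
  partialD a (fun y => w y b c d) x - partialD b (fun y => w y a c d) x
    + partialD c (fun y => w y a b d) x - partialD d (fun y => w y a b c) x

/-- The full torsion tensor `T_a{}^m = (1/48) (∇_a φ_{bcd}) ψ^{mbcd}` of `φ`, where `ψ = ∗φ`;
the second index is an upper index. It is equivalent to `∇_a φ_{bcd} = 2 T_a{}^e ψ_{ebcd}`. -/
def torsionUp (g : E7 → Mat) (vol : E7 → (Fin 7 → Fin 7) → ℂ) (φ : E7 → T3) (x : E7) : T2 :=
  fun a m => (1 / 48 : ℂ) * ∑ b, ∑ c, ∑ d, ∑ m', ∑ b', ∑ c', ∑ d',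
    nablaForm g φ x a b c d *
      ((g x)⁻¹ m m' * (g x)⁻¹ b b' * (g x)⁻¹ c c' * (g x)⁻¹ d d'
        * hodge (g x) (vol x) (φ x) m' b' c' d')

/-- The torsion tensor `T_{ab}` with both indices lowered. -/
def torsionLow (g : E7 → Mat) (vol : E7 → (Fin 7 → Fin 7) → ℂ) (φ : E7 → T3) (x : E7) : T2 :=
  fun a b => ∑ m, g x b m * torsionUp g vol φ x a m

/-- The octonion covariant derivative `D_a A = ∇_a A - A T_a`, where `T_a` is regarded as an
imaginary octonion. -/
def covD (g : E7 → Mat) (vol : E7 → (Fin 7 → Fin 7) → ℂ) (φ : E7 → T3) (A : E7 → Bioct)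
    (x : E7) (a : Fin 7) : Bioct :=
  nablaOct g A x a - octMul (g x) (φ x) (A x) (0, fun m => torsionUp g vol φ x a m)

/-! ## Smooth 7-manifolds -/

section Manifold

variable {M : Type*} [TopologicalSpace M] [ChartedSpace E7 M] [IsManifold (𝓡 7) ∞ M]

/-- The coordinates of `p` in the preferred chart at `p`. -/
def center (p : M) : E7 := extChartAt (𝓡 7) p p

/-- The point with coordinates `x` in the preferred chart at `p`. -/
def pointAt (p : M) (x : E7) : M := (extChartAt (𝓡 7) p).symm x

/-- The coordinate vector `∂_i`, at the point with coordinates `x`, of the chart at `p`: the image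
of the `i`-th basis vector under the differential of the inverse of the chart. -/
def coordFrame (p : M) (x : E7) (i : Fin 7) : TangentSpace (𝓡 7) (pointAt p x) :=
  (trivializationAt E7 (TangentSpace (𝓡 7) : M → Type _) p).symmL ℝ (pointAt p x)
    (EuclideanSpace.single i 1)

/-- The components, at the point with coordinates `x`, of a vector field in the chart at `p`. -/
def vecCoord (ξ : ∀ q : M, TangentSpace (𝓡 7) q) (p : M) (x : E7) : E7 :=
  (trivializationAt E7 (TangentSpace (𝓡 7) : M → Type _) p
    (⟨pointAt p x, ξ (pointAt p x)⟩ : TangentBundle (𝓡 7) M)).2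

variable (M) in
/-- A field of real alternating `k`-forms. -/
abbrev FormField (k : ℕ) := ∀ q : M, TangentSpace (𝓡 7) q [⋀^Fin k]→ₗ[ℝ] ℝ

/-- Components of a form, at the point with coordinates `x`, in the chart at `p`. -/
def formCoord {k : ℕ} (w : FormField M k) (p : M) (x : E7) (v : Fin k → Fin 7) : ℝ :=
  w (pointAt p x) (fun j => coordFrame p x (v j))

/-- Smoothness of a form: its components in all charts `chartAt p` are smooth. -/
def IsSmoothForm {k : ℕ} (w : FormField M k) : Prop :=
  ∀ (p : M) (v : Fin k → Fin 7),
    ContDiffOn ℝ ∞ (fun x => formCoord w p x v) (extChartAt (𝓡 7) p).target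

/-- The differential `(df)_a` at `p` of a complex function, in the chart at `p`. -/
def dFun (f : M → ℂ) (p : M) : T1 := fun a =>
  partialD a (fun x => f (pointAt p x)) (center p)

variable (M) in
/-- A `G₂`-structure `(φ, g)` on `M`, with its volume form: at every point there is a frame in
which `g` is the standard metric, `φ` is the standard 3-form, and which has volume one. -/
structure G2Structure where
  form : FormField M 3
  metric : Bundle.ContMDiffRiemannianMetric (𝓡 7) ∞ E7 (TangentSpace (𝓡 7) : M → Type _)
  vol : FormField M 7
  smooth_form : IsSmoothForm form
  adapted : ∀ p : M, ∃ b : Module.Basis (Fin 7) ℝ (TangentSpace (𝓡 7) p),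
    (∀ i j, metric.inner p (b i) (b j) = if i = j then 1 else 0) ∧
    (∀ i j k, form p ![b i, b j, b k] = phi0 i j k) ∧
    vol p b = 1

variable (M) in
/-- A smooth section `Z` of the bioctonion bundle `(Λ⁰ ⊕ TM) ⊗ ℂ`: its octonion-real part is the
complex function `scalar`, its octonion-imaginary part is `vecRe + i vecIm`. -/
structure BioctonionSection where
  scalar : M → ℂ
  vecRe : ∀ q : M, TangentSpace (𝓡 7) q
  vecIm : ∀ q : M, TangentSpace (𝓡 7) q
  smooth_scalar : ContMDiff (𝓡 7) 𝓘(ℝ, ℂ) ∞ scalar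
  smooth_vecRe : ContMDiff (𝓡 7) (𝓡 7).tangent ∞
    (fun q => (⟨q, vecRe q⟩ : TangentBundle (𝓡 7) M))
  smooth_vecIm : ContMDiff (𝓡 7) (𝓡 7).tangent ∞
    (fun q => (⟨q, vecIm q⟩ : TangentBundle (𝓡 7) M))

/-- The components of `Z` in the chart at `p`. -/
def BioctonionSection.coord (Z : BioctonionSection M) (p : M) (x : E7) : Bioct :=
  (Z.scalar (pointAt p x),
    fun i => (vecCoord Z.vecRe p x i : ℂ) + Complex.I * (vecCoord Z.vecIm p x i : ℂ))

/-- The components of a 4-form at `p`, in the chart at `p`. -/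
def fluxCoord (G : FormField M 4) (p : M) : T4 := fun a b c d =>
  (formCoord G p (center p) ![a, b, c, d] : ℂ)

namespace G2Structure

variable (S : G2Structure M) (Z : BioctonionSection M)

/-- The components of the metric in the chart at `p`. -/
def gC (p : M) (x : E7) : Mat := Matrix.of fun i j =>
  (S.metric.inner (pointAt p x) (coordFrame p x i) (coordFrame p x j) : ℂ)

/-- The components of `φ` in the chart at `p`. -/
def phiC (p : M) (x : E7) : T3 := fun i j k => (formCoord S.form p x ![i, j, k] : ℂ)

/-- The components of the volume form in the chart at `p`. -/
def volC (p : M) (x : E7) (v : Fin 7 → Fin 7) : ℂ := (formCoord S.vol p x v : ℂ)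

/-- `Z` is a zero divisor in the fibre at `p` of the bioctonion bundle. -/
def IsZeroDivisorAt (p : M) : Prop :=
  ∃ B : Bioct, B ≠ 0 ∧
    (octMul (S.gC p (center p)) (S.phiC p (center p)) (Z.coord p (center p)) B = 0 ∨
      octMul (S.gC p (center p)) (S.phiC p (center p)) B (Z.coord p (center p)) = 0)

/-- The complex function `N(Z) = ⟨Z, Z⟩` on `M`. -/
def normZ (q : M) : ℂ := Z.scalar q ^ 2
  + ((S.metric.inner q (Z.vecRe q) (Z.vecRe q) : ℂ) - (S.metric.inner q (Z.vecIm q) (Z.vecIm q) : ℂ)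
    + 2 * Complex.I * (S.metric.inner q (Z.vecRe q) (Z.vecIm q) : ℂ))

/-- The complex 1-form `d log N(Z) = N(Z)⁻¹ dN(Z)` at `p`. -/
def dlogN (p : M) : T1 := fun a => (S.normZ Z p)⁻¹ * dFun (S.normZ Z) p a

/-- The complexified `G₂`-structure `φ_Z = σ_Z(φ)` in the chart at `p`. -/
def phiZ (p : M) (x : E7) : T3 := sigma (S.gC p x) (S.volC p x) (Z.coord p x) (S.phiC p x)

/-- The 4-form `ψ_Z = ∗φ_Z` at `p`. -/
def psiZ (p : M) : T4 := hodge (S.gC p (center p)) (S.volC p (center p)) (S.phiZ Z p (center p))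

/-- The torsion tensor `T⁽ᶻ⁾_{ab}` of `φ_Z` at `p`. -/
def torsionZ (p : M) : T2 := torsionLow (S.gC p) (S.volC p) (S.phiZ Z p) (center p)

/-- The internal Killing equation
`D_a Z = -(1/2) μ e^{-4Δ} δ_a Z + i δ_a G⁽⁴⁾(Z) + 12 i G⁽³⁾_a(Z)` on `M`. -/
def InternalKilling (G : FormField M 4) (μ : ℝ) (Δ : M → ℝ) : Prop :=
  ∀ (p : M) (a : Fin 7),
    let x := center p
    let g := S.gC p x
    let φ := S.phiC p x
    let z := Z.coord p x
    let F := fluxCoord G p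
    covD (S.gC p) (S.volC p) (S.phiC p) (Z.coord p) x a =
      (-(1 / 2) * μ * Real.exp (-4 * Δ p) : ℂ) • octMul g φ (deltaLow a) z
        + Complex.I • octMul g φ (deltaLow a) (opG4 g φ F z)
        + (12 * Complex.I) • opG3 g φ F a z

end G2Structure

end Manifold

end G2Flux

end

open scoped Topology Matrix

namespace G2Flux

/-! The product `A ∘ B` attached to `σ_Z(φ)` is `(A(BZ))Z⁻¹`; equivalently `(A ∘ B)Z = A(BZ)`. This
identity (`quadN_smul_octMul_sigma`, then `octMul_sigmaS_mulS` and `IsAdapted.octMul_sigma_octMul`)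
carries the whole proof, in three ways.

Algebra. The product `∘` inherits left alternativity, so its cross product satisfies `α × (α × β) =
⟨α,β⟩α - ⟨α,α⟩β`. Hence there is a complex orthonormal frame in which `σ_Z(φ)` is the standard
3-form (`exists_adapted_frame`), and a connectedness argument in `ℂ` shows that the frame is
positively oriented (`orientInv_eq`). Every identity checked for the standard form therefore holds
for both `φ` and `φ_Z`.

Torsion. For any field of such forms, differentiating `A(AB) = (AA)B` shows that `∇_a φ` has only a
`Λ³₇` component, that is, `∇_a φ` acts as the associator `(AB)T_a - A(BT_a)`
(`LocalG2.cross_nablaForm`). Differentiating `(A ∘ B)Z = A(BZ)` and writing `D_a Z = W_a Z`, all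
terms with the torsion of `φ` cancel, because `D_a` contains `-Z T_a`. What remains says that `∇_a
φ_Z` acts as the associator of `∘` with `-W_a`. So the torsion of `φ_Z` is `-Im W_a`
(`LocalG2.torsionUp_sigma`), while `d log N(Z) = 2 Re W_a` (`LocalG2.partialD_quadN_eq`).

Flux. Moving `Z` out of iterated products gives `δ^b(δ^c(⋯ Z)) = (δ^b ∘ (δ^c ∘ ⋯ 1))Z`, so the right
side of the Killing equation is `J_a Z`, where `J_a` is computed at the unit for `φ_Z`. Cancelling
`Z`, the equation becomes `W_a = J_a`. Every 4-form splits as `35 = 1 + 7 + 27` (`exists_fluxS`),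
and in terms of the components `J_a` has real part `(4/3)iQ₁`; its imaginary part is minus the
torsion prescribed in the theorem (`flux_term_fluxS`). Comparing real and imaginary parts gives the
equivalence (`LocalG2.killing_iff`).

For the converse, `dφ_Z = 8 ι_ψ(T)` (`LocalG2.extD_eq_iota`) expresses the components of the given
4-form through the torsion, and they satisfy the same equations. The logarithm of `N(Z)` exists
locally since `N(Z)` is smooth and nonzero. -/

/-! ### The standard 3-form, its Hodge dual and the octonion product in coordinates. -/

def crossIdx : Fin 7 → Fin 7 → Fin 7 :=
  ![![0, 2, 1, 4, 3, 6, 5], ![2, 0, 0, 5, 6, 3, 4], ![1, 0, 0, 6, 5, 4, 3],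
    ![4, 5, 6, 0, 0, 1, 2], ![3, 6, 5, 0, 0, 2, 1], ![6, 3, 4, 1, 2, 0, 0], ![5, 4, 3, 2, 1, 0, 0]]
def crossSgn : Fin 7 → Fin 7 → ℤ :=
  ![![0, 1, -1, 1, -1, 1, -1], ![-1, 0, 1, 1, -1, -1, 1], ![1, -1, 0, -1, -1, 1, 1],
    ![-1, -1, 1, 0, 1, 1, -1], ![1, 1, 1, -1, 0, -1, -1], ![-1, 1, -1, -1, 1, 0, 1],
    ![1, -1, -1, 1, 1, -1, 0]]
/-- The components of the standard 3-form, as integers. -/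
def phiI (i j k : Fin 7) : ℤ := if crossIdx i j = k then crossSgn i j else 0

set_option maxRecDepth 10000 in
theorem phiI_perm : ∀ i j k, phiI i j k = -phiI j i k ∧ phiI i j k = -phiI i k j := by decide +kernel

def wedgeI (a b c i j k : Fin 7) : ℤ :=
  Matrix.det !![if a = i then (1 : ℤ) else 0, if a = j then 1 else 0, if a = k then 1 else 0;
    if b = i then 1 else 0, if b = j then 1 else 0, if b = k then 1 else 0;
    if c = i then 1 else 0, if c = j then 1 else 0, if c = k then 1 else 0]

theorem wedgeBasis_eq (a b c i j k : Fin 7) : wedgeBasis a b c i j k = (wedgeI a b c i j k : ℝ) := by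
  simp only [wedgeBasis, wedgeI, Matrix.det_fin_three]
  simp
theorem phi_sum_eq : ∀ i j k, phiI i j k =
   wedgeI 0 1 2 i j k + wedgeI 0 3 4 i j k + wedgeI 0 5 6 i j k
    + wedgeI 1 3 5 i j k - wedgeI 1 4 6 i j k - wedgeI 2 3 6 i j k
    - wedgeI 2 4 5 i j k := by
  simp only [wedgeI, Matrix.det_fin_three]
  decide +kernel

theorem phi0_eq (i j k : Fin 7) : (phi0 i j k : ℂ) = (phiI i j k : ℂ) := by
  rw [phi_sum_eq]; simp only [phi0, wedgeBasis_eq]; push_cast; ring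

/-- The complexified standard 3-form. -/
noncomputable def phiS : T3 := fun i j k => (phi0 i j k : ℂ)

theorem phiS_eq (i j k : Fin 7) : phiS i j k = (phiI i j k : ℂ) := phi0_eq i j k

/-- For fixed `i` only the three monomials of the 3-form containing `i` contribute, in two orders
each. The coordinate formulas for the cross and octonion products come from this table. -/
theorem sum_phiS (Y : Fin 7 → Fin 7 → ℂ) (i : Fin 7) : ∑ j, ∑ k, phiS i j k * Y j k =
  (![Y 1 2 - Y 2 1 + Y 3 4 - Y 4 3 + Y 5 6 - Y 6 5,
    Y 2 0 - Y 0 2 + Y 3 5 - Y 5 3 + Y 6 4 - Y 4 6,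
    Y 0 1 - Y 1 0 + Y 6 3 - Y 3 6 + Y 5 4 - Y 4 5,
    Y 4 0 - Y 0 4 + Y 5 1 - Y 1 5 + Y 2 6 - Y 6 2,
    Y 0 3 - Y 3 0 + Y 1 6 - Y 6 1 + Y 2 5 - Y 5 2,
    Y 6 0 - Y 0 6 + Y 1 3 - Y 3 1 + Y 4 2 - Y 2 4,
    Y 0 5 - Y 5 0 + Y 4 1 - Y 1 4 + Y 3 2 - Y 2 3] : Fin 7 → ℂ) i := by
  simp only [phiS_eq]
  fin_cases i <;> simp [Fin.sum_univ_seven, phiI, crossIdx, crossSgn] <;> ring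

theorem pair_one (α β : T1) : pair 1 α β = ∑ i, α i * β i := by
  simp [pair, Matrix.one_apply]

theorem cross_one (w : T3) (α β : T1) (a : Fin 7) :
    cross 1 w α β a = ∑ b, ∑ c, w a b c * α b * β c := by
  simp [cross, Matrix.one_apply]

theorem cross_phiS (α β : T1) : cross 1 phiS α β =
    ![α 1 * β 2 - α 2 * β 1 + α 3 * β 4 - α 4 * β 3 + α 5 * β 6 - α 6 * β 5,
      α 2 * β 0 - α 0 * β 2 + α 3 * β 5 - α 5 * β 3 + α 6 * β 4 - α 4 * β 6,
      α 0 * β 1 - α 1 * β 0 + α 6 * β 3 - α 3 * β 6 + α 5 * β 4 - α 4 * β 5,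
      α 4 * β 0 - α 0 * β 4 + α 5 * β 1 - α 1 * β 5 + α 2 * β 6 - α 6 * β 2,
      α 0 * β 3 - α 3 * β 0 + α 1 * β 6 - α 6 * β 1 + α 2 * β 5 - α 5 * β 2,
      α 6 * β 0 - α 0 * β 6 + α 1 * β 3 - α 3 * β 1 + α 4 * β 2 - α 2 * β 4,
      α 0 * β 5 - α 5 * β 0 + α 4 * β 1 - α 1 * β 4 + α 3 * β 2 - α 2 * β 3] := by
  funext a
  rw [cross_one]
  simp_rw [mul_assoc]
  rw [sum_phiS (fun b c => α b * β c)]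

/-- The octonion product in an adapted frame. -/
noncomputable abbrev mulS (A B : Bioct) : Bioct := octMul 1 phiS A B

theorem mulS_eq (A B : Bioct) : mulS A B =
    (A.1 * B.1 - (A.2 0 * B.2 0 + A.2 1 * B.2 1 + A.2 2 * B.2 2 + A.2 3 * B.2 3 + A.2 4 * B.2 4
      + A.2 5 * B.2 5 + A.2 6 * B.2 6),
    ![A.1 * B.2 0 + B.1 * A.2 0 + (A.2 1 * B.2 2 - A.2 2 * B.2 1 + A.2 3 * B.2 4 - A.2 4 * B.2 3
        + A.2 5 * B.2 6 - A.2 6 * B.2 5),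
      A.1 * B.2 1 + B.1 * A.2 1 + (A.2 2 * B.2 0 - A.2 0 * B.2 2 + A.2 3 * B.2 5 - A.2 5 * B.2 3
        + A.2 6 * B.2 4 - A.2 4 * B.2 6),
      A.1 * B.2 2 + B.1 * A.2 2 + (A.2 0 * B.2 1 - A.2 1 * B.2 0 + A.2 6 * B.2 3 - A.2 3 * B.2 6
        + A.2 5 * B.2 4 - A.2 4 * B.2 5),
      A.1 * B.2 3 + B.1 * A.2 3 + (A.2 4 * B.2 0 - A.2 0 * B.2 4 + A.2 5 * B.2 1 - A.2 1 * B.2 5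
        + A.2 2 * B.2 6 - A.2 6 * B.2 2),
      A.1 * B.2 4 + B.1 * A.2 4 + (A.2 0 * B.2 3 - A.2 3 * B.2 0 + A.2 1 * B.2 6 - A.2 6 * B.2 1
        + A.2 2 * B.2 5 - A.2 5 * B.2 2),
      A.1 * B.2 5 + B.1 * A.2 5 + (A.2 6 * B.2 0 - A.2 0 * B.2 6 + A.2 1 * B.2 3 - A.2 3 * B.2 1
        + A.2 4 * B.2 2 - A.2 2 * B.2 4),
      A.1 * B.2 6 + B.1 * A.2 6 + (A.2 0 * B.2 5 - A.2 5 * B.2 0 + A.2 4 * B.2 1 - A.2 1 * B.2 4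
        + A.2 3 * B.2 2 - A.2 2 * B.2 3)]) := by
  refine Prod.ext ?_ ?_
  · simp [octMul, pair_one, Fin.sum_univ_seven]
  · funext a
    simp only [octMul, cross_phiS]
    fin_cases a <;> rfl

/-- Octonion conjugation. -/
def conj (A : Bioct) : Bioct := (A.1, fun i => -A.2 i)

theorem quadN_one (A : Bioct) : quadN 1 A = A.1 ^ 2 + (A.2 0 ^ 2 + A.2 1 ^ 2 + A.2 2 ^ 2
    + A.2 3 ^ 2 + A.2 4 ^ 2 + A.2 5 ^ 2 + A.2 6 ^ 2) := by
  simp [quadN, pair_one, Fin.sum_univ_seven, sq]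

theorem bioct_ext {A B : Bioct} (h : A.1 = B.1) (h0 : A.2 0 = B.2 0) (h1 : A.2 1 = B.2 1)
    (h2 : A.2 2 = B.2 2) (h3 : A.2 3 = B.2 3) (h4 : A.2 4 = B.2 4) (h5 : A.2 5 = B.2 5)
    (h6 : A.2 6 = B.2 6) : A = B := by
  refine Prod.ext h (funext fun i => ?_)
  fin_cases i <;> assumption

/-- Left alternativity and the two cancellation rules for the conjugate that follow replace
associativity in the later arguments. Each is a polynomial identity in sixteen coordinates. -/
theorem mulS_left_alt (A B : Bioct) : mulS A (mulS A B) = mulS (mulS A A) B := by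
  simp only [mulS_eq]
  apply bioct_ext <;> simp <;> ring

theorem mulS_conj_mulS (A Z : Bioct) : mulS (mulS A (conj Z)) Z = quadN 1 Z • A := by
  simp only [mulS_eq, quadN_one, conj]
  apply bioct_ext <;> simp <;> ring

theorem mulS_mulS_conj (A Z : Bioct) : mulS (mulS A Z) (conj Z) = quadN 1 Z • A := by
  simp only [mulS_eq, quadN_one, conj]
  apply bioct_ext <;> simp <;> ring

/-- The volume form in an adapted frame. -/
def epsS (v : Fin 7 → Fin 7) : ℂ := Matrix.det (Matrix.of fun k i => if v k = i then (1 : ℂ) else 0)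

/-- Its components, as integers. -/
def epsI (v : Fin 7 → Fin 7) : ℤ :=
  ∏ i, ∏ j ∈ Finset.Ioi i, if v i < v j then 1 else if v i = v j then 0 else -1

/-- For a permutation both sides are the sign, written as a product over pairs; otherwise the
determinant has two equal rows and the product has a factor `0`. -/
theorem epsS_eq (v : Fin 7 → Fin 7) : epsS v = epsI v := by
  by_cases hv : Function.Injective v
  · have hb : Function.Bijective v := (Finite.injective_iff_bijective).1 hv
    obtain ⟨σ, rfl⟩ : ∃ σ : Equiv.Perm (Fin 7), ⇑σ = v := ⟨Equiv.ofBijective v hb, rfl⟩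
    have h1 : epsS σ = (Equiv.Perm.sign σ : ℤ) := by
      have := Matrix.det_permutation (n := Fin 7) (R := ℂ) σ
      rw [← this]
      unfold epsS
      congr 1
      ext k i
      simp [Equiv.toPEquiv, PEquiv.toMatrix, eq_comm]
    rw [h1, Equiv.Perm.sign_eq_prod_prod_Ioi]
    unfold epsI
    push_cast
    refine Finset.prod_congr rfl fun i _ => Finset.prod_congr rfl fun j hj => ?_
    have : σ i ≠ σ j := fun h => (Finset.mem_Ioi.1 hj).ne (hv h)
    split_ifs <;> simp_all
  · simp only [Function.Injective, not_forall] at hv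
    obtain ⟨i, j, hij, hne⟩ := hv
    wlog hlt : i < j generalizing i j
    · exact this j i hij.symm (Ne.symm hne) (lt_of_le_of_ne (not_lt.1 hlt) (Ne.symm hne))
    have h1 : epsS v = 0 := Matrix.det_zero_of_row_eq hne (by ext k; simp [hij])
    have h2 : epsI v = 0 := by
      refine Finset.prod_eq_zero (Finset.mem_univ i)
        (Finset.prod_eq_zero (Finset.mem_Ioi.2 hlt) ?_)
      simp [hij]
    rw [h1, h2]; simp

/-- The components of the Hodge dual of the standard 3-form, as integers. -/
def psiI (i j k l : Fin 7) : ℤ :=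
  (if crossIdx i j = crossIdx k l then crossSgn i j * crossSgn k l else 0)
   - (if i = k ∧ j = l then 1 else 0) + (if i = l ∧ j = k then 1 else 0)

/-- `psiI` is by construction the remainder in this contraction identity; that it is the Hodge dual
of the 3-form is `psiS_eq`. -/
theorem phiI_mul_phiI : ∀ a b c d, ∑ e, phiI a b e * phiI c d e =
    (if a = c ∧ b = d then 1 else 0) - (if a = d ∧ b = c then 1 else 0) + psiI a b c d := by
  decide +kernel

theorem psiI_perm : ∀ i j k l, psiI i j k l = -psiI j i k l ∧ psiI i j k l = -psiI i k j l ∧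
    psiI i j k l = -psiI i j l k := by
  decide +kernel

def ordSign (a b : Fin 7) : ℤ := if a < b then 1 else if a = b then 0 else -1

/-- The 21 factors are grouped into pairs inside `a, b, c`, mixed pairs, and pairs inside `d, e, f,
h`. -/
def epsProd (a b c d e f h : Fin 7) : ℤ :=
  ordSign a b * ordSign a c * ordSign b c * (ordSign a d * ordSign a e * ordSign a f * ordSign a h
    * ordSign b d * ordSign b e * ordSign b f * ordSign b h * ordSign c d * ordSign c e
    * ordSign c f * ordSign c h) * (ordSign d e * ordSign d f * ordSign d h * ordSign e f
    * ordSign e h * ordSign f h)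

theorem epsI_eq_epsProd (a b c d e f h : Fin 7) :
    epsI ![a, b, c, d, e, f, h] = epsProd a b c d e f h := by
  have h0 : Finset.Ioi (0 : Fin 7) = {1, 2, 3, 4, 5, 6} := by decide
  have h1 : Finset.Ioi (1 : Fin 7) = {2, 3, 4, 5, 6} := by decide
  have h2 : Finset.Ioi (2 : Fin 7) = {3, 4, 5, 6} := by decide
  have h3 : Finset.Ioi (3 : Fin 7) = {4, 5, 6} := by decide
  have h4 : Finset.Ioi (4 : Fin 7) = {5, 6} := by decide
  have h5 : Finset.Ioi (5 : Fin 7) = {6} := by decide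
  have h6 : Finset.Ioi (6 : Fin 7) = ∅ := by decide
  change (∏ i, ∏ j ∈ Finset.Ioi i, ordSign (![a, b, c, d, e, f, h] i) (![a, b, c, d, e, f, h] j)) = _
  rw [Fin.prod_univ_seven, h0, h1, h2, h3, h4, h5, h6]
  repeat rw [Finset.prod_insert (by decide)]
  simp only [Finset.prod_singleton, Finset.prod_empty, epsProd]
  simp
  ring

theorem sum_epsProd : ∀ d e f h,
    epsProd 0 1 2 d e f h + epsProd 0 3 4 d e f h + epsProd 0 5 6 d e f h + epsProd 1 3 5 d e f h
      - epsProd 1 4 6 d e f h - epsProd 2 3 6 d e f h - epsProd 2 4 5 d e f h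
      = psiI d e f h := by
  decide +kernel

/-- One term survives for each of the seven monomials of the 3-form, and the factor 6 counts the
orders of its indices. This reduces the Hodge dual to the seven-term check `sum_epsProd`. -/
theorem sum_phiI_of_alternating (E : Fin 7 → Fin 7 → Fin 7 → ℤ) (h1 : ∀ a b c, E b a c = -E a b c)
    (h2 : ∀ a b c, E a c b = -E a b c) : ∑ a, ∑ b, ∑ c, phiI a b c * E a b c =
    6 * (E 0 1 2 + E 0 3 4 + E 0 5 6 + E 1 3 5 - E 1 4 6 - E 2 3 6 - E 2 4 5) := by
  have h3 : ∀ a b c, E b c a = E a b c := fun a b c => by rw [h2 b a c, h1 a b c, neg_neg]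
  have h4 : ∀ a b c, E c a b = E a b c := fun a b c => by rw [← h3 c a b]
  have h5 : ∀ a b c, E c b a = -E a b c := fun a b c => by rw [h1 b c a, h3]
  simp [Fin.sum_univ_seven, phiI, crossIdx, crossSgn]
  simp only [h1 0 1 2, h1 0 3 4, h1 0 5 6, h1 1 3 5, h1 1 4 6, h1 2 3 6, h1 2 4 5,
    h2 0 1 2, h2 0 3 4, h2 0 5 6, h2 1 3 5, h2 1 4 6, h2 2 3 6, h2 2 4 5,
    h3 0 1 2, h3 0 3 4, h3 0 5 6, h3 1 3 5, h3 1 4 6, h3 2 3 6, h3 2 4 5,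
    h4 0 1 2, h4 0 3 4, h4 0 5 6, h4 1 3 5, h4 1 4 6, h4 2 3 6, h4 2 4 5,
    h5 0 1 2, h5 0 3 4, h5 0 5 6, h5 1 3 5, h5 1 4 6, h5 2 3 6, h5 2 4 5]
  ring

theorem ordSign_swap (a b : Fin 7) : ordSign b a = -ordSign a b := by
  revert a b; decide

theorem sum_phiI_epsProd (d e f h : Fin 7) :
    ∑ a, ∑ b, ∑ c, phiI a b c * epsProd a b c d e f h = 6 * psiI d e f h := by
  rw [← sum_epsProd, sum_phiI_of_alternating (fun a b c => epsProd a b c d e f h)]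
  · intro a b c; simp only [epsProd]; rw [ordSign_swap a b]; ring
  · intro a b c; simp only [epsProd]; rw [ordSign_swap b c]; ring

/-- The Hodge dual of the standard 3-form. -/
noncomputable def psiS : T4 := hodge 1 epsS phiS

theorem hodge_one (w : T3) (d e f h : Fin 7) : hodge 1 epsS w d e f h =
    (1 / 6 : ℂ) * ∑ a, ∑ b, ∑ c, w a b c * epsS ![a, b, c, d, e, f, h] := by
  simp [hodge, Matrix.one_apply]

theorem psiS_eq (d e f h : Fin 7) : psiS d e f h = psiI d e f h := by
  rw [psiS, hodge_one]
  simp_rw [phiS_eq, epsS_eq, epsI_eq_epsProd]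
  have := sum_phiI_epsProd d e f h
  have h2 : (∑ a, ∑ b, ∑ c, (phiI a b c : ℂ) * (epsProd a b c d e f h : ℂ))
      = 6 * (psiI d e f h : ℂ) := by exact_mod_cast this
  rw [h2]; ring

/-- Total antisymmetry of a tensor with three indices. -/
structure Alt3 {V : Type*} [Neg V] (w : Fin 7 → Fin 7 → Fin 7 → V) : Prop where
  swap01 : ∀ a b c, w a b c = -w b a c
  swap12 : ∀ a b c, w a b c = -w a c b

/-- Total antisymmetry of a tensor with four indices. -/
structure Alt4 (w : T4) : Prop where
  swap01 : ∀ a b c d, w a b c d = -w b a c d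
  swap12 : ∀ a b c d, w a b c d = -w a c b d
  swap23 : ∀ a b c d, w a b c d = -w a b d c

theorem alt3_phiS : Alt3 phiS where
  swap01 a b c := by rw [phiS_eq, phiS_eq, (phiI_perm a b c).1]; push_cast; rfl
  swap12 a b c := by rw [phiS_eq, phiS_eq, (phiI_perm a b c).2]; push_cast; rfl

theorem alt4_psiS : Alt4 psiS where
  swap01 a b c d := by rw [psiS_eq, psiS_eq, (psiI_perm a b c d).1]; push_cast; rfl
  swap12 a b c d := by rw [psiS_eq, psiS_eq, (psiI_perm a b c d).2.1]; push_cast; rfl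
  swap23 a b c d := by rw [psiS_eq, psiS_eq, (psiI_perm a b c d).2.2]; push_cast; rfl

theorem phiS_mul_phiS (a b c d : Fin 7) : ∑ e, phiS a b e * phiS c d e =
    (if a = c ∧ b = d then 1 else 0) - (if a = d ∧ b = c then 1 else 0) + psiS a b c d := by
  simp_rw [phiS_eq, psiS_eq]
  have := phiI_mul_phiI a b c d
  have h2 := congrArg (fun n : ℤ => (n : ℂ)) this
  simpa using h2

/-- Substituting `ψ = φφ - δδ + δδ`, the quadratic term becomes a double cross product and the
deltas become metric pairings. -/
theorem sum_psiS (z α β : T1) (a : Fin 7) :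
    ∑ m, z m * ∑ b, ∑ c, psiS m a b c * α b * β c =
      -cross 1 phiS z (cross 1 phiS α β) a + α a * pair 1 z β - β a * pair 1 z α := by
  have key : ∀ m b c, psiS m a b c = ∑ e, phiS m a e * phiS b c e
      - (if m = b ∧ a = c then 1 else 0) + (if m = c ∧ a = b then 1 else 0) := by
    intro m b c; rw [phiS_mul_phiS]; ring
  have e1 : cross 1 phiS z (cross 1 phiS α β) a
      = -∑ m, z m * ∑ b, ∑ c, (∑ e, phiS m a e * phiS b c e) * α b * β c := by
    rw [cross_one]
    simp only [cross_one, Finset.mul_sum, Finset.sum_mul, ← Finset.sum_neg_distrib]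
    refine Finset.sum_congr rfl fun m _ => ?_
    rw [Finset.sum_comm]
    refine Finset.sum_congr rfl fun b _ => ?_
    rw [Finset.sum_comm]
    refine Finset.sum_congr rfl fun c _ => Finset.sum_congr rfl fun e _ => ?_
    rw [alt3_phiS.swap01 a m e, alt3_phiS.swap01 e b c, alt3_phiS.swap12 b e c]; ring
  rw [e1]
  simp_rw [key, add_mul, sub_mul, Finset.sum_add_distrib, Finset.sum_sub_distrib, mul_add, mul_sub,
    Finset.sum_add_distrib, Finset.sum_sub_distrib, pair_one]
  simp [ite_and, Finset.mul_sum]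
  simp [mul_comm, mul_left_comm]
  ring


/-- Expresses the cross product of `σ_Z(φ)` through that of `φ` alone: the `∗φ` term is handled by
`sum_psiS`, and the wedge term is expanded into its three summands. -/
theorem quadN_mul_cross_sigma (Z : Bioct) (hZ : quadN 1 Z ≠ 0) (α β : T1) (a : Fin 7) :
    quadN 1 Z * cross 1 (sigma 1 epsS Z phiS) α β a =
      (Z.1 ^ 2 - pair 1 Z.2 Z.2) * cross 1 phiS α β a
      - 2 * Z.1 * (-cross 1 phiS Z.2 (cross 1 phiS α β) a + α a * pair 1 Z.2 β
        - β a * pair 1 Z.2 α)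
      + 2 * (Z.2 a * pair 1 Z.2 (cross 1 phiS α β) + pair 1 Z.2 α * cross 1 phiS Z.2 β a
        - pair 1 Z.2 β * cross 1 phiS Z.2 α a) := by
  have e1 : ∀ b c, quadN 1 Z * sigma 1 epsS Z phiS a b c =
      (Z.1 ^ 2 - pair 1 Z.2 Z.2) * phiS a b c - 2 * Z.1 * ∑ m, Z.2 m * psiS m a b c
      + 2 * (Z.2 a * ∑ m, Z.2 m * phiS m b c - Z.2 b * ∑ m, Z.2 m * phiS m a c
        + Z.2 c * ∑ m, Z.2 m * phiS m a b) := by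
    intro b c
    simp only [sigma, psiS]
    rw [mul_inv_cancel_left₀ hZ]
    simp [Matrix.one_apply]
  have c1 : pair 1 Z.2 (cross 1 phiS α β) = ∑ b, ∑ c, (∑ m, Z.2 m * phiS m b c) * α b * β c := by
    simp only [pair_one, cross_one, Finset.mul_sum, Finset.sum_mul]
    rw [Finset.sum_comm]
    refine Finset.sum_congr rfl fun b _ => ?_
    rw [Finset.sum_comm]
    exact Finset.sum_congr rfl fun c _ => Finset.sum_congr rfl fun m _ => by ring
  have c2 : ∀ γ : T1, cross 1 phiS Z.2 γ a = -∑ c, (∑ m, Z.2 m * phiS m a c) * γ c := by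
    intro γ
    simp only [cross_one, Finset.sum_mul, ← Finset.sum_neg_distrib]
    rw [Finset.sum_comm]
    refine Finset.sum_congr rfl fun c _ => Finset.sum_congr rfl fun m _ => ?_
    rw [alt3_phiS.swap01 a m c]; ring
  have e2 : ∀ b c, quadN 1 Z * (sigma 1 epsS Z phiS a b c * α b * β c) =
      (Z.1 ^ 2 - pair 1 Z.2 Z.2) * (phiS a b c * α b * β c)
      - 2 * Z.1 * (∑ m, Z.2 m * (psiS m a b c * α b * β c))
      + 2 * (Z.2 a * ((∑ m, Z.2 m * phiS m b c) * α b * β c))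
      - 2 * ((Z.2 b * α b) * ((∑ m, Z.2 m * phiS m a c) * β c))
      + 2 * ((Z.2 c * β c) * ((∑ m, Z.2 m * phiS m a b) * α b)) := by
    intro b c
    have : ∑ m, Z.2 m * (psiS m a b c * α b * β c) = (∑ m, Z.2 m * psiS m a b c) * α b * β c := by
      simp only [Finset.sum_mul]
      exact Finset.sum_congr rfl fun m _ => by ring
    rw [this, ← mul_assoc, ← mul_assoc, e1]; ring
  have e3 : ∑ m, Z.2 m * ∑ b, ∑ c, psiS m a b c * α b * β c
      = ∑ b, ∑ c, ∑ m, Z.2 m * (psiS m a b c * α b * β c) := by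
    simp only [Finset.mul_sum]
    rw [Finset.sum_comm]
    refine Finset.sum_congr rfl fun b _ => ?_
    rw [Finset.sum_comm]
  rw [← sum_psiS, e3, c1, c2 α, c2 β, cross_one, cross_one, pair_one Z.2 α, pair_one Z.2 β,
    Finset.mul_sum, Finset.sum_congr rfl fun b _ => Finset.mul_sum ..]
  simp_rw [e2]
  simp only [Finset.sum_add_distrib, Finset.sum_sub_distrib, ← Finset.mul_sum, ← Finset.sum_mul]
  ring

set_option maxHeartbeats 4000000 in
-- The key identity `A ∘ B = (A(BZ))Z⁻¹`, with `Z⁻¹ = conj Z / N(Z)` and denominators cleared. Once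
-- `∗φ` has been eliminated by `quadN_mul_cross_sigma`, it is a polynomial identity in the
-- coordinates of `A`, `B` and `Z`.
theorem quadN_smul_octMul_sigma (Z : Bioct) (hZ : quadN 1 Z ≠ 0) (A B : Bioct) :
    quadN 1 Z • octMul 1 (sigma 1 epsS Z phiS) A B = mulS (mulS A (mulS B Z)) (conj Z) := by
  have h := quadN_mul_cross_sigma Z hZ A.2 B.2
  have e : quadN 1 Z • octMul 1 (sigma 1 epsS Z phiS) A B =
     (quadN 1 Z * (A.1 * B.1 - pair 1 A.2 B.2), fun a => quadN 1 Z * (A.1 * B.2 a + B.1 * A.2 a) +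
       quadN 1 Z * cross 1 (sigma 1 epsS Z phiS) A.2 B.2 a) := by
    refine Prod.ext rfl (funext fun a => ?_)
    simp [octMul, mul_add]
  rw [e]
  simp only [h]
  simp only [mulS_eq, quadN_one, conj, cross_phiS, pair_one, Fin.sum_univ_seven]
  apply bioct_ext <;> simp <;> ring


/-! ### Alternating tensors are determined by their components with increasing indices. -/

theorem forall_lt_three {P : Fin 7 → Fin 7 → Fin 7 → Prop}
    (h012 : P 0 1 2) (h013 : P 0 1 3) (h014 : P 0 1 4) (h015 : P 0 1 5) (h016 : P 0 1 6)
    (h023 : P 0 2 3) (h024 : P 0 2 4) (h025 : P 0 2 5) (h026 : P 0 2 6) (h034 : P 0 3 4)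
    (h035 : P 0 3 5) (h036 : P 0 3 6) (h045 : P 0 4 5) (h046 : P 0 4 6) (h056 : P 0 5 6)
    (h123 : P 1 2 3) (h124 : P 1 2 4) (h125 : P 1 2 5) (h126 : P 1 2 6) (h134 : P 1 3 4)
    (h135 : P 1 3 5) (h136 : P 1 3 6) (h145 : P 1 4 5) (h146 : P 1 4 6) (h156 : P 1 5 6)
    (h234 : P 2 3 4) (h235 : P 2 3 5) (h236 : P 2 3 6) (h245 : P 2 4 5) (h246 : P 2 4 6)
    (h256 : P 2 5 6) (h345 : P 3 4 5) (h346 : P 3 4 6) (h356 : P 3 5 6) (h456 : P 4 5 6) :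
    ∀ a b c, a < b → b < c → P a b c := by
  intro a b c hab hbc
  have key : ∀ a b c : Fin 7, a < b → b < c → (a, b, c) ∈ ([
    (0, 1, 2), (0, 1, 3), (0, 1, 4), (0, 1, 5), (0, 1, 6), (0, 2, 3), (0, 2, 4), (0, 2, 5),
    (0, 2, 6), (0, 3, 4), (0, 3, 5), (0, 3, 6), (0, 4, 5), (0, 4, 6), (0, 5, 6), (1, 2, 3),
    (1, 2, 4), (1, 2, 5), (1, 2, 6), (1, 3, 4), (1, 3, 5), (1, 3, 6), (1, 4, 5), (1, 4, 6),
    (1, 5, 6), (2, 3, 4), (2, 3, 5), (2, 3, 6), (2, 4, 5), (2, 4, 6), (2, 5, 6), (3, 4, 5),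
    (3, 4, 6), (3, 5, 6), (4, 5, 6)] :
    List (Fin 7 × Fin 7 × Fin 7)) := by decide +kernel
  have := key a b c hab hbc
  simp only [List.mem_cons, Prod.mk.injEq, List.not_mem_nil, or_false] at this
  rcases this with (h | h | h | h | h | h | h | h | h | h | h | h | h | h | h | h | h | h | h | h | h | h | h |
    h | h | h | h | h | h | h | h | h | h | h | h) <;>
  · obtain ⟨rfl, rfl, rfl⟩ := h
    assumption

theorem forall_lt_four {P : Fin 7 → Fin 7 → Fin 7 → Fin 7 → Prop}
    (h0123 : P 0 1 2 3) (h0124 : P 0 1 2 4) (h0125 : P 0 1 2 5) (h0126 : P 0 1 2 6)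
    (h0134 : P 0 1 3 4) (h0135 : P 0 1 3 5) (h0136 : P 0 1 3 6) (h0145 : P 0 1 4 5)
    (h0146 : P 0 1 4 6) (h0156 : P 0 1 5 6) (h0234 : P 0 2 3 4) (h0235 : P 0 2 3 5)
    (h0236 : P 0 2 3 6) (h0245 : P 0 2 4 5) (h0246 : P 0 2 4 6) (h0256 : P 0 2 5 6)
    (h0345 : P 0 3 4 5) (h0346 : P 0 3 4 6) (h0356 : P 0 3 5 6) (h0456 : P 0 4 5 6)
    (h1234 : P 1 2 3 4) (h1235 : P 1 2 3 5) (h1236 : P 1 2 3 6) (h1245 : P 1 2 4 5)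
    (h1246 : P 1 2 4 6) (h1256 : P 1 2 5 6) (h1345 : P 1 3 4 5) (h1346 : P 1 3 4 6)
    (h1356 : P 1 3 5 6) (h1456 : P 1 4 5 6) (h2345 : P 2 3 4 5) (h2346 : P 2 3 4 6)
    (h2356 : P 2 3 5 6) (h2456 : P 2 4 5 6) (h3456 : P 3 4 5 6) :
    ∀ a b c d, a < b → b < c → c < d → P a b c d := by
  intro a b c d hab hbc hcd
  have key : ∀ a b c d : Fin 7, a < b → b < c → c < d → (a, b, c, d) ∈ ([
    (0, 1, 2, 3), (0, 1, 2, 4), (0, 1, 2, 5), (0, 1, 2, 6), (0, 1, 3, 4), (0, 1, 3, 5),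
    (0, 1, 3, 6), (0, 1, 4, 5), (0, 1, 4, 6), (0, 1, 5, 6), (0, 2, 3, 4), (0, 2, 3, 5),
    (0, 2, 3, 6), (0, 2, 4, 5), (0, 2, 4, 6), (0, 2, 5, 6), (0, 3, 4, 5), (0, 3, 4, 6),
    (0, 3, 5, 6), (0, 4, 5, 6), (1, 2, 3, 4), (1, 2, 3, 5), (1, 2, 3, 6), (1, 2, 4, 5),
    (1, 2, 4, 6), (1, 2, 5, 6), (1, 3, 4, 5), (1, 3, 4, 6), (1, 3, 5, 6), (1, 4, 5, 6),
    (2, 3, 4, 5), (2, 3, 4, 6), (2, 3, 5, 6), (2, 4, 5, 6), (3, 4, 5, 6)] :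
    List (Fin 7 × Fin 7 × Fin 7 × Fin 7)) := by decide +kernel
  have := key a b c d hab hbc hcd
  simp only [List.mem_cons, Prod.mk.injEq, List.not_mem_nil, or_false] at this
  rcases this with (h | h | h | h | h | h | h | h | h | h | h | h | h | h | h | h | h | h | h | h | h | h | h |
    h | h | h | h | h | h | h | h | h | h | h | h) <;>
  · obtain ⟨rfl, rfl, rfl, rfl⟩ := h
    assumption

theorem Alt3.ext {w w' : T3} (h : Alt3 w) (h' : Alt3 w')
    (H : ∀ a b c, a < b → b < c → w a b c = w' a b c) : w = w' := by
  have z1 : ∀ {u : T3}, Alt3 u → ∀ a c, u a a c = 0 := fun hu a c =>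
    self_eq_neg.1 (hu.swap01 a a c)
  have z2 : ∀ {u : T3}, Alt3 u → ∀ a c, u a c c = 0 := fun hu a c =>
    self_eq_neg.1 (hu.swap12 a c c)
  have H2 : ∀ a b c, a < b → w a b c = w' a b c := by
    intro a b c hab
    rcases lt_trichotomy b c with hbc | rfl | hbc
    · exact H a b c hab hbc
    · rw [z2 h, z2 h']
    · rw [h.swap12, h'.swap12]
      rcases lt_trichotomy a c with hac | rfl | hac
      · rw [H a c b hac hbc]
      · rw [z1 h, z1 h']
      · rw [h.swap01, h'.swap01, H c a b hac hab]
  funext a b c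
  rcases lt_trichotomy a b with hab | rfl | hab
  · exact H2 a b c hab
  · rw [z1 h, z1 h']
  · rw [h.swap01, h'.swap01, H2 b a c hab]

theorem Alt4.ext {w w' : T4} (h : Alt4 w) (h' : Alt4 w')
    (H : ∀ a b c d, a < b → b < c → c < d → w a b c d = w' a b c d) : w = w' := by
  have z1 : ∀ {u : T4}, Alt4 u → ∀ a c d, u a a c d = 0 := fun hu a c d =>
    self_eq_neg.1 (hu.swap01 a a c d)
  have H2 : ∀ a b c d, a < b → a < c → a < d → w a b c d = w' a b c d := by
    intro a b c d hab hac had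
    -- Setting `u a b c d` to zero unless `b, c, d` all exceed `a` keeps it alternating in the last
    -- three indices, so the result for three indices applies.
    have k : ∀ {u : T4}, Alt4 u → Alt3 (fun b c d => if a < b ∧ a < c ∧ a < d then u a b c d else 0) :=
      fun hu => ⟨fun b c d => by
          by_cases hb : a < b <;> by_cases hc : a < c <;> by_cases hd : a < d <;> simp [*]
          exact hu.swap12 a b c d, fun b c d => by
          by_cases hb : a < b <;> by_cases hc : a < c <;> by_cases hd : a < d <;> simp [*]
          exact hu.swap23 a b c d⟩
    have := Alt3.ext (k h) (k h') (fun b c d hbc hcd => by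
      by_cases hb : a < b
      · simp [hb, hb.trans hbc, (hb.trans hbc).trans hcd, H a b c d hb hbc hcd]
      · simp [hb])
    have := congrFun (congrFun (congrFun this b) c) d
    simpa [hab, hac, had] using this
  have H3 : ∀ a b c d, a < b → a < c → w a b c d = w' a b c d := by
    intro a b c d hab hac
    rcases lt_trichotomy a d with had | rfl | had
    · exact H2 a b c d hab hac had
    · rw [h.swap23, h.swap12, z1 h, h'.swap23, h'.swap12, z1 h']
    · rw [h.swap23, h.swap12, h.swap01, h'.swap23, h'.swap12, h'.swap01,
        H2 d a b c had (had.trans hab) (had.trans hac)]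
  have H4 : ∀ a b c d, a < b → w a b c d = w' a b c d := by
    intro a b c d hab
    rcases lt_trichotomy a c with hac | rfl | hac
    · exact H3 a b c d hab hac
    · rw [h.swap12, z1 h, h'.swap12, z1 h']
    · rw [h.swap12, h.swap01, h'.swap12, h'.swap01, H3 c a b d hac (hac.trans hab)]
  funext a b c d
  rcases lt_trichotomy a b with hab | rfl | hab
  · exact H4 a b c d hab
  · rw [z1 h, z1 h']
  · rw [h.swap01, h'.swap01, H4 b a c d hab]


/-! ## Bilinearity -/

theorem pair_add_left (g : Mat) (α α' β : T1) : pair g (α + α') β = pair g α β + pair g α' β := by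
  simp only [pair, ← Finset.sum_add_distrib, Pi.add_apply]
  exact Finset.sum_congr rfl fun i _ => Finset.sum_congr rfl fun j _ => by ring

theorem pair_smul_left (g : Mat) (c : ℂ) (α β : T1) : pair g (c • α) β = c * pair g α β := by
  simp only [pair, Finset.mul_sum, Pi.smul_apply, smul_eq_mul]
  exact Finset.sum_congr rfl fun i _ => Finset.sum_congr rfl fun j _ => by ring

theorem pair_add_right (g : Mat) (α β β' : T1) : pair g α (β + β') = pair g α β + pair g α β' := by
  simp only [pair, ← Finset.sum_add_distrib, Pi.add_apply]
  exact Finset.sum_congr rfl fun i _ => Finset.sum_congr rfl fun j _ => by ring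

theorem pair_smul_right (g : Mat) (c : ℂ) (α β : T1) : pair g α (c • β) = c * pair g α β := by
  simp only [pair, Finset.mul_sum, Pi.smul_apply, smul_eq_mul]
  exact Finset.sum_congr rfl fun i _ => Finset.sum_congr rfl fun j _ => by ring

theorem cross_add_left (g : Mat) (w : T3) (α α' β : T1) :
    cross g w (α + α') β = cross g w α β + cross g w α' β := by
  funext a
  simp only [cross, ← Finset.sum_add_distrib, Pi.add_apply]
  exact Finset.sum_congr rfl fun i _ => Finset.sum_congr rfl fun j _ =>
    Finset.sum_congr rfl fun k _ => by ring

theorem cross_smul_left (g : Mat) (w : T3) (c : ℂ) (α β : T1) :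
    cross g w (c • α) β = c • cross g w α β := by
  funext a
  simp only [cross, Finset.mul_sum, Pi.smul_apply, smul_eq_mul]
  exact Finset.sum_congr rfl fun i _ => Finset.sum_congr rfl fun j _ =>
    Finset.sum_congr rfl fun k _ => by ring

theorem cross_add_right (g : Mat) (w : T3) (α β β' : T1) :
    cross g w α (β + β') = cross g w α β + cross g w α β' := by
  funext a
  simp only [cross, ← Finset.sum_add_distrib, Pi.add_apply]
  exact Finset.sum_congr rfl fun i _ => Finset.sum_congr rfl fun j _ =>
    Finset.sum_congr rfl fun k _ => by ring

theorem cross_smul_right (g : Mat) (w : T3) (c : ℂ) (α β : T1) :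
    cross g w α (c • β) = c • cross g w α β := by
  funext a
  simp only [cross, Finset.mul_sum, Pi.smul_apply, smul_eq_mul]
  exact Finset.sum_congr rfl fun i _ => Finset.sum_congr rfl fun j _ =>
    Finset.sum_congr rfl fun k _ => by ring

/-- The cross product as a bilinear map. -/
noncomputable def crossL (g : Mat) (w : T3) : T1 →ₗ[ℂ] T1 →ₗ[ℂ] T1 :=
  LinearMap.mk₂ ℂ (cross g w) (cross_add_left g w) (cross_smul_left g w) (cross_add_right g w)
    (cross_smul_right g w)

/-- The octonion product as a bilinear map. -/
noncomputable def octMulL (g : Mat) (w : T3) : Bioct →ₗ[ℂ] Bioct →ₗ[ℂ] Bioct :=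
  LinearMap.mk₂ ℂ (octMul g w)
    (fun A A' B => by
      refine Prod.ext ?_ (funext fun a => ?_)
      · simp [octMul, pair_add_left]; ring
      · simp [octMul, cross_add_left]; ring)
    (fun c A B => by
      refine Prod.ext ?_ (funext fun a => ?_)
      · simp [octMul, pair_smul_left]; ring
      · simp [octMul, cross_smul_left]; ring)
    (fun A B B' => by
      refine Prod.ext ?_ (funext fun a => ?_)
      · simp [octMul, pair_add_right]; ring
      · simp [octMul, cross_add_right]; ring)
    (fun c A B => by
      refine Prod.ext ?_ (funext fun a => ?_)
      · simp [octMul, pair_smul_right]; ring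
      · simp [octMul, cross_smul_right]; ring)

theorem octMul_add_left (g : Mat) (w : T3) (A A' B : Bioct) :
    octMul g w (A + A') B = octMul g w A B + octMul g w A' B := (octMulL g w).map_add₂ A A' B
theorem octMul_add_right (g : Mat) (w : T3) (A B B' : Bioct) :
    octMul g w A (B + B') = octMul g w A B + octMul g w A B' := (octMulL g w A).map_add B B'
theorem octMul_sub_left (g : Mat) (w : T3) (A A' B : Bioct) :
    octMul g w (A - A') B = octMul g w A B - octMul g w A' B := (octMulL g w).map_sub₂ A A' B
theorem octMul_sub_right (g : Mat) (w : T3) (A B B' : Bioct) :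
    octMul g w A (B - B') = octMul g w A B - octMul g w A B' := (octMulL g w A).map_sub B B'
theorem octMul_smul_left (g : Mat) (w : T3) (c : ℂ) (A B : Bioct) :
    octMul g w (c • A) B = c • octMul g w A B := (octMulL g w).map_smul₂ c A B
theorem octMul_smul_right (g : Mat) (w : T3) (c : ℂ) (A B : Bioct) :
    octMul g w A (c • B) = c • octMul g w A B := (octMulL g w A).map_smul c B
theorem octMul_sum_left {ι : Type*} (s : Finset ι) (g : Mat) (w : T3) (A : ι → Bioct) (B : Bioct) :
    octMul g w (∑ i ∈ s, A i) B = ∑ i ∈ s, octMul g w (A i) B := (octMulL g w).map_sum₂ s A B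
theorem octMul_sum_right {ι : Type*} (s : Finset ι) (g : Mat) (w : T3) (A : Bioct) (B : ι → Bioct) :
    octMul g w A (∑ i ∈ s, B i) = ∑ i ∈ s, octMul g w A (B i) := map_sum (octMulL g w A) B s

/-! ## Adapted frames from the cross product -/

/-- Pull back a 3-tensor along a linear map. -/
def lift3 (R : Mat) (w : T3) : T3 := fun a b c => ∑ i, ∑ j, ∑ k, R a i * R b j * R c k * w i j k

theorem alt3_lift3 (R : Mat) {w : T3} (h : Alt3 w) : Alt3 (lift3 R w) where
  swap01 a b c := by
    simp only [lift3, ← Finset.sum_neg_distrib]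
    rw [Finset.sum_comm]
    exact Finset.sum_congr rfl fun i _ => Finset.sum_congr rfl fun j _ =>
      Finset.sum_congr rfl fun k _ => by rw [h.swap01]; ring
  swap12 a b c := by
    simp only [lift3, ← Finset.sum_neg_distrib]
    refine Finset.sum_congr rfl fun i _ => ?_
    rw [Finset.sum_comm]
    exact Finset.sum_congr rfl fun j _ =>
      Finset.sum_congr rfl fun k _ => by rw [h.swap12]; ring

theorem lift3_eq_dot (R : Mat) (w : T3) (a b c : Fin 7) :
    lift3 R w a b c = R a ⬝ᵥ cross 1 w (R b) (R c) := by
  simp only [lift3, dotProduct, cross_one, Finset.mul_sum]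
  exact Finset.sum_congr rfl fun i _ => Finset.sum_congr rfl fun j _ =>
      Finset.sum_congr rfl fun k _ => by ring

theorem cross_swap {w : T3} (h : Alt3 w) (α β : T1) : cross 1 w α β = -cross 1 w β α := by
  funext a
  simp only [cross_one, Pi.neg_apply, ← Finset.sum_neg_distrib]
  rw [Finset.sum_comm]
  exact Finset.sum_congr rfl fun j _ =>
      Finset.sum_congr rfl fun k _ => by rw [h.swap12]; ring

theorem dot_cross_rotate {w : T3} (h : Alt3 w) (α β γ : T1) :
    α ⬝ᵥ cross 1 w β γ = β ⬝ᵥ cross 1 w γ α := by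
  simp only [dotProduct, cross_one, Finset.mul_sum]
  rw [Finset.sum_comm]
  refine Finset.sum_congr rfl fun j _ => ?_
  rw [Finset.sum_comm]
  exact Finset.sum_congr rfl fun k _ => Finset.sum_congr rfl fun i _ => by
    rw [h.swap01, h.swap12]; ring

/-- The hypothesis on double cross products is the composition-algebra law for imaginary elements.
As for the octonions, an orthonormal triple `f1, f2, f4` with `f4` orthogonal to `f1 × f2` generates
a standard basis, and all products and pairings follow from this law, antisymmetry and cyclic
symmetry. Over `ℂ` isotropic vectors must be avoided when choosing the triple. -/
theorem exists_adapted_frame {w : T3} (h : Alt3 w)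
    (hc : ∀ α β : T1, cross 1 w α (cross 1 w α β) = (α ⬝ᵥ β) • α - (α ⬝ᵥ α) • β) :
    ∃ F : Mat, F * F.transpose = 1 ∧ lift3 F w = phiS := by
  set X : T1 → T1 → T1 := cross 1 w with hX
  have anti : ∀ α β, X α β = -X β α := cross_swap h
  have rot : ∀ α β γ : T1, α ⬝ᵥ X β γ = β ⬝ᵥ X γ α := dot_cross_rotate h
  have addl : ∀ α α' β, X (α + α') β = X α β + X α' β := cross_add_left 1 w
  have addr : ∀ α β β', X α (β + β') = X α β + X α β' := cross_add_right 1 w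
  have negr : ∀ α β, X α (-β) = -X α β := fun α β => (crossL 1 w α).map_neg β
  have negl : ∀ α β, X (-α) β = -X α β := fun α β => (crossL 1 w).map_neg₂ α β
  have self0 : ∀ α, X α α = 0 := fun α => self_eq_neg.1 (anti α α)
  have dot0 : ∀ α β, α ⬝ᵥ X α β = 0 := fun α β => by rw [rot, rot, self0]; simp
  have dot0' : ∀ α β, β ⬝ᵥ X α β = 0 := fun α β => by rw [rot, self0]; simp
  -- Polarisation of the double cross product identity in its repeated argument.
  have pol : ∀ α β γ, X α (X β γ) = -X β (X α γ) + ((α ⬝ᵥ γ) • β + (β ⬝ᵥ γ) • α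
      - (2 * (α ⬝ᵥ β)) • γ) := by
    intro α β γ
    have h1 := hc (α + β) γ
    simp only [addl, addr, hc, add_dotProduct, dotProduct_add, dotProduct_comm β α] at h1
    linear_combination (norm := module) h1
  -- choose the generating triple
  obtain ⟨f1, f2, f4, h11, h22, h44, h12, h14, h24, h34⟩ : ∃ f1 f2 f4 : T1, f1 ⬝ᵥ f1 = 1 ∧
      f2 ⬝ᵥ f2 = 1 ∧ f4 ⬝ᵥ f4 = 1 ∧ f1 ⬝ᵥ f2 = 0 ∧ f1 ⬝ᵥ f4 = 0 ∧ f2 ⬝ᵥ f4 = 0 ∧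
      X f1 f2 ⬝ᵥ f4 = 0 := by
    set e1 : T1 := Pi.single 0 1 with he1
    set e2 : T1 := Pi.single 1 1 with he2
    set u := X e1 e2 with hu
    have u0 : u 0 = 0 := by simpa [he1] using dot0 e1 e2
    have u1 : u 1 = 0 := by simpa [he2] using dot0' e1 e2
    have uu : u ⬝ᵥ u = 1 := by
      have : X e1 u = -e2 := by rw [hu, hc]; simp [he1, he2]
      nth_rw 2 [hu]
      rw [rot, rot, anti, this]
      simp [he2]
    -- The projection `e_i - u_i u` is orthogonal to `e1`, `e2` and `u`, and its square length is `1
    -- - u_i²`. If this vanished for all five remaining indices, then `u · u` would be 5 instead of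
    -- 1. A nonzero square length can be normalised by a complex square root.
    obtain ⟨i, hi0, hi1, hi⟩ : ∃ i : Fin 7, i ≠ 0 ∧ i ≠ 1 ∧ 1 - u i ^ 2 ≠ 0 := by
      by_contra! hcon
      have k : ∀ i : Fin 7, i ≠ 0 → i ≠ 1 → u i ^ 2 = 1 := fun i h0 h1 =>
        (sub_eq_zero.1 (hcon i h0 h1)).symm
      simp only [dotProduct, Fin.sum_univ_seven, u0, u1, ← sq] at uu
      rw [k 2 (by decide) (by decide), k 3 (by decide) (by decide), k 4 (by decide) (by decide),
        k 5 (by decide) (by decide), k 6 (by decide) (by decide)] at uu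
      norm_num at uu
    obtain ⟨c, hcc⟩ := IsAlgClosed.exists_pow_nat_eq ((1 - u i ^ 2)⁻¹) (n := 2) (by norm_num)
    refine ⟨e1, e2, c • (Pi.single i 1 - u i • u), by simp [he1], by simp [he2], ?_,
      by simp [he1, he2], by simp [he1, u0, hi0.symm], by simp [he2, u1, hi1.symm], ?_⟩
    · have : c * c = (1 - u i ^ 2)⁻¹ := by rw [← hcc]; ring
      rw [smul_dotProduct, dotProduct_smul, smul_smul, this, smul_eq_mul,
        inv_mul_eq_one₀ hi]
      simp only [smul_dotProduct, dotProduct_smul, sub_dotProduct, dotProduct_sub, uu, smul_eq_mul,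
        single_dotProduct, dotProduct_single]
      simp
      ring
    · change u ⬝ᵥ _ = 0
      simp [dotProduct_sub, uu]
  set f3 := X f1 f2 with hf3
  set f5 := X f1 f4 with hf5
  set f6 := X f2 f4 with hf6
  -- The sign matches the term `-e³⁴⁷` of the standard form.
  set f7 := -X f3 f4 with hf7
  have h13 : f1 ⬝ᵥ f3 = 0 := dot0 _ _
  have h23 : f2 ⬝ᵥ f3 = 0 := dot0' _ _
  have x12 : X f1 f2 = f3 := rfl
  have x14 : X f1 f4 = f5 := rfl
  have x24 : X f2 f4 = f6 := rfl
  have x34 : X f3 f4 = -f7 := by rw [hf7, neg_neg]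
  have x13 : X f1 f3 = -f2 := by rw [hf3, hc, h11, h12]; simp
  have x23 : X f2 f3 = f1 := by
    rw [hf3, anti f1 f2, negr, hc, dotProduct_comm f2 f1, h12, h22]; simp
  have x15 : X f1 f5 = -f4 := by rw [hf5, hc, h11, h14]; simp
  have x26 : X f2 f6 = -f4 := by rw [hf6, hc, h22, h24]; simp
  have x45 : X f4 f5 = f1 := by
    rw [hf5, anti f1 f4, negr, hc, dotProduct_comm f4 f1, h14, h44]; simp
  have x46 : X f4 f6 = f2 := by
    rw [hf6, anti f2 f4, negr, hc, dotProduct_comm f4 f2, h24, h44]; simp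
  have h33 : f3 ⬝ᵥ f3 = 1 := by
    nth_rw 2 [hf3]
    rw [rot, x23, h11]
  have x37 : X f3 f7 = f4 := by
    rw [hf7, negr, hc, h33, h34]; simp
  have x47 : X f4 f7 = -f3 := by
    rw [hf7, anti f3 f4, neg_neg, hc, dotProduct_comm f4 f3, h34, h44]; simp
  have x16 : X f1 f6 = f7 := by
    rw [hf6, anti f2 f4, negr, pol f1 f4 f2, x12, h12, dotProduct_comm f4 f2, h24, h14,
      anti f4 f3, x34]
    simp
  have x25 : X f2 f5 = -f7 := by
    rw [hf5, anti f1 f4, negr, pol f2 f4 f1, anti f2 f1, x12, dotProduct_comm f2 f1, h12,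
      dotProduct_comm f4 f1, h14, h24, negr, anti f4 f3, x34]
    simp
  have x35 : X f3 f5 = -f6 := by
    rw [hf5, anti f1 f4, negr, pol f3 f4 f1, anti f3 f1, x13, dotProduct_comm f3 f1, h13,
      dotProduct_comm f4 f1, h14, h34, neg_neg, anti f4 f2, x24]
    simp
  have x36 : X f3 f6 = f5 := by
    rw [hf6, anti f2 f4, negr, pol f3 f4 f2, anti f3 f2, x23, dotProduct_comm f3 f2, h23,
      dotProduct_comm f4 f2, h24, h34, negr, anti f4 f1, x14]
    simp
  have h16 : f1 ⬝ᵥ f6 = 0 := by rw [hf6, rot, rot, x12, dotProduct_comm, h34]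
  have h25 : f2 ⬝ᵥ f5 = 0 := by
    rw [hf5, rot, rot, anti f2 f1, x12, dotProduct_neg, dotProduct_comm, h34, neg_zero]
  have x17 : X f1 f7 = -f6 := by rw [← x16, hc, h11, h16]; simp
  have x27 : X f2 f7 = f5 := by rw [← neg_neg f7, ← x25, negr, hc, h22, h25]; simp
  have h42 := (dotProduct_comm f4 f2).trans h24
  have h41 := (dotProduct_comm f4 f1).trans h14
  have h21 := (dotProduct_comm f2 f1).trans h12
  have h32 := (dotProduct_comm f3 f2).trans h23
  have h31 := (dotProduct_comm f3 f1).trans h13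
  have h15 : f1 ⬝ᵥ f5 = 0 := dot0 _ _
  have h45 : f4 ⬝ᵥ f5 = 0 := dot0' _ _
  have h26 : f2 ⬝ᵥ f6 = 0 := dot0 _ _
  have h46 : f4 ⬝ᵥ f6 = 0 := dot0' _ _
  have h35 : f3 ⬝ᵥ f5 = 0 := by
    rw [hf5, rot, rot, anti f3 f1, x13, neg_neg, h42]
  have h36 : f3 ⬝ᵥ f6 = 0 := by
    rw [hf6, rot, rot, anti f3 f2, x23, dotProduct_neg, h41, neg_zero]
  have h37 : f3 ⬝ᵥ f7 = 0 := by rw [hf7, dotProduct_neg, dot0, neg_zero]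
  have h47 : f4 ⬝ᵥ f7 = 0 := by rw [hf7, dotProduct_neg, dot0', neg_zero]
  have h17 : f1 ⬝ᵥ f7 = 0 := by
    rw [hf7, dotProduct_neg, rot, rot, x13, dotProduct_neg, h42, neg_zero, neg_zero]
  have h27 : f2 ⬝ᵥ f7 = 0 := by
    rw [hf7, dotProduct_neg, rot, rot, x23, h41, neg_zero]
  have h55 : f5 ⬝ᵥ f5 = 1 := by nth_rw 2 [hf5]; rw [rot, x45, h11]
  have h66 : f6 ⬝ᵥ f6 = 1 := by nth_rw 2 [hf6]; rw [rot, x46, h22]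
  have h77 : f7 ⬝ᵥ f7 = 1 := by
    nth_rw 2 [hf7]; rw [dotProduct_neg, rot, x47, dotProduct_neg, h33, neg_neg]
  have h56 : f5 ⬝ᵥ f6 = 0 := by rw [hf6, rot, x45, h21]
  have h57 : f5 ⬝ᵥ f7 = 0 := by rw [hf7, dotProduct_neg, rot, x45, h31, neg_zero]
  have h67 : f6 ⬝ᵥ f7 = 0 := by rw [hf7, dotProduct_neg, rot, x46, h32, neg_zero]
  -- The only triple containing none of `f1, …, f4`. Replacing `f7` by `-f3 × f4` and polarising
  -- reduces it to known products.
  have t567 : f5 ⬝ᵥ X f6 f7 = 0 := by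
    rw [hf7, negr, pol f6 f3 f4, anti f6 f4, x46, negr, anti f3 f2, x23, h34,
      dotProduct_comm f6 f4, h46, dotProduct_comm f6 f3, h36]
    simp [dotProduct_comm f5 f1, h15]
  have x56 : f1 ⬝ᵥ X f5 f6 = 0 := by rw [rot, anti, x16, dotProduct_neg, h57, neg_zero]
  refine ⟨Matrix.of ![f1, f2, f3, f4, f5, f6, f7], ?_, ?_⟩
  · ext i j
    rw [Matrix.mul_apply]
    change ![f1, f2, f3, f4, f5, f6, f7] i ⬝ᵥ ![f1, f2, f3, f4, f5, f6, f7] j = _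
    wlog hij : i ≤ j generalizing i j
    · rw [dotProduct_comm, this j i (not_le.1 hij).le, Matrix.one_apply, Matrix.one_apply]
      simp [eq_comm]
    rw [Matrix.one_apply]
    fin_cases i <;> fin_cases j
    · exact h11.trans (if_pos rfl).symm
    · exact h12.trans (if_neg (by decide)).symm
    · exact h13.trans (if_neg (by decide)).symm
    · exact h14.trans (if_neg (by decide)).symm
    · exact h15.trans (if_neg (by decide)).symm
    · exact h16.trans (if_neg (by decide)).symm
    · exact h17.trans (if_neg (by decide)).symm
    · exact absurd hij (by decide)
    · exact h22.trans (if_pos rfl).symm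
    · exact h23.trans (if_neg (by decide)).symm
    · exact h24.trans (if_neg (by decide)).symm
    · exact h25.trans (if_neg (by decide)).symm
    · exact h26.trans (if_neg (by decide)).symm
    · exact h27.trans (if_neg (by decide)).symm
    · exact absurd hij (by decide)
    · exact absurd hij (by decide)
    · exact h33.trans (if_pos rfl).symm
    · exact h34.trans (if_neg (by decide)).symm
    · exact h35.trans (if_neg (by decide)).symm
    · exact h36.trans (if_neg (by decide)).symm
    · exact h37.trans (if_neg (by decide)).symm
    · exact absurd hij (by decide)
    · exact absurd hij (by decide)
    · exact absurd hij (by decide)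
    · exact h44.trans (if_pos rfl).symm
    · exact h45.trans (if_neg (by decide)).symm
    · exact h46.trans (if_neg (by decide)).symm
    · exact h47.trans (if_neg (by decide)).symm
    · exact absurd hij (by decide)
    · exact absurd hij (by decide)
    · exact absurd hij (by decide)
    · exact absurd hij (by decide)
    · exact h55.trans (if_pos rfl).symm
    · exact h56.trans (if_neg (by decide)).symm
    · exact h57.trans (if_neg (by decide)).symm
    · exact absurd hij (by decide)
    · exact absurd hij (by decide)
    · exact absurd hij (by decide)
    · exact absurd hij (by decide)
    · exact absurd hij (by decide)
    · exact h66.trans (if_pos rfl).symm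
    · exact h67.trans (if_neg (by decide)).symm
    · exact absurd hij (by decide)
    · exact absurd hij (by decide)
    · exact absurd hij (by decide)
    · exact absurd hij (by decide)
    · exact absurd hij (by decide)
    · exact absurd hij (by decide)
    · exact h77.trans (if_pos rfl).symm
  · refine Alt3.ext (alt3_lift3 _ h) alt3_phiS ?_
    simp_rw [lift3_eq_dot, phiS_eq]
    change ∀ a b c, _ → _ → ![f1, f2, f3, f4, f5, f6, f7] a ⬝ᵥ
      X (![f1, f2, f3, f4, f5, f6, f7] b) (![f1, f2, f3, f4, f5, f6, f7] c) = _
    have r5 : ∀ i j k : T1, i ⬝ᵥ X j k = -(j ⬝ᵥ X i k) := fun i j k => by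
      rw [rot, anti, dotProduct_neg]
    apply forall_lt_three
    · rw [show phiI 0 1 2 = 1 from rfl]
      change f1 ⬝ᵥ X f2 f3 = _
      rw [x23, h11]
      norm_num
    · rw [show phiI 0 1 3 = 0 from rfl]
      change f1 ⬝ᵥ X f2 f4 = _
      rw [x24, h16]
      norm_num
    · rw [show phiI 0 1 4 = 0 from rfl]
      change f1 ⬝ᵥ X f2 f5 = _
      rw [x25, dotProduct_neg, h17]
      norm_num
    · rw [show phiI 0 1 5 = 0 from rfl]
      change f1 ⬝ᵥ X f2 f6 = _
      rw [x26, dotProduct_neg, h14]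
      norm_num
    · rw [show phiI 0 1 6 = 0 from rfl]
      change f1 ⬝ᵥ X f2 f7 = _
      rw [x27, h15]
      norm_num
    · rw [show phiI 0 2 3 = 0 from rfl]
      change f1 ⬝ᵥ X f3 f4 = _
      rw [x34, dotProduct_neg, h17]
      norm_num
    · rw [show phiI 0 2 4 = 0 from rfl]
      change f1 ⬝ᵥ X f3 f5 = _
      rw [x35, dotProduct_neg, h16]
      norm_num
    · rw [show phiI 0 2 5 = 0 from rfl]
      change f1 ⬝ᵥ X f3 f6 = _
      rw [x36, h15]
      norm_num
    · rw [show phiI 0 2 6 = 0 from rfl]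
      change f1 ⬝ᵥ X f3 f7 = _
      rw [x37, h14]
      norm_num
    · rw [show phiI 0 3 4 = 1 from rfl]
      change f1 ⬝ᵥ X f4 f5 = _
      rw [x45, h11]
      norm_num
    · rw [show phiI 0 3 5 = 0 from rfl]
      change f1 ⬝ᵥ X f4 f6 = _
      rw [x46, h12]
      norm_num
    · rw [show phiI 0 3 6 = 0 from rfl]
      change f1 ⬝ᵥ X f4 f7 = _
      rw [x47, dotProduct_neg, h13]
      norm_num
    · rw [show phiI 0 4 5 = 0 from rfl]
      change f1 ⬝ᵥ X f5 f6 = _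
      rw [r5 f1, x16, h57]
      norm_num
    · rw [show phiI 0 4 6 = 0 from rfl]
      change f1 ⬝ᵥ X f5 f7 = _
      rw [r5 f1, x17, dotProduct_neg, h56]
      norm_num
    · rw [show phiI 0 5 6 = 1 from rfl]
      change f1 ⬝ᵥ X f6 f7 = _
      rw [r5 f1, x17, dotProduct_neg, h66]
      norm_num
    · rw [show phiI 1 2 3 = 0 from rfl]
      change f2 ⬝ᵥ X f3 f4 = _
      rw [x34, dotProduct_neg, h27]
      norm_num
    · rw [show phiI 1 2 4 = 0 from rfl]
      change f2 ⬝ᵥ X f3 f5 = _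
      rw [x35, dotProduct_neg, h26]
      norm_num
    · rw [show phiI 1 2 5 = 0 from rfl]
      change f2 ⬝ᵥ X f3 f6 = _
      rw [x36, h25]
      norm_num
    · rw [show phiI 1 2 6 = 0 from rfl]
      change f2 ⬝ᵥ X f3 f7 = _
      rw [x37, h24]
      norm_num
    · rw [show phiI 1 3 4 = 0 from rfl]
      change f2 ⬝ᵥ X f4 f5 = _
      rw [x45, dotProduct_comm f2 f1, h12]
      norm_num
    · rw [show phiI 1 3 5 = 1 from rfl]
      change f2 ⬝ᵥ X f4 f6 = _
      rw [x46, h22]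
      norm_num
    · rw [show phiI 1 3 6 = 0 from rfl]
      change f2 ⬝ᵥ X f4 f7 = _
      rw [x47, dotProduct_neg, h23]
      norm_num
    · rw [show phiI 1 4 5 = 0 from rfl]
      change f2 ⬝ᵥ X f5 f6 = _
      rw [r5 f2, x26, dotProduct_neg, dotProduct_comm f5 f4, h45]
      norm_num
    · rw [show phiI 1 4 6 = -1 from rfl]
      change f2 ⬝ᵥ X f5 f7 = _
      rw [r5 f2, x27, h55]
      norm_num
    · rw [show phiI 1 5 6 = 0 from rfl]
      change f2 ⬝ᵥ X f6 f7 = _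
      rw [r5 f2, x27, dotProduct_comm f6 f5, h56]
      norm_num
    · rw [show phiI 2 3 4 = 0 from rfl]
      change f3 ⬝ᵥ X f4 f5 = _
      rw [x45, dotProduct_comm f3 f1, h13]
      norm_num
    · rw [show phiI 2 3 5 = 0 from rfl]
      change f3 ⬝ᵥ X f4 f6 = _
      rw [x46, dotProduct_comm f3 f2, h23]
      norm_num
    · rw [show phiI 2 3 6 = -1 from rfl]
      change f3 ⬝ᵥ X f4 f7 = _
      rw [x47, dotProduct_neg, h33]
      norm_num
    · rw [show phiI 2 4 5 = -1 from rfl]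
      change f3 ⬝ᵥ X f5 f6 = _
      rw [r5 f3, x36, h55]
      norm_num
    · rw [show phiI 2 4 6 = 0 from rfl]
      change f3 ⬝ᵥ X f5 f7 = _
      rw [r5 f3, x37, dotProduct_comm f5 f4, h45]
      norm_num
    · rw [show phiI 2 5 6 = 0 from rfl]
      change f3 ⬝ᵥ X f6 f7 = _
      rw [r5 f3, x37, dotProduct_comm f6 f4, h46]
      norm_num
    · rw [show phiI 3 4 5 = 0 from rfl]
      change f4 ⬝ᵥ X f5 f6 = _
      rw [r5 f4, x46, dotProduct_comm f5 f2, h25]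
      norm_num
    · rw [show phiI 3 4 6 = 0 from rfl]
      change f4 ⬝ᵥ X f5 f7 = _
      rw [r5 f4, x47, dotProduct_neg, dotProduct_comm f5 f3, h35]
      norm_num
    · rw [show phiI 3 5 6 = 0 from rfl]
      change f4 ⬝ᵥ X f6 f7 = _
      rw [r5 f4, x47, dotProduct_neg, dotProduct_comm f6 f3, h36]
      norm_num
    · rw [show phiI 4 5 6 = 0 from rfl]
      change f5 ⬝ᵥ X f6 f7 = _
      rw [t567, Int.cast_zero]


/-! ## Change of frame -/

section Push

variable {V W X : Type*} [AddCommMonoid V] [Module ℂ V] [AddCommMonoid W] [Module ℂ W]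
  [AddCommMonoid X] [Module ℂ X]

/-- Transform one index by a matrix. -/
noncomputable def push (R : Mat) : (Fin 7 → V) →ₗ[ℂ] (Fin 7 → V) where
  toFun u a := ∑ i, R a i • u i
  map_add' u v := by funext a; simp [Finset.sum_add_distrib]
  map_smul' c u := by funext a; simp [Finset.smul_sum, smul_smul, mul_comm]

theorem push_apply (R : Mat) (u : Fin 7 → V) (a : Fin 7) : push R u a = ∑ i, R a i • u i := rfl

theorem push_push (R Q : Mat) (u : Fin 7 → V) : push R (push Q u) = push (R * Q) u := by
  funext a
  simp only [push_apply, Matrix.mul_apply, Finset.smul_sum, Finset.sum_smul, smul_smul]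
  exact Finset.sum_comm

theorem push_one (u : Fin 7 → V) : push 1 u = u := by
  funext a
  simp [push_apply, Matrix.one_apply]

theorem map_push (L : V →ₗ[ℂ] W) (R : Mat) (u : Fin 7 → V) (a : Fin 7) :
    L (push R u a) = push R (fun i => L (u i)) a := by
  simp [push_apply]

/-- Transform two indices. -/
noncomputable def lift2 (R : Mat) (w : Fin 7 → Fin 7 → V) : Fin 7 → Fin 7 → V :=
  push R fun i => push R (w i)

/-- Transform three indices. -/
noncomputable def push3 (R : Mat) (w : Fin 7 → Fin 7 → Fin 7 → V) : Fin 7 → Fin 7 → Fin 7 → V :=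
  push R fun i => lift2 R (w i)

/-- Transform four indices. -/
noncomputable def lift4 (R : Mat) (w : Fin 7 → Fin 7 → Fin 7 → Fin 7 → V) :
    Fin 7 → Fin 7 → Fin 7 → Fin 7 → V :=
  push R fun i => push3 R (w i)

theorem lift2_lift2 (R Q : Mat) (w : Fin 7 → Fin 7 → V) :
    lift2 R (lift2 Q w) = lift2 (R * Q) w := by
  unfold lift2
  simp_rw [map_push (push R), push_push]

theorem lift2_one (w : Fin 7 → Fin 7 → V) : lift2 1 w = w := by
  unfold lift2; simp_rw [push_one]

/-- `lift2` as a linear map. -/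
noncomputable def lift2L (R : Mat) : (Fin 7 → Fin 7 → V) →ₗ[ℂ] (Fin 7 → Fin 7 → V) where
  toFun := lift2 R
  map_add' u v := by
    funext a b; simp [lift2, push_apply, Finset.sum_add_distrib]
  map_smul' c u := by
    funext a b; simp [lift2, push_apply, Finset.smul_sum, smul_smul, mul_comm, mul_left_comm]

theorem push3_push3 (R Q : Mat) (w : Fin 7 → Fin 7 → Fin 7 → V) :
    push3 R (push3 Q w) = push3 (R * Q) w := by
  unfold push3
  have : ∀ i, lift2 R (push Q (fun i => lift2 Q (w i)) i)
      = push Q (fun i => lift2 (R * Q) (w i)) i := fun i => by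
    rw [← show (fun i => lift2 R (lift2 Q (w i))) = fun i => lift2 (R * Q) (w i) from
      funext fun i => lift2_lift2 R Q (w i)]
    exact map_push (lift2L R) Q (fun i => lift2 Q (w i)) i
  simp_rw [this]
  rw [← push_push]

theorem push3_one (w : Fin 7 → Fin 7 → Fin 7 → V) : push3 1 w = w := by
  unfold push3; simp_rw [lift2_one, push_one]

/-- `push3` as a linear map. -/
noncomputable def push3L (R : Mat) :
    (Fin 7 → Fin 7 → Fin 7 → V) →ₗ[ℂ] (Fin 7 → Fin 7 → Fin 7 → V) where
  toFun := push3 R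
  map_add' u v := by
    funext a b c; simp [push3, lift2, push_apply, Finset.sum_add_distrib]
  map_smul' c u := by
    funext a b d
    simp [push3, lift2, push_apply, Finset.smul_sum, smul_smul, mul_comm, mul_left_comm]

theorem lift4_lift4 (R Q : Mat) (w : Fin 7 → Fin 7 → Fin 7 → Fin 7 → V) :
    lift4 R (lift4 Q w) = lift4 (R * Q) w := by
  unfold lift4
  have : ∀ i, push3 R (push Q (fun i => push3 Q (w i)) i)
      = push Q (fun i => push3 (R * Q) (w i)) i := fun i => by
    rw [← show (fun i => push3 R (push3 Q (w i))) = fun i => push3 (R * Q) (w i) from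
      funext fun i => push3_push3 R Q (w i)]
    exact map_push (push3L R) Q (fun i => push3 Q (w i)) i
  simp_rw [this]
  rw [← push_push]

theorem lift4_one (w : Fin 7 → Fin 7 → Fin 7 → Fin 7 → V) : lift4 1 w = w := by
  unfold lift4; simp_rw [push3_one, push_one]

/-- `lift4` as a linear map. -/
noncomputable def lift4L (R : Mat) : (Fin 7 → Fin 7 → Fin 7 → Fin 7 → V) →ₗ[ℂ]
    (Fin 7 → Fin 7 → Fin 7 → Fin 7 → V) where
  toFun := lift4 R
  map_add' u v := by
    funext a b c d; simp [lift4, push3, lift2, push_apply, Finset.sum_add_distrib]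
  map_smul' c u := by
    funext a b d e
    simp [lift4, push3, lift2, push_apply, Finset.smul_sum, smul_smul, mul_comm, mul_left_comm]

theorem lift3_eq_push3 (R : Mat) (w : T3) : lift3 R w = push3 R w := by
  funext a b c
  simp only [lift3, push3, lift2, push_apply, Finset.sum_apply, Pi.smul_apply, smul_eq_mul,
    Finset.mul_sum, mul_assoc]

theorem lift2_apply (R : Mat) (w : Fin 7 → Fin 7 → V) (a b : Fin 7) :
    lift2 R w a b = ∑ i, R a i • ∑ j, R b j • w i j := by
  simp [lift2, push_apply]

theorem push3_apply (R : Mat) (w : Fin 7 → Fin 7 → Fin 7 → V) (a b c : Fin 7) :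
    push3 R w a b c = ∑ i, R a i • ∑ j, R b j • ∑ k, R c k • w i j k := by
  simp [push3, lift2, push_apply]

theorem lift4_apply (R : Mat) (w : Fin 7 → Fin 7 → Fin 7 → Fin 7 → V) (a b c d : Fin 7) :
    lift4 R w a b c d = ∑ i, R a i • ∑ j, R b j • ∑ k, R c k • ∑ l, R d l • w i j k l := by
  simp [lift4, push3, lift2, push_apply]

/-- Contraction of one index. -/
noncomputable def sumPair (B : V →ₗ[ℂ] W →ₗ[ℂ] X) : (Fin 7 → V) →ₗ[ℂ] (Fin 7 → W) →ₗ[ℂ] X :=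
  LinearMap.mk₂ ℂ (fun u v => ∑ a, B (u a) (v a)) (by simp [Finset.sum_add_distrib])
    (by simp [Finset.smul_sum]) (by simp [Finset.sum_add_distrib]) (by simp [Finset.smul_sum])

theorem sumPair_apply (B : V →ₗ[ℂ] W →ₗ[ℂ] X) (u : Fin 7 → V) (v : Fin 7 → W) :
    sumPair B u v = ∑ a, B (u a) (v a) := rfl

/-- A contraction does not depend on the frame: the two indices transform by `R` and by the inverse
of its transpose. Values in arbitrary modules allow the statement to be applied to one index pair
after another. -/
theorem sumPair_push (B : V →ₗ[ℂ] W →ₗ[ℂ] X) {R Q : Mat} (h : R.transpose * Q = 1)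
    (u : Fin 7 → V) (v : Fin 7 → W) : sumPair B (push R u) (push Q v) = sumPair B u v := by
  have h' : ∀ i j, ∑ a, R a i * Q a j = if i = j then 1 else 0 := fun i j => by
    have := congrFun (congrFun h i) j
    simpa [Matrix.mul_apply, Matrix.one_apply] using this
  simp only [sumPair_apply, push_apply, map_sum, map_smul, LinearMap.sum_apply,
    LinearMap.smul_apply]
  have e : ∀ a, (∑ x, R a x • ∑ y, Q a y • B (u x) (v y))
      = ∑ x, ∑ y, (R a x * Q a y) • B (u x) (v y) := fun a => by
    simp only [Finset.smul_sum, smul_smul]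
  have e2 : ∀ a, (∑ y, Q a y • ∑ x, R a x • B (u x) (v y))
      = ∑ x, ∑ y, (R a x * Q a y) • B (u x) (v y) := fun a => by
    rw [← e]; simp only [Finset.smul_sum, smul_smul]; rw [Finset.sum_comm]
    simp only [mul_comm]
  simp only [e2]
  rw [Finset.sum_comm]
  refine Finset.sum_congr rfl fun i _ => ?_
  rw [Finset.sum_comm]
  simp only [← Finset.sum_smul, h']
  simp

theorem sum_push_smul_push {R Q : Mat} (h : R.transpose * Q = 1) (u : T1) (v : Fin 7 → W) :
    ∑ a, push R u a • push Q v a = ∑ i, u i • v i :=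
  sumPair_push (LinearMap.lsmul ℂ W) h u v

theorem sum_lift2_smul_lift2 {R Q : Mat} (h : R.transpose * Q = 1) (u : T2)
    (v : Fin 7 → Fin 7 → W) :
    ∑ a, ∑ b, lift2 R u a b • lift2 Q v a b = ∑ i, ∑ j, u i j • v i j := by
  have := sumPair_push (sumPair (LinearMap.lsmul ℂ W)) h (fun i => push R (u i))
    (fun i => push Q (v i))
  calc _ = ∑ i, ∑ b, push R (u i) b • push Q (v i) b := this
    _ = _ := Finset.sum_congr rfl fun i _ => sum_push_smul_push h (u i) (v i)

theorem sum_push3_smul_push3 {R Q : Mat} (h : R.transpose * Q = 1) (u : T3)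
    (v : Fin 7 → Fin 7 → Fin 7 → W) :
    ∑ a, ∑ b, ∑ c, push3 R u a b c • push3 Q v a b c = ∑ i, ∑ j, ∑ k, u i j k • v i j k := by
  have := sumPair_push (sumPair (sumPair (LinearMap.lsmul ℂ W))) h
    (fun i => lift2 R (u i)) (fun i => lift2 Q (v i))
  calc _ = ∑ i, ∑ b, ∑ c, lift2 R (u i) b c • lift2 Q (v i) b c := this
    _ = _ := Finset.sum_congr rfl fun i _ => sum_lift2_smul_lift2 h (u i) (v i)

theorem sum_lift4_smul_lift4 {R Q : Mat} (h : R.transpose * Q = 1) (u : T4)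
    (v : Fin 7 → Fin 7 → Fin 7 → Fin 7 → W) :
    ∑ a, ∑ b, ∑ c, ∑ d, lift4 R u a b c d • lift4 Q v a b c d
      = ∑ i, ∑ j, ∑ k, ∑ l, u i j k l • v i j k l := by
  have := sumPair_push (sumPair (sumPair (sumPair (LinearMap.lsmul ℂ W)))) h
    (fun i => push3 R (u i)) (fun i => push3 Q (v i))
  calc _ = ∑ i, ∑ b, ∑ c, ∑ d, push3 R (u i) b c d • push3 Q (v i) b c d := this
    _ = _ := Finset.sum_congr rfl fun i _ => sum_push3_smul_push3 h (u i) (v i)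

end Push

/-! ## The volume form in a frame -/

/-- The volume form whose components are the minors of `R`. -/
def volOf (R : Mat) (v : Fin 7 → Fin 7) : ℂ := Matrix.det (R.submatrix v id)

/-- Linearity of the determinant in row `k`. Used for the seven rows in turn, it writes the
determinant as the full contraction of the rows with `epsS`. -/
theorem det_rows_expand (m : Mat) (k : Fin 7) :
    Matrix.det m = ∑ i, m k i * Matrix.det (m.updateRow k (Pi.single i 1)) := by
  let L : (Fin 7 → ℂ) →ₗ[ℂ] ℂ :=
    { toFun := fun r => Matrix.det (m.updateRow k r)
      map_add' := fun u v => Matrix.det_updateRow_add m k u v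
      map_smul' := fun c u => Matrix.det_updateRow_smul m k c u }
  have h := LinearMap.pi_apply_eq_sum_univ L (m k)
  have h2 : L (m k) = Matrix.det m := congrArg Matrix.det (Matrix.updateRow_eq_self m k)
  rw [← h2, h]
  refine Finset.sum_congr rfl fun i _ => ?_
  rw [smul_eq_mul]
  refine congrArg (fun r => m k i * L r) (funext fun j => ?_)
  simp [Pi.single_apply, eq_comm]

/-- The seven indices are split as `3 + 4`: the Hodge star contracts the first three and leaves the
last four. -/
theorem volOf_eq (R : Mat) (a b c d e f h : Fin 7) : volOf R ![a, b, c, d, e, f, h] =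
    push3 R (fun i j k => lift4 R (fun l m n o => epsS ![i, j, k, l, m, n, o]) d e f h) a b c := by
  have step : ∀ m : Mat, Matrix.det m = ∑ i, m 0 i * ∑ j, m 1 j * ∑ k, m 2 k * ∑ l, m 3 l *
      ∑ p, m 4 p * ∑ q, m 5 q * ∑ r, m 6 r * epsS ![i, j, k, l, p, q, r] := by
    intro m
    rw [det_rows_expand m 0]
    refine Finset.sum_congr rfl fun i _ => congrArg _ ?_
    rw [det_rows_expand _ 1, Matrix.updateRow_ne (by decide)]
    refine Finset.sum_congr rfl fun j _ => congrArg _ ?_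
    rw [det_rows_expand _ 2, Matrix.updateRow_ne (by decide), Matrix.updateRow_ne (by decide)]
    refine Finset.sum_congr rfl fun k _ => congrArg _ ?_
    rw [det_rows_expand _ 3]
    iterate 3 rw [Matrix.updateRow_ne (by decide)]
    refine Finset.sum_congr rfl fun l _ => congrArg _ ?_
    rw [det_rows_expand _ 4]
    iterate 4 rw [Matrix.updateRow_ne (by decide)]
    refine Finset.sum_congr rfl fun p _ => congrArg _ ?_
    rw [det_rows_expand _ 5]
    iterate 5 rw [Matrix.updateRow_ne (by decide)]
    refine Finset.sum_congr rfl fun q _ => congrArg _ ?_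
    rw [det_rows_expand _ 6]
    iterate 6 rw [Matrix.updateRow_ne (by decide)]
    refine Finset.sum_congr rfl fun r _ => congrArg _ ?_
    unfold epsS
    congr 1
    ext x y
    fin_cases x <;> simp [Matrix.updateRow_apply, Pi.single_apply, eq_comm]
  rw [push3_apply]
  simp only [lift4_apply, smul_eq_mul]
  exact step _

/-- Since `g⁻¹R = Pᵀ`, raising the indices of the 3-form makes them contract with the three
corresponding factors `R` of the volume form, and the other four factors remain. -/
theorem hodge_volOf {P R g : Mat} (hPR : P * R = 1) (hg : g = R * R.transpose) (w : T3) :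
    hodge g (volOf R) (push3 R w) = lift4 R (hodge 1 epsS w) := by
  have hRP : R * P = 1 := mul_eq_one_comm.1 hPR
  have hginv : g⁻¹ = P.transpose * P := by
    rw [hg]
    refine Matrix.inv_eq_right_inv ?_
    rw [Matrix.mul_assoc, ← Matrix.mul_assoc R.transpose, ← Matrix.transpose_mul, hPR,
      Matrix.transpose_one, Matrix.one_mul, hRP]
  have hraise : g⁻¹ * R = P.transpose := by rw [hginv, Matrix.mul_assoc, hPR, Matrix.mul_one]
  funext d e f h
  have h1 : hodge g (volOf R) (push3 R w) d e f h = (1 / 6 : ℂ) * ∑ a, ∑ b, ∑ c,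
      push3 g⁻¹ (push3 R w) a b c • volOf R ![a, b, c, d, e, f, h] := by
    unfold hodge
    congr 1
    refine Finset.sum_congr rfl fun a _ => Finset.sum_congr rfl fun b _ =>
      Finset.sum_congr rfl fun c _ => ?_
    rw [push3_apply]
    simp only [smul_eq_mul, Finset.mul_sum, Finset.sum_mul]
    refine Finset.sum_congr rfl fun a _ => Finset.sum_congr rfl fun b _ =>
      Finset.sum_congr rfl fun c _ => by ring
  rw [h1, push3_push3, hraise]
  simp_rw [volOf_eq]
  rw [sum_push3_smul_push3 (by rw [Matrix.transpose_transpose, hPR])]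
  have h2 : hodge 1 epsS w = (1 / 6 : ℂ) • ∑ i, ∑ j, ∑ k, w i j k •
      (fun l m n o => epsS ![i, j, k, l, m, n, o] : T4) := by
    funext d e f h
    simp [hodge_one, Finset.sum_apply]
  have h3 : lift4 R (hodge 1 epsS w) = (1 / 6 : ℂ) • ∑ i, ∑ j, ∑ k, w i j k •
      lift4 R (fun l m n o => epsS ![i, j, k, l, m, n, o] : T4) := by
    rw [h2]
    change lift4L R _ = _
    simp only [map_smul, map_sum]
    rfl
  rw [h3]
  simp [Finset.sum_apply]


/-! ## The 3-form `σ_Z(φ)` in a frame adapted to `φ` -/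

theorem bioct_smul_right_injective {c : ℂ} (hc : c ≠ 0) {A B : Bioct} (h : c • A = c • B) : A = B :=
  smul_right_injective Bioct hc h

theorem mulS_right_cancel {Z A B : Bioct} (hZ : quadN 1 Z ≠ 0) (h : mulS A Z = mulS B Z) :
    A = B := by
  apply bioct_smul_right_injective hZ
  rw [← mulS_mulS_conj, ← mulS_mulS_conj, h]

/-- `σ_Z(φ)` in a frame adapted to `φ`. -/
noncomputable abbrev sigmaS (Z : Bioct) : T3 := sigma 1 epsS Z phiS

/-- The form of the key identity used from here on: neither the conjugate nor the norm of `Z` occurs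
in the equation, so it can be iterated and differentiated directly. -/
theorem octMul_sigmaS_mulS {Z : Bioct} (hZ : quadN 1 Z ≠ 0) (A B : Bioct) :
    mulS (octMul 1 (sigmaS Z) A B) Z = mulS A (mulS B Z) := by
  apply bioct_smul_right_injective hZ
  rw [← octMul_smul_left, quadN_smul_octMul_sigma Z hZ]
  exact mulS_conj_mulS _ Z

/-- After right multiplication by `Z` the claim becomes left alternativity of the original product,
`A(A(BZ)) = (AA)(BZ)`. The square of `A` is the same for both products, for the same reason. -/
theorem octMul_sigmaS_left_alt {Z : Bioct} (hZ : quadN 1 Z ≠ 0) (A B : Bioct) :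
    octMul 1 (sigmaS Z) A (octMul 1 (sigmaS Z) A B)
      = octMul 1 (sigmaS Z) (octMul 1 (sigmaS Z) A A) B := by
  apply mulS_right_cancel hZ
  rw [octMul_sigmaS_mulS hZ, octMul_sigmaS_mulS hZ, mulS_left_alt, octMul_sigmaS_mulS hZ]
  have h : mulS A A = octMul 1 (sigmaS Z) A A := by
    apply mulS_right_cancel hZ
    rw [octMul_sigmaS_mulS hZ, mulS_left_alt]
  rw [h]

theorem sigmaS_apply (Z : Bioct) (a b c : Fin 7) : sigmaS Z a b c = (quadN 1 Z)⁻¹ *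
    ((Z.1 ^ 2 - pair 1 Z.2 Z.2) * phiS a b c - 2 * Z.1 * ∑ m, Z.2 m * psiS m a b c
      + 2 * (Z.2 a * ∑ m, Z.2 m * phiS m b c - Z.2 b * ∑ m, Z.2 m * phiS m a c
        + Z.2 c * ∑ m, Z.2 m * phiS m a b)) := by
  simp only [sigma, psiS]
  simp [Matrix.one_apply]

theorem alt3_sigmaS (Z : Bioct) : Alt3 (sigmaS Z) where
  swap01 a b c := by
    rw [sigmaS_apply, sigmaS_apply]
    have h1 : ∑ m, Z.2 m * psiS m a b c = -∑ m, Z.2 m * psiS m b a c := by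
      rw [← Finset.sum_neg_distrib]
      exact Finset.sum_congr rfl fun m _ => by rw [alt4_psiS.swap12]; ring
    have h2 : ∑ m, Z.2 m * phiS m a b = -∑ m, Z.2 m * phiS m b a := by
      rw [← Finset.sum_neg_distrib]
      exact Finset.sum_congr rfl fun m _ => by rw [alt3_phiS.swap12]; ring
    rw [h1, h2, alt3_phiS.swap01 a b c]; ring
  swap12 a b c := by
    rw [sigmaS_apply, sigmaS_apply]
    have h1 : ∑ m, Z.2 m * psiS m a b c = -∑ m, Z.2 m * psiS m a c b := by
      rw [← Finset.sum_neg_distrib]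
      exact Finset.sum_congr rfl fun m _ => by rw [alt4_psiS.swap23]; ring
    have h2 : ∑ m, Z.2 m * phiS m b c = -∑ m, Z.2 m * phiS m c b := by
      rw [← Finset.sum_neg_distrib]
      exact Finset.sum_congr rfl fun m _ => by rw [alt3_phiS.swap12]; ring
    rw [h1, h2, alt3_phiS.swap12 a b c]; ring

/-- The imaginary part of left alternativity for imaginary arguments, where the square of `α` is the
scalar `-⟨α, α⟩`. -/
theorem cross_sigmaS_cross {Z : Bioct} (hZ : quadN 1 Z ≠ 0) (α β : T1) :
    cross 1 (sigmaS Z) α (cross 1 (sigmaS Z) α β) = (α ⬝ᵥ β) • α - (α ⬝ᵥ α) • β := by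
  have h := congrArg Prod.snd (octMul_sigmaS_left_alt hZ (0, α) (0, β))
  have h0 : cross 1 (sigmaS Z) α α = 0 := self_eq_neg.1 (cross_swap (alt3_sigmaS Z) α α)
  funext a
  have ha := congrFun h a
  have hz : cross 1 (sigmaS Z) 0 β = 0 := by
    have := cross_smul_left 1 (sigmaS Z) 0 0 β
    simpa using this
  simp only [octMul, h0, pair_one, zero_mul, zero_sub, zero_add, Pi.zero_apply, mul_zero, add_zero,
    dotProduct, Pi.sub_apply, Pi.smul_apply, smul_eq_mul] at ha ⊢
  rw [show (fun _ : Fin 7 => (0 : ℂ)) = 0 from rfl, hz] at ha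
  simp only [Pi.zero_apply] at ha
  linear_combination ha

theorem exists_frame_sigmaS {Z : Bioct} (hZ : quadN 1 Z ≠ 0) :
    ∃ F : Mat, F * F.transpose = 1 ∧ sigmaS Z = push3 F.transpose phiS := by
  obtain ⟨F, hF, h⟩ := exists_adapted_frame (alt3_sigmaS Z) (cross_sigmaS_cross hZ)
  refine ⟨F, hF, ?_⟩
  rw [← h, lift3_eq_push3, push3_push3, mul_eq_one_comm.1 hF, push3_one]

theorem volOf_mul (R Q : Mat) (v : Fin 7 → Fin 7) : volOf (R * Q) v = volOf R v * Q.det := by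
  have : (R * Q).submatrix v id = R.submatrix v id * Q := by
    ext i j; simp [Matrix.mul_apply]
  rw [volOf, this, Matrix.det_mul]; rfl

theorem volOf_one : volOf 1 = epsS := by
  funext v
  unfold volOf epsS
  congr 1

theorem hodge_smul_vol (g : Mat) (vol : (Fin 7 → Fin 7) → ℂ) (c : ℂ) (w : T3) :
    hodge g (fun v => vol v * c) w = c • hodge g vol w := by
  funext d e f h
  simp only [hodge, Pi.smul_apply, smul_eq_mul, Finset.mul_sum]
  refine Finset.sum_congr rfl fun _ _ => Finset.sum_congr rfl fun _ _ =>
    Finset.sum_congr rfl fun _ _ => Finset.sum_congr rfl fun _ _ =>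
    Finset.sum_congr rfl fun _ _ => Finset.sum_congr rfl fun _ _ => by ring

theorem push3_eq_push_lift2 (R : Mat) (w : T3) (a b : Fin 7) :
    push3 R w a b = push R (lift2 R w a b) := by
  funext c
  simp only [push3_apply, push_apply, lift2_apply, Finset.sum_apply, Pi.smul_apply, smul_eq_mul,
    Finset.mul_sum]
  symm
  rw [Finset.sum_comm]
  refine Finset.sum_congr rfl fun i _ => ?_
  rw [Finset.sum_comm]
  exact Finset.sum_congr rfl fun j _ => Finset.sum_congr rfl fun k _ => by ring

/-- The contraction `w_{abe} w_{cde}`. -/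
noncomputable def selfContract (w : T3) : T4 := fun a b c d => ∑ e, w a b e * w c d e

theorem selfContract_push3 {R : Mat} (h : R.transpose * R = 1) (w : T3) :
    selfContract (push3 R w) = lift4 R (selfContract w) := by
  funext a b c d
  have h1 : ∀ x y : T1, sumPair (LinearMap.mul ℂ ℂ) (push R x) (push R y)
    = sumPair (LinearMap.mul ℂ ℂ) x y := sumPair_push _ h
  have h2 : selfContract (push3 R w) a b c d
      = sumPair (LinearMap.mul ℂ ℂ) (lift2 R w a b) (lift2 R w c d) := by
    rw [← h1]
    simp only [selfContract, push3_eq_push_lift2]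
    rfl
  have h3 : ∀ Y : T1, sumPair (LinearMap.mul ℂ ℂ) (lift2 R w a b) Y
      = ∑ i, R a i • ∑ j, R b j • sumPair (LinearMap.mul ℂ ℂ) (w i j) Y := fun Y => by
    simp only [lift2_apply, map_sum, map_smul, LinearMap.sum_apply, LinearMap.smul_apply]
  have h4 : ∀ Y : T1, sumPair (LinearMap.mul ℂ ℂ) Y (lift2 R w c d)
      = ∑ i, R c i • ∑ j, R d j • sumPair (LinearMap.mul ℂ ℂ) Y (w i j) := fun Y => by
    simp only [lift2_apply, map_sum, map_smul]
  rw [h2, h3, lift4_apply]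
  simp only [h4]
  rfl

/-- The delta terms of `φφ` are killed by the antisymmetry of `ψ`, so the value is the full
contraction of `ψ` with itself, `7 · 24`. -/
theorem sum_psiS_selfContract_phiS :
    ∑ a, ∑ b, ∑ c, ∑ d, psiS a b c d * selfContract phiS a b c d = 168 := by
  have h : ∑ a, ∑ b, ∑ c, ∑ d, psiI a b c d * ∑ e, phiI a b e * phiI c d e = 168 := by
    decide +kernel
  simp only [selfContract, psiS_eq, phiS_eq]
  exact_mod_cast h

/-- An invariant of `σ_Z(φ)` which detects the orientation. -/
noncomputable def orientInv (Z : Bioct) : ℂ :=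
  ∑ a, ∑ b, ∑ c, ∑ d, hodge 1 epsS (sigmaS Z) a b c d * selfContract (sigmaS Z) a b c d

/-- An orthogonal change of frame preserves the metric and multiplies the volume form, hence the
Hodge star, by its determinant `±1`. -/
theorem det_smul_hodge_sigmaS {Z : Bioct} {F : Mat} (hF : F * F.transpose = 1)
    (h : sigmaS Z = push3 F.transpose phiS) :
    F.det • hodge 1 epsS (sigmaS Z) = lift4 F.transpose psiS := by
  have hg : (1 : Mat) = F.transpose * F.transpose.transpose := by
    rw [Matrix.transpose_transpose, mul_eq_one_comm.1 hF]
  rw [psiS, ← hodge_volOf hF hg phiS, ← h, ← hodge_smul_vol]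
  congr 1
  funext v
  rw [← volOf_one, ← Matrix.det_transpose F, ← volOf_mul, Matrix.one_mul]

theorem det_mul_orientInv {Z : Bioct} {F : Mat} (hF : F * F.transpose = 1)
    (h : sigmaS Z = push3 F.transpose phiS) : F.det * orientInv Z = 168 := by
  have hF' : F.transpose.transpose * F.transpose = 1 := by rw [Matrix.transpose_transpose, hF]
  rw [← sum_psiS_selfContract_phiS]
  have h2 := sum_lift4_smul_lift4 hF' psiS (selfContract phiS)
  simp only [smul_eq_mul] at h2
  rw [← h2, ← det_smul_hodge_sigmaS hF h, ← selfContract_push3 hF', ← h, orientInv]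
  simp only [Finset.mul_sum, Pi.smul_apply, smul_eq_mul, mul_assoc]

theorem det_sq_eq_one {F : Mat} (hF : F * F.transpose = 1) : F.det ^ 2 = 1 := by
  have := congrArg Matrix.det hF
  rwa [Matrix.det_mul, Matrix.det_transpose, Matrix.det_one, ← sq] at this

theorem orientInv_sq {Z : Bioct} (hZ : quadN 1 Z ≠ 0) : orientInv Z ^ 2 = 168 ^ 2 := by
  obtain ⟨F, hF, h⟩ := exists_frame_sigmaS hZ
  rw [← det_mul_orientInv hF h, mul_pow, det_sq_eq_one hF, one_mul]

/-- The complex line `γ(s) = (1 - s) + sZ` joins `1` to `Z`, and `N(γ(s))` is a polynomial in `s`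
that is not identically zero. Removing its finitely many roots from `ℂ` leaves a connected set.
There the invariant is continuous with constant square `168²`, hence constant, and at `s = 0` it is
that of the standard form. -/
theorem orientInv_eq {Z : Bioct} (hZ : quadN 1 Z ≠ 0) : orientInv Z = 168 := by
  let γ : ℂ → Bioct := fun s => ((1 - s) + s * Z.1, fun i => s * Z.2 i)
  let p : Polynomial ℂ := (1 - .X + .C Z.1 * .X) ^ 2 + .C (pair 1 Z.2 Z.2) * .X ^ 2
  have hp : ∀ s, p.eval s = quadN 1 (γ s) := by
    intro s
    have : pair 1 (fun i => s * Z.2 i) (fun i => s * Z.2 i) = s * (s * pair 1 Z.2 Z.2) := by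
      rw [← pair_smul_right, ← pair_smul_left]; rfl
    simp [p, γ, quadN, this]
    ring
  have hp0 : p ≠ 0 := fun h => by
    have := hp 0
    rw [h] at this
    simp [γ, quadN, pair] at this
  set U : Set ℂ := {s | p.IsRoot s}ᶜ with hU
  have hconn : IsPreconnected U :=
    ((Polynomial.finite_setOfPred_isRoot hp0).countable.isConnected_compl_of_one_lt_rank
      (by rw [Complex.rank_real_complex]; norm_num)).isPreconnected
  have hne : ∀ s ∈ U, quadN 1 (γ s) ≠ 0 := fun s hs => by rw [← hp]; exact hs
  have hγ1 : Continuous fun s => (γ s).1 := by fun_prop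
  have hγ2 : ∀ i, Continuous fun s => (γ s).2 i := fun i => by fun_prop
  have hσ : ∀ a b c, ContinuousOn (fun s => sigmaS (γ s) a b c) U := by
    intro a b c
    simp only [sigmaS_apply]
    refine ContinuousOn.mul (ContinuousOn.inv₀ ?_ hne) ?_
    · simp only [quadN, pair]; fun_prop
    · simp only [pair]; fun_prop
  have hcont : ContinuousOn (fun s => orientInv (γ s)) U := by
    unfold orientInv selfContract
    simp only [hodge_one]
    fun_prop
  have h0 : orientInv (γ 0) = 168 := by
    have : sigmaS (γ 0) = phiS := by
      funext a b c
      rw [sigmaS_apply]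
      simp [γ, quadN, pair]
    unfold orientInv
    rw [this]
    exact sum_psiS_selfContract_phiS
  have hγ : γ 1 = Z := by simp [γ]
  have m0 : (0 : ℂ) ∈ U := fun h => by
    have : quadN 1 (γ 0) = 0 := by rw [← hp]; exact h
    simp [γ, quadN, pair] at this
  have m1 : (1 : ℂ) ∈ U := fun h => by
    have : quadN 1 (γ 1) = 0 := by rw [← hp]; exact h
    exact hZ (by rwa [hγ] at this)
  rcases hconn.eq_or_eq_neg_of_sq_eq hcont (g := fun _ => (168 : ℂ)) continuousOn_const
    (fun s hs => orientInv_sq (hne s hs)) (fun _ => by norm_num) with h | h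
  · rw [← hγ]; exact h m1
  · have := h m0
    simp only [h0, Pi.neg_apply] at this
    norm_num at this

theorem exists_oriented_frame_sigmaS {Z : Bioct} (hZ : quadN 1 Z ≠ 0) :
    ∃ F : Mat, F * F.transpose = 1 ∧ sigmaS Z = push3 F.transpose phiS ∧ F.det = 1 := by
  obtain ⟨F, hF, h⟩ := exists_frame_sigmaS hZ
  refine ⟨F, hF, h, ?_⟩
  have := det_mul_orientInv hF h
  rw [orientInv_eq hZ] at this
  exact mul_right_cancel₀ (b := (168 : ℂ)) (by norm_num) (by rw [this, one_mul])


/-! ## Naturality -/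

/-- `P` and `R = P⁻¹` are the matrices of a `g`-orthonormal frame. -/
structure IsFrame (P R g : Mat) : Prop where
  mul_eq : P * R = 1
  metric_eq : g = R * R.transpose

namespace IsFrame

variable {P R g : Mat} (h : IsFrame P R g)
include h

theorem mul_eq' : R * P = 1 := mul_eq_one_comm.1 h.mul_eq

theorem transpose_mul : P.transpose.transpose * R = 1 := by
  rw [Matrix.transpose_transpose, h.mul_eq]

theorem transpose_mul' : R.transpose * P.transpose = 1 := by
  rw [← Matrix.transpose_mul, h.mul_eq, Matrix.transpose_one]

theorem inv_eq : g⁻¹ = P.transpose * P := by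
  rw [h.metric_eq]
  refine Matrix.inv_eq_right_inv ?_
  rw [Matrix.mul_assoc, ← Matrix.mul_assoc R.transpose, h.transpose_mul', Matrix.one_mul, h.mul_eq']

theorem inv_mul : g⁻¹ * R = P.transpose := by rw [h.inv_eq, Matrix.mul_assoc, h.mul_eq, Matrix.mul_one]

theorem metric_mul : g * P.transpose = R := by
  rw [h.metric_eq, Matrix.mul_assoc, h.transpose_mul', Matrix.mul_one]

end IsFrame

/-- The bioctonion whose components in the frame `P` are given. -/
noncomputable def fr (P : Mat) : Bioct →ₗ[ℂ] Bioct where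
  toFun A := (A.1, push P.transpose A.2)
  map_add' A B := by simp
  map_smul' c A := by simp

theorem fr_fst (P : Mat) (A : Bioct) : (fr P A).1 = A.1 := rfl
theorem fr_snd (P : Mat) (A : Bioct) : (fr P A).2 = push P.transpose A.2 := rfl

theorem push3_apply_eq (R : Mat) (w : T3) (a b c : Fin 7) :
    push3 R w a b c = ∑ i, R a i * lift2 R (w i) b c := by
  simp [push3, push_apply]

theorem lift4_apply_eq (R : Mat) (w : T4) (a b c d : Fin 7) :
    lift4 R w a b c d = ∑ i, R a i * push3 R (w i) b c d := by
  simp [lift4, push_apply]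

theorem push3_swap01 (R : Mat) (w : T3) (a b c : Fin 7) :
    push3 R (fun i j k => w j i k) a b c = push3 R w b a c := by
  simp only [push3_apply, smul_eq_mul, Finset.mul_sum]
  rw [Finset.sum_comm]
  exact Finset.sum_congr rfl fun i _ => Finset.sum_congr rfl fun j _ =>
    Finset.sum_congr rfl fun k _ => by ring

theorem lift2_swap (R : Mat) (w : T2) (a b : Fin 7) :
    lift2 R (fun i j => w j i) a b = lift2 R w b a := by
  simp only [lift2_apply, smul_eq_mul, Finset.mul_sum]
  rw [Finset.sum_comm]
  exact Finset.sum_congr rfl fun i _ => Finset.sum_congr rfl fun j _ => by ring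

theorem push3_swap12 (R : Mat) (w : T3) (a b c : Fin 7) :
    push3 R (fun i j k => w i k j) a b c = push3 R w a c b := by
  simp only [push3_apply_eq]
  exact Finset.sum_congr rfl fun i _ => by rw [lift2_swap R (w i) b c]

theorem lift4_swap01 (R : Mat) (w : T4) (a b c d : Fin 7) :
    lift4 R (fun i j k l => w j i k l) a b c d = lift4 R w b a c d := by
  simp only [lift4_apply, smul_eq_mul, Finset.mul_sum]
  rw [Finset.sum_comm]
  exact Finset.sum_congr rfl fun i _ => Finset.sum_congr rfl fun j _ =>
    Finset.sum_congr rfl fun k _ => Finset.sum_congr rfl fun l _ => by ring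

theorem lift4_swap12 (R : Mat) (w : T4) (a b c d : Fin 7) :
    lift4 R (fun i j k l => w i k j l) a b c d = lift4 R w a c b d := by
  simp only [lift4_apply_eq]
  exact Finset.sum_congr rfl fun i _ => by rw [push3_swap01 R (w i) b c d]

theorem lift4_swap23 (R : Mat) (w : T4) (a b c d : Fin 7) :
    lift4 R (fun i j k l => w i j l k) a b c d = lift4 R w a b d c := by
  simp only [lift4_apply_eq]
  exact Finset.sum_congr rfl fun i _ => by rw [push3_swap12 R (w i) b c d]

theorem alt3_push3 (R : Mat) {w : T3} (h : Alt3 w) : Alt3 (push3 R w) := by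
  rw [← lift3_eq_push3]; exact alt3_lift3 R h

theorem lift4_neg (R : Mat) (w : T4) : lift4 R (-w) = -lift4 R w := (lift4L R).map_neg w

theorem alt4_lift4 (R : Mat) {w : T4} (h : Alt4 w) : Alt4 (lift4 R w) where
  swap01 a b c d := by
    rw [← lift4_swap01 R w a b c d, show (fun i j k l => w j i k l) = -w from
      funext fun i => funext fun j => funext fun k => funext fun l => by rw [h.swap01]; rfl,
      lift4_neg, Pi.neg_apply, Pi.neg_apply, Pi.neg_apply, Pi.neg_apply, neg_neg]
  swap12 a b c d := by
    rw [← lift4_swap12 R w a b c d, show (fun i j k l => w i k j l) = -w from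
      funext fun i => funext fun j => funext fun k => funext fun l => by rw [h.swap12]; rfl,
      lift4_neg, Pi.neg_apply, Pi.neg_apply, Pi.neg_apply, Pi.neg_apply, neg_neg]
  swap23 a b c d := by
    rw [← lift4_swap23 R w a b c d, show (fun i j k l => w i j l k) = -w from
      funext fun i => funext fun j => funext fun k => funext fun l => by rw [h.swap23]; rfl,
      lift4_neg, Pi.neg_apply, Pi.neg_apply, Pi.neg_apply, Pi.neg_apply, neg_neg]

theorem push_mul_lift2 (R : Mat) (α : T1) (w : T2) (a b c : Fin 7) :
    push R α a * lift2 R w b c = push3 R (fun i j k => α i * w j k) a b c := by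
  rw [push3_apply_eq, push_apply, Finset.sum_mul]
  refine Finset.sum_congr rfl fun i _ => ?_
  rw [smul_eq_mul, mul_assoc]
  congr 1
  exact (congrFun (congrFun ((lift2L R).map_smul (α i) w) b) c).symm

theorem push_mul_push3 (R : Mat) (α : T1) (w : T3) (a b c d : Fin 7) :
    push R α a * push3 R w b c d = lift4 R (fun i j k l => α i * w j k l) a b c d := by
  rw [lift4_apply_eq, push_apply, Finset.sum_mul]
  refine Finset.sum_congr rfl fun i _ => ?_
  rw [smul_eq_mul, mul_assoc]
  congr 1
  exact (congrFun (congrFun (congrFun ((push3L R).map_smul (α i) w) b) c) d).symm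

theorem push_mul_push (R : Mat) (α β : T1) (a b : Fin 7) :
    push R α a * push R β b = lift2 R (fun i j => α i * β j) a b := by
  rw [lift2_apply, push_apply, push_apply, Finset.sum_mul]
  refine Finset.sum_congr rfl fun i _ => ?_
  simp only [smul_eq_mul, Finset.mul_sum]
  exact Finset.sum_congr rfl fun j _ => by ring

namespace IsFrame

variable {P R g : Mat} (h : IsFrame P R g)
include h

theorem fr_surjective (A : Bioct) : ∃ B, fr P B = A := by
  refine ⟨(A.1, push R.transpose A.2), Prod.ext rfl ?_⟩
  rw [fr_snd, push_push, ← Matrix.transpose_mul, h.mul_eq', Matrix.transpose_one, push_one]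

theorem fr_injective : Function.Injective (fr P) := by
  intro A B hAB
  have h1 : (fr P A).1 = (fr P B).1 := by rw [hAB]
  have h2 : (fr P A).2 = (fr P B).2 := by rw [hAB]
  refine Prod.ext h1 ?_
  rw [fr_snd, fr_snd] at h2
  have := congrArg (push R.transpose) h2
  rwa [push_push, push_push, h.transpose_mul', push_one, push_one] at this

theorem pair_push (α β : T1) :
    pair g (push P.transpose α) (push P.transpose β) = pair 1 α β := by
  have e : pair g (push P.transpose α) (push P.transpose β)
      = ∑ i, push P.transpose α i • push g (push P.transpose β) i := by
    simp only [pair, push_apply g, smul_eq_mul, Finset.mul_sum]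
    exact Finset.sum_congr rfl fun i _ => Finset.sum_congr rfl fun j _ => by ring
  rw [e, push_push, h.metric_mul, sum_push_smul_push h.transpose_mul, pair_one]
  rfl

theorem cross_push (w : T3) (α β : T1) :
    cross g (push3 R w) (push P.transpose α) (push P.transpose β)
      = push P.transpose (cross 1 w α β) := by
  have e : cross g (push3 R w) (push P.transpose α) (push P.transpose β) = push g⁻¹ (fun d =>
      ∑ b, ∑ c, lift2 P.transpose (fun i j => α i * β j) b c • push3 R w d b c) := by
    funext a
    simp only [cross, push_apply g⁻¹, smul_eq_mul, Finset.mul_sum, ← push_mul_push]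
    exact Finset.sum_congr rfl fun i _ => Finset.sum_congr rfl fun j _ =>
      Finset.sum_congr rfl fun k _ => by ring
  have e2 : (fun d => ∑ b, ∑ c, lift2 P.transpose (fun i j => α i * β j) b c • push3 R w d b c)
      = push R (cross 1 w α β) := by
    funext d
    have e3 : ∀ b c, push3 R w d b c = lift2 R (push R w d) b c := fun b c => by
      have := map_push (lift2L R) R w d
      exact (congrFun (congrFun this b) c).symm
    simp only [e3]
    rw [sum_lift2_smul_lift2 h.transpose_mul]
    simp only [push_apply, Finset.sum_apply, Pi.smul_apply, smul_eq_mul, cross_one, Finset.mul_sum]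
    symm
    rw [Finset.sum_comm]
    refine Finset.sum_congr rfl fun i _ => ?_
    rw [Finset.sum_comm]
    exact Finset.sum_congr rfl fun j _ => Finset.sum_congr rfl fun k _ => by ring
  rw [e, e2, push_push, h.inv_mul]

theorem octMul_fr (w : T3) (A B : Bioct) :
    octMul g (push3 R w) (fr P A) (fr P B) = fr P (octMul 1 w A B) := by
  refine Prod.ext ?_ ?_
  · simp only [octMul, fr_fst, fr_snd, h.pair_push]
  · simp only [octMul, fr_fst, fr_snd, h.cross_push]
    funext a
    simp only [push_apply, smul_eq_mul, mul_add, Finset.sum_add_distrib, Finset.mul_sum]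
    congr 1
    congr 1 <;> exact Finset.sum_congr rfl fun i _ => by ring

theorem quadN_fr (A : Bioct) : quadN g (fr P A) = quadN 1 A := by
  simp only [quadN, fr_fst, fr_snd, h.pair_push]

/-- Each ingredient of `sigma` is compatible with a change of frame. For the Hodge star this needs
the volume form to be given by the minors of the same matrix `R`. -/
theorem sigma_fr (w : T3) (A : Bioct) :
    sigma g (volOf R) (fr P A) (push3 R w) = push3 R (sigma 1 epsS A w) := by
  have low : (fun i => ∑ j, g i j * (fr P A).2 j) = push R A.2 := by
    rw [fr_snd, ← h.metric_mul, ← push_push]; rfl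
  have con : (fun i j => ∑ a, (fr P A).2 a * push3 R w a i j)
      = lift2 R (fun i j => ∑ a, A.2 a * w a i j) := by
    have := sumPair_push (LinearMap.lsmul ℂ T2) h.transpose_mul A.2 (fun i => lift2 R (w i))
    have h3 : (fun i j => ∑ a, A.2 a * w a i j) = ∑ a, A.2 a • w a := by
      funext i j; simp [Finset.sum_apply]
    rw [h3]
    have h4 : lift2 R (∑ a, A.2 a • w a) = ∑ a, A.2 a • lift2 R (w a) := by
      change lift2L R _ = _
      rw [map_sum]; simp only [map_smul]; rfl
    rw [h4]
    refine Eq.trans ?_ this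
    funext i j
    simp [sumPair_apply, Finset.sum_apply]
    rfl
  have con4 : ∀ ψ : T4, (fun i j k => ∑ a, (fr P A).2 a * lift4 R ψ a i j k)
      = push3 R (fun i j k => ∑ a, A.2 a * ψ a i j k) := by
    intro ψ
    have := sumPair_push (LinearMap.lsmul ℂ T3) h.transpose_mul A.2 (fun i => push3 R (ψ i))
    have h3 : (fun i j k => ∑ a, A.2 a * ψ a i j k) = ∑ a, A.2 a • ψ a := by
      funext i j k; simp [Finset.sum_apply]
    rw [h3]
    have h4 : push3 R (∑ a, A.2 a • ψ a) = ∑ a, A.2 a • push3 R (ψ a) := by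
      change push3L R _ = _
      rw [map_sum]; simp only [map_smul]; rfl
    rw [h4]
    refine Eq.trans ?_ this
    funext i j k
    simp [sumPair_apply, Finset.sum_apply]
    rfl
  have hs : sigma 1 epsS A w = fun b c d => (quadN 1 A)⁻¹ * ((A.1 ^ 2 - pair 1 A.2 A.2) * w b c d
      - 2 * A.1 * ∑ a, A.2 a * hodge 1 epsS w a b c d + 2 * (A.2 b * ∑ a, A.2 a * w a c d
        - A.2 c * ∑ a, A.2 a * w a b d + A.2 d * ∑ a, A.2 a * w a b c)) := by
    funext b c d
    simp [sigma, Matrix.one_apply]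
  rw [hs]
  funext b c d
  have c4 := congrFun (congrFun (congrFun (con4 (hodge 1 epsS w)) b) c) d
  have lowi := fun i => congrFun low i
  have coni := fun i j => congrFun (congrFun con i) j
  simp only [sigma, hodge_volOf h.mul_eq h.metric_eq, h.quadN_fr, fr_fst] at c4 lowi coni ⊢
  rw [c4, lowi, lowi, lowi, coni, coni, coni, fr_snd, h.pair_push]
  rw [push_mul_lift2, push_mul_lift2, push_mul_lift2, ← push3_swap01 R _ b c d,
    ← push3_swap01 R _ b d c, ← push3_swap12 R _ b c d]
  have hl : ∀ (k k1 k2 : ℂ) (x y u v t : T3), push3 R (fun i j l => k * (k1 * x i j l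
      - k2 * y i j l + 2 * (u i j l - v i j l + t i j l))) =
      k • (k1 • push3 R x - k2 • push3 R y + (2 : ℂ) • (push3 R u - push3 R v + push3 R t)) := by
    intro k k1 k2 x y u v t
    change push3L R (k • (k1 • x - k2 • y + (2 : ℂ) • (u - v + t))) = _
    simp only [map_smul, map_add, map_sub]
    rfl
  have := congrFun (congrFun (congrFun (hl (quadN 1 A)⁻¹ (A.1 ^ 2 - pair 1 A.2 A.2) (2 * A.1) w
    (fun i j k => ∑ a, A.2 a * hodge 1 epsS w a i j k)
    (fun i j k => A.2 i * ∑ a, A.2 a * w a j k) (fun i j k => A.2 j * ∑ a, A.2 a * w a i k)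
    (fun i j k => A.2 k * ∑ a, A.2 a * w a i j)) b) c) d
  exact this.symm

theorem deltaLow_eq (a : Fin 7) : deltaLow a = push R (fun i => fr P (deltaLow i)) a := by
  have := map_push (fr P) R deltaLow a
  rw [← this]
  have e : push R deltaLow a = (0, R a) := by
    refine Prod.ext ?_ (funext fun j => ?_)
    · simp [push_apply, deltaLow, Prod.fst_sum]
    · simp [push_apply, deltaLow, Prod.snd_sum, Finset.sum_apply]
  rw [e]
  refine Prod.ext rfl (funext fun j => ?_)
  have h2 := congrFun (congrFun h.mul_eq' a) j
  rw [Matrix.mul_apply, Matrix.one_apply] at h2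
  change (if j = a then (1 : ℂ) else 0) = ∑ i, P i j * R a i
  rw [Finset.sum_congr rfl fun i _ => mul_comm (P i j) (R a i), h2]
  simp only [eq_comm]

theorem deltaUp_eq (a : Fin 7) : deltaUp g a = push P.transpose (fun i => fr P (deltaLow i)) a := by
  have e1 : deltaUp g a = push g⁻¹ deltaLow a := by
    refine Prod.ext ?_ (funext fun j => ?_)
    · simp [push_apply, deltaLow, deltaUp, Prod.fst_sum]
    · simp [push_apply, deltaLow, deltaUp, Prod.snd_sum, Finset.sum_apply]
  have hd : deltaLow = push R (fun i => fr P (deltaLow i)) := funext h.deltaLow_eq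
  rw [e1]
  conv_lhs => rw [hd]
  rw [push_push, h.inv_mul]

end IsFrame

/-- The iterated product `δ_b (δ_c (δ_d A))`. -/
noncomputable def delta3 (g : Mat) (w : T3) (δ : Fin 7 → Bioct) (A : Bioct) (b c d : Fin 7) : Bioct :=
  octMul g w (δ b) (octMul g w (δ c) (octMul g w (δ d) A))

theorem wedge13_push (q : T1) (w : T3) :
    wedge13 (push R q) (push3 R w) = lift4 R (wedge13 q w) := by
  funext a b c d
  have e : wedge13 q w = (fun i j k l => q i * w j k l) - (fun i j k l => q j * w i k l)
      + (fun i j k l => q k * w i j l) - (fun i j k l => q l * w i j k) := rfl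
  have e2 : lift4 R (wedge13 q w) = lift4 R (fun i j k l => q i * w j k l)
      - lift4 R (fun i j k l => q j * w i k l) + lift4 R (fun i j k l => q k * w i j l)
      - lift4 R (fun i j k l => q l * w i j k) := by
    rw [e]
    change lift4L R _ = _
    rw [map_sub, map_add, map_sub]; rfl
  rw [e2]
  simp only [wedge13, push_mul_push3, Pi.sub_apply, Pi.add_apply]
  rw [← lift4_swap01 R _ a b c d, ← lift4_swap01 R _ a c b d, ← lift4_swap12 R _ a b c d,
    ← lift4_swap01 R _ a d b c, ← lift4_swap12 R _ a b d c, ← lift4_swap23 R _ a b c d]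

theorem octMul_push_left (g : Mat) (w : T3) (Q : Mat) (δ : Fin 7 → Bioct) (b : Fin 7) (A : Bioct) :
    octMul g w (push Q δ b) A = ∑ i, Q b i • octMul g w (δ i) A := by
  simp only [push_apply, octMul_sum_left, octMul_smul_left]

/-- Iterated products are multilinear in the vectors `δ`, so they form a tensor with values in the
bioctonions; this is why `push` allows module-valued tensors. -/
theorem delta3_push (g : Mat) (w : T3) (Q : Mat) (δ : Fin 7 → Bioct) (A : Bioct) :
    delta3 g w (push Q δ) A = push3 Q (delta3 g w δ A) := by
  funext b c d
  rw [delta3, octMul_push_left, push3_apply]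
  refine Finset.sum_congr rfl fun i _ => congrArg _ ?_
  rw [octMul_push_left, octMul_sum_right]
  refine Finset.sum_congr rfl fun j _ => ?_
  rw [octMul_smul_right]
  refine congrArg _ ?_
  simp only [octMul_push_left, octMul_sum_right, octMul_smul_right, delta3]

theorem delta4_push (g : Mat) (w : T3) (Q : Mat) (δ : Fin 7 → Bioct) (A : Bioct) (a b c d : Fin 7) :
    octMul g w (push Q δ a) (delta3 g w (push Q δ) A b c d)
      = lift4 Q (fun i j k l => octMul g w (δ i) (delta3 g w δ A j k l)) a b c d := by
  rw [delta3_push, octMul_push_left, lift4_apply]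
  simp only [push3_apply, octMul_sum_right, octMul_smul_right]

namespace IsFrame

variable {P R g : Mat} (h : IsFrame P R g)
include h

theorem opG4_fr (w : T3) (G : T4) (A : Bioct) :
    opG4 g (push3 R w) (lift4 R G) (fr P A) = fr P (opG4 1 w G A) := by
  have hd : deltaUp g = push P.transpose (fun i => fr P (deltaLow i)) := funext h.deltaUp_eq
  have e1 : opG4 g (push3 R w) (lift4 R G) (fr P A) = (-(1 / 144) : ℂ) • ∑ a, ∑ b, ∑ c, ∑ d,
      lift4 R G a b c d • octMul g (push3 R w) (deltaUp g a)
        (delta3 g (push3 R w) (deltaUp g) (fr P A) b c d) := by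
    simp only [opG4, delta3]
  rw [e1, hd]
  simp only [delta4_push]
  rw [sum_lift4_smul_lift4 h.transpose_mul', opG4]
  simp only [delta3, h.octMul_fr, map_smul, map_sum]
  have h1 : ∀ a, deltaUp 1 a = deltaLow a := fun a => by
    simp [deltaUp, deltaLow, Matrix.one_apply, eq_comm]
  simp only [h1]

theorem opG3_fr (w : T3) (G : T4) (A : Bioct) (a : Fin 7) :
    opG3 g (push3 R w) (lift4 R G) a (fr P A) = push R (fun i => fr P (opG3 1 w G i A)) a := by
  have hd : deltaUp g = push P.transpose (fun i => fr P (deltaLow i)) := funext h.deltaUp_eq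
  have e1 : opG3 g (push3 R w) (lift4 R G) a (fr P A) = (-(1 / 144) : ℂ) • ∑ b, ∑ c, ∑ d,
      lift4 R G a b c d • (delta3 g (push3 R w) (deltaUp g) (fr P A) b c d) := by
    simp only [opG3, delta3]
  have e2 : lift4 R G a = push3 R (push R G a) := (map_push (push3L R) R G a).symm
  rw [e1, hd, e2]
  simp only [delta3_push]
  rw [sum_push3_smul_push3 h.transpose_mul']
  have h1 : ∀ a, deltaUp 1 a = deltaLow a := fun a => by
    simp [deltaUp, deltaLow, Matrix.one_apply, eq_comm]
  simp only [delta3, h.octMul_fr, opG3, map_smul, map_sum, h1, push_apply, Finset.sum_apply,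
    Pi.smul_apply, Finset.sum_smul, Finset.smul_sum, smul_eq_mul, smul_smul]
  symm
  rw [Finset.sum_comm]
  refine Finset.sum_congr rfl fun i _ => ?_
  rw [Finset.sum_comm]
  refine Finset.sum_congr rfl fun j _ => ?_
  rw [Finset.sum_comm]
  exact Finset.sum_congr rfl fun k _ => Finset.sum_congr rfl fun l _ => by congr 1; ring

theorem contract_push (q : T1) (w : T3) :
    contract g (push R q) (push3 R w) = lift2 R (contract 1 q w) := by
  have e1 : contract g (push R q) (push3 R w)
      = ∑ c, push P.transpose q c • push R (fun i => lift2 R (w i)) c := by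
    rw [← h.inv_mul, ← push_push]
    funext a b
    simp only [contract, push_apply g⁻¹, Finset.sum_apply, Pi.smul_apply, smul_eq_mul,
      Finset.sum_mul]
    rfl
  have e2 : contract 1 q w = ∑ c, q c • w c := by
    funext a b
    simp [contract, Matrix.one_apply, Finset.sum_apply]
  rw [e1, e2, sum_push_smul_push h.transpose_mul]
  change _ = lift2L R _
  rw [map_sum]; simp only [map_smul]; rfl

theorem iota_lift (ψ : T4) (q : T2) :
    iota g (lift4 R ψ) (lift2 R q) = lift4 R (iota 1 ψ q) := by
  set K : T4 := fun a b c d => ∑ m, q a m * ψ m b c d with hK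
  have up : ∀ a m, ∑ n, g⁻¹ m n * lift2 R q a n = push P.transpose (push R q a) m := by
    intro a m
    rw [← h.inv_mul, ← push_push, map_push (push R)]
    rfl
  have e1 : ∀ a b c d, ∑ m, push P.transpose (push R q a) m * lift4 R ψ m b c d
      = lift4 R K a b c d := by
    intro a b c d
    have h1 := congrFun (congrFun (congrFun (sum_push_smul_push h.transpose_mul (push R q a)
      (fun i => push3 R (ψ i))) b) c) d
    have h2 : lift4 R K = push R (fun x => ∑ i, q x i • push3 R (ψ i)) := by
      unfold lift4
      congr 1
      funext x
      have : K x = ∑ i, q x i • ψ i := by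
        funext b c d; simp [hK, Finset.sum_apply]
      rw [this]
      change push3L R _ = _
      rw [map_sum]; simp only [map_smul]; rfl
    rw [h2]
    simp only [Finset.sum_apply, Pi.smul_apply, smul_eq_mul] at h1
    refine h1.trans ?_
    simp only [push_apply, Finset.sum_apply, Pi.smul_apply, smul_eq_mul, Finset.sum_mul,
      Finset.mul_sum]
    rw [Finset.sum_comm]
    exact Finset.sum_congr rfl fun i _ => Finset.sum_congr rfl fun j _ => by ring
  have e : iota 1 ψ q = (1 / 4 : ℂ) • (K - (fun i j k l => K j i k l) + (fun i j k l => K k i j l)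
      - (fun i j k l => K l i j k)) := by
    funext a b c d
    simp [iota, hK, Matrix.one_apply, Finset.sum_add_distrib, Finset.sum_sub_distrib]
  have e2 : lift4 R (iota 1 ψ q) = (1 / 4 : ℂ) • (lift4 R K - lift4 R (fun i j k l => K j i k l)
      + lift4 R (fun i j k l => K k i j l) - lift4 R (fun i j k l => K l i j k)) := by
    rw [e]
    change lift4L R _ = _
    rw [map_smul, map_sub, map_add, map_sub]; rfl
  funext a b c d
  rw [e2]
  simp only [iota, up, Finset.sum_add_distrib, Finset.sum_sub_distrib, e1, Pi.sub_apply,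
    Pi.add_apply, Pi.smul_apply, smul_eq_mul]
  rw [← lift4_swap01 R _ a b c d, ← lift4_swap01 R _ a c b d, ← lift4_swap12 R _ a b c d,
    ← lift4_swap01 R _ a d b c, ← lift4_swap12 R _ a b d c, ← lift4_swap23 R _ a b c d]

theorem sum_raise_push3 (X : T3) (ψ : T4) (m : Fin 7) :
    ∑ b, ∑ c, ∑ d, ∑ m', ∑ b', ∑ c', ∑ d', push3 R X b c d *
      (g⁻¹ m m' * g⁻¹ b b' * g⁻¹ c c' * g⁻¹ d d' * lift4 R ψ m' b' c' d')
      = push P.transpose (fun i => ∑ j, ∑ k, ∑ l, X j k l * ψ i j k l) m := by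
  have e1 : ∀ b c d, ∑ m', ∑ b', ∑ c', ∑ d', push3 R X b c d *
      (g⁻¹ m m' * g⁻¹ b b' * g⁻¹ c c' * g⁻¹ d d' * lift4 R ψ m' b' c' d')
      = push3 R X b c d * push3 P.transpose (push P.transpose ψ m) b c d := by
    intro b c d
    have e2 : push3 P.transpose (push P.transpose ψ m) = lift4 P.transpose ψ m :=
      map_push (push3L P.transpose) P.transpose ψ m
    rw [e2, ← h.inv_mul, ← lift4_lift4, lift4_apply g⁻¹]
    simp only [smul_eq_mul, Finset.mul_sum]
    exact Finset.sum_congr rfl fun i _ => Finset.sum_congr rfl fun j _ =>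
      Finset.sum_congr rfl fun k _ => Finset.sum_congr rfl fun l _ => by ring
  simp only [e1]
  have e3 := sum_push3_smul_push3 h.transpose_mul' X (push P.transpose ψ m)
  simp only [smul_eq_mul] at e3
  rw [e3]
  simp only [push_apply, Finset.sum_apply, Pi.smul_apply, smul_eq_mul, Finset.mul_sum]
  symm
  rw [Finset.sum_comm]
  refine Finset.sum_congr rfl fun i _ => ?_
  rw [Finset.sum_comm]
  refine Finset.sum_congr rfl fun j _ => ?_
  rw [Finset.sum_comm]
  exact Finset.sum_congr rfl fun k _ => Finset.sum_congr rfl fun l _ => by ring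

theorem trace_lift2 (q : T2) : ∑ a, ∑ b, g⁻¹ a b * lift2 R q a b = ∑ i, q i i := by
  have e : ∀ a b, g⁻¹ a b = lift2 P.transpose (fun i j => if i = j then 1 else 0) a b := by
    intro a b
    rw [h.inv_eq, lift2_apply]
    simp [Matrix.mul_apply]
  simp only [e]
  have := sum_lift2_smul_lift2 h.transpose_mul (fun i j => if i = j then 1 else 0) q
  simp only [smul_eq_mul] at this
  rw [this]
  simp

end IsFrame


/-! ## Contractions of the standard forms -/

theorem phiI_contract_two : ∀ a b, ∑ c, ∑ d, phiI a c d * phiI b c d = if a = b then 6 else 0 := by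
  decide +kernel

theorem phiI_psiI_contract_two :
    ∀ a b l, ∑ c, ∑ d, phiI a c d * psiI l b c d = 4 * phiI a l b := by
  decide +kernel

theorem phiI_psiI_contract_three : ∀ l, ∑ b, ∑ c, ∑ d, phiI b c d * psiI l b c d = 0 := by
  decide +kernel

theorem psiI_contract_two : ∀ a b c d, ∑ e, ∑ f, psiI a b e f * psiI c d e f =
    4 * (if a = c ∧ b = d then 1 else 0) - 4 * (if a = d ∧ b = c then 1 else 0)
      + 2 * psiI a b c d := by
  decide +kernel

theorem psiI_contract_three : ∀ a b, ∑ c, ∑ d, ∑ e, psiI a c d e * psiI b c d e =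
    if a = b then 24 else 0 := by
  decide +kernel

theorem phiS_contract_two (a b : Fin 7) :
    ∑ c, ∑ d, phiS a c d * phiS b c d = if a = b then 6 else 0 := by
  simp only [phiS_eq]; exact_mod_cast phiI_contract_two a b

theorem phiS_psiS_contract_two (a b l : Fin 7) :
    ∑ c, ∑ d, phiS a c d * psiS l b c d = 4 * phiS a l b := by
  simp only [phiS_eq, psiS_eq]; exact_mod_cast phiI_psiI_contract_two a b l

theorem phiS_psiS_contract_three (l : Fin 7) :
    ∑ b, ∑ c, ∑ d, phiS b c d * psiS l b c d = 0 := by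
  simp only [phiS_eq, psiS_eq]; exact_mod_cast phiI_psiI_contract_three l

theorem psiS_contract_two (a b c d : Fin 7) : ∑ e, ∑ f, psiS a b e f * psiS c d e f =
    4 * (if a = c ∧ b = d then 1 else 0) - 4 * (if a = d ∧ b = c then 1 else 0)
      + 2 * psiS a b c d := by
  simp only [psiS_eq]; exact_mod_cast psiI_contract_two a b c d

theorem psiS_contract_three (a b : Fin 7) : ∑ c, ∑ d, ∑ e, psiS a c d e * psiS b c d e =
    if a = b then 24 else 0 := by
  simp only [psiS_eq]; exact_mod_cast psiI_contract_three a b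

/-! ## The component `Λ³₇` -/

/-- The 3-form `2 T ⌟ ψ`. -/
noncomputable def twoContractPsi (T : T1) : T3 := fun b c d => 2 * ∑ e, T e * psiS e b c d

theorem alt3_twoContractPsi (T : T1) : Alt3 (twoContractPsi T) where
  swap01 a b c := by
    simp only [twoContractPsi]
    rw [Finset.sum_congr rfl fun e _ => by rw [alt4_psiS.swap12 e a b c]]
    simp
  swap12 a b c := by
    simp only [twoContractPsi]
    rw [Finset.sum_congr rfl fun e _ => by rw [alt4_psiS.swap23 e a b c]]
    simp

/-- The associator of the octonions is given by `ψ`. This translates statements about `∇φ` into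
statements about associators. -/
theorem cross_twoContractPsi (T : T1) (A B : Bioct) :
    ((0, cross 1 (twoContractPsi T) A.2 B.2) : Bioct) =
      mulS (mulS A B) (0, T) - mulS A (mulS B (0, T)) := by
  have e : cross 1 (twoContractPsi T) A.2 B.2 = fun a => 2 * (-cross 1 phiS T (cross 1 phiS A.2 B.2) a
      + A.2 a * pair 1 T B.2 - B.2 a * pair 1 T A.2) := by
    funext a
    rw [← sum_psiS, cross_one]
    simp only [twoContractPsi, Finset.mul_sum, Finset.sum_mul]
    symm
    rw [Finset.sum_comm]
    refine Finset.sum_congr rfl fun b _ => ?_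
    rw [Finset.sum_comm]
    exact Finset.sum_congr rfl fun c _ => Finset.sum_congr rfl fun d _ => by ring
  rw [e]
  simp only [mulS_eq, cross_phiS, pair_one, Fin.sum_univ_seven]
  apply bioct_ext <;> simp <;> ring

theorem eq_of_cross_eq {X Y : T3} (h : ∀ α β : T1, cross 1 X α β = cross 1 Y α β) : X = Y := by
  funext a b c
  have := congrFun (h (Pi.single b 1) (Pi.single c 1)) a
  simpa [cross_one, Pi.single_apply] using this

theorem sum_twoContractPsi_mul_psiS (T : T1) (m : Fin 7) :
    ∑ b, ∑ c, ∑ d, twoContractPsi T b c d * psiS m b c d = 48 * T m := by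
  have e : ∑ b, ∑ c, ∑ d, twoContractPsi T b c d * psiS m b c d
      = ∑ e, 2 * T e * ∑ b, ∑ c, ∑ d, psiS e b c d * psiS m b c d := by
    simp only [twoContractPsi, Finset.mul_sum, Finset.sum_mul]
    symm
    rw [Finset.sum_comm]
    refine Finset.sum_congr rfl fun b _ => ?_
    rw [Finset.sum_comm]
    refine Finset.sum_congr rfl fun c _ => ?_
    rw [Finset.sum_comm]
    exact Finset.sum_congr rfl fun d _ => Finset.sum_congr rfl fun i _ => by ring
  rw [e]
  simp only [psiS_contract_three]
  simp
  ring

theorem octMul_scalar_right (g : Mat) (w : T3) (c : ℂ) (A : Bioct) :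
    octMul g w A (c, 0) = c • A := by
  have h1 : cross g w A.2 0 = 0 := (crossL g w A.2).map_zero
  refine Prod.ext ?_ (funext fun a => ?_)
  · simp [octMul, pair, mul_comm]
  · simp [octMul, h1]

theorem octMul_scalar_left (g : Mat) (w : T3) (c : ℂ) (A : Bioct) :
    octMul g w (c, 0) A = c • A := by
  have h1 : cross g w 0 A.2 = 0 := (crossL g w).map_zero₂ A.2
  refine Prod.ext ?_ (funext fun a => ?_)
  · simp [octMul, pair]
  · simp [octMul, h1]

/-- Scalars associate with everything, so only the imaginary part of `W` matters. -/
theorem assoc_imag (g : Mat) (w : T3) (A B W : Bioct) :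
    octMul g w (octMul g w A B) W - octMul g w A (octMul g w B W) =
      octMul g w (octMul g w A B) (0, W.2) - octMul g w A (octMul g w B (0, W.2)) := by
  have hW : W = (W.1, 0) + (0, W.2) := by simp
  conv_lhs => rw [hW]
  simp only [octMul_add_right, octMul_scalar_right, octMul_smul_right]
  abel

/-- A tensor acting as the associator with `W` is `2 W ⌟ ψ`. -/
theorem eq_twoContractPsi_of_assoc {X : T3} {W : Bioct} (h : ∀ A B : Bioct,
    ((0, cross 1 X A.2 B.2) : Bioct) = mulS (mulS A B) W - mulS A (mulS B W)) :
    X = twoContractPsi W.2 := by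
  refine eq_of_cross_eq fun α β => ?_
  have h1 := h (0, α) (0, β)
  rw [assoc_imag, ← cross_twoContractPsi] at h1
  exact congrArg Prod.snd h1

/-- The inequalities orient the swaps, so that they sort indices when used as rewriting rules. -/
theorem Alt3.eq_neg_of_lt {w : T3} (h : Alt3 w) :
    (∀ a b c, b < a → w a b c = -w b a c) ∧ (∀ a b c, c < b → w a b c = -w a c b) ∧
    (∀ a c, w a a c = 0) ∧ (∀ a c, w a c c = 0) :=
  ⟨fun a b c _ => h.swap01 a b c, fun a b c _ => h.swap12 a b c,
    fun a c => self_eq_neg.1 (h.swap01 a a c), fun a c => self_eq_neg.1 (h.swap12 a c c)⟩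

/-- After substituting `ψ = φφ - δδ + δδ`, each delta term repeats an index of the alternating `Y`
and vanishes. -/
theorem sum_psiS_mul (Y : T3) (h : Alt3 Y) (a : Fin 7) :
    ∑ b, ∑ c, ∑ d, psiS a b c d * Y b c d = ∑ b, ∑ e, phiS a b e * ∑ c, ∑ d, phiS e c d * Y b c d := by
  have e : ∀ b, ∑ c, ∑ d, psiS a b c d * Y b c d
      = ∑ e, phiS a b e * ∑ c, ∑ d, phiS e c d * Y b c d := by
    intro b
    have e1 : ∀ c d, psiS a b c d = ∑ e, phiS a b e * phiS e c d
        - (if a = c ∧ b = d then 1 else 0) + (if a = d ∧ b = c then 1 else 0) := by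
      intro c d
      have := phiS_mul_phiS a b c d
      rw [Finset.sum_congr rfl fun e _ => by rw [alt3_phiS.swap01 e c d, alt3_phiS.swap12 c e d, neg_neg],
        this]
      ring
    have z1 : ∀ a c, Y a a c = 0 := fun a c => self_eq_neg.1 (h.swap01 a a c)
    have z2 : ∀ a c, Y a c a = 0 := fun a c => by rw [h.swap12, z1, neg_zero]
    simp only [e1, add_mul, sub_mul, Finset.sum_add_distrib, Finset.sum_sub_distrib]
    simp [ite_and, z1, z2, Finset.mul_sum, Finset.sum_mul]
    symm
    rw [Finset.sum_comm]
    refine Finset.sum_congr rfl fun c _ => ?_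
    rw [Finset.sum_comm]
    exact Finset.sum_congr rfl fun c _ => Finset.sum_congr rfl fun d _ => by ring
  exact Finset.sum_congr rfl fun b _ => e b


set_option maxHeartbeats 4000000 in
/-- A 3-form with no components in `Λ³₁ ⊕ Λ³₂₇` is of the form `2 T ⌟ ψ`. -/
theorem eq_twoContractPsi_of_symm {X : T3} (hX : Alt3 X) (hS : ∀ i l,
    ∑ j, ∑ k, phiS l j k * X i j k + ∑ j, ∑ k, phiS i j k * X l j k = 0) :
    X = twoContractPsi fun e => (1 / 48 : ℂ) * ∑ b, ∑ c, ∑ d, psiS e b c d * X b c d := by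
  suffices h : ∃ T : T1, X = twoContractPsi T by
    obtain ⟨T, rfl⟩ := h
    congr 1
    funext e
    have := sum_twoContractPsi_mul_psiS T e
    simp only [mul_comm (psiS _ _ _ _), this]
    ring
  obtain ⟨s1, s2, z1, z2⟩ := hX.eq_neg_of_lt
  simp only [sum_phiS] at hS
  -- The entries of the symmetric tensor give 28 linear equations for the 35 independent components
  -- of `X`; their solutions form the seven-dimensional space `Λ³₇`.
  have h00 : 4 * X 0 1 2 + 4 * X 0 3 4 + 4 * X 0 5 6 = 0 := by
    have := hS 0 0
    simp [s1, s2, z1, z2] at this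
    linear_combination 2 * this
  have h01 : 2 * X 0 3 5 - 2 * X 0 4 6 + 2 * X 1 3 4 + 2 * X 1 5 6 = 0 := by
    have := hS 0 1
    simp [s1, s2, z1, z2] at this
    linear_combination this
  have h02 : - 2 * X 0 3 6 - 2 * X 0 4 5 + 2 * X 2 3 4 + 2 * X 2 5 6 = 0 := by
    have := hS 0 2
    simp [s1, s2, z1, z2] at this
    linear_combination this
  have h03 : - 2 * X 0 1 5 + 2 * X 0 2 6 + 2 * X 1 2 3 + 2 * X 3 5 6 = 0 := by
    have := hS 0 3
    simp [s1, s2, z1, z2] at this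
    linear_combination this
  have h04 : 2 * X 0 1 6 + 2 * X 0 2 5 + 2 * X 1 2 4 + 2 * X 4 5 6 = 0 := by
    have := hS 0 4
    simp [s1, s2, z1, z2] at this
    linear_combination this
  have h05 : 2 * X 0 1 3 - 2 * X 0 2 4 + 2 * X 1 2 5 + 2 * X 3 4 5 = 0 := by
    have := hS 0 5
    simp [s1, s2, z1, z2] at this
    linear_combination this
  have h06 : - 2 * X 0 1 4 - 2 * X 0 2 3 + 2 * X 1 2 6 + 2 * X 3 4 6 = 0 := by
    have := hS 0 6
    simp [s1, s2, z1, z2] at this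
    linear_combination this
  have h11 : 4 * X 0 1 2 + 4 * X 1 3 5 - 4 * X 1 4 6 = 0 := by
    have := hS 1 1
    simp [s1, s2, z1, z2] at this
    linear_combination 2 * this
  have h12 : - 2 * X 1 3 6 - 2 * X 1 4 5 + 2 * X 2 3 5 - 2 * X 2 4 6 = 0 := by
    have := hS 1 2
    simp [s1, s2, z1, z2] at this
    linear_combination this
  have h13 : 2 * X 0 1 4 - 2 * X 0 2 3 + 2 * X 1 2 6 - 2 * X 3 4 6 = 0 := by
    have := hS 1 3
    simp [s1, s2, z1, z2] at this
    linear_combination this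
  have h14 : - 2 * X 0 1 3 - 2 * X 0 2 4 + 2 * X 1 2 5 - 2 * X 3 4 5 = 0 := by
    have := hS 1 4
    simp [s1, s2, z1, z2] at this
    linear_combination this
  have h15 : 2 * X 0 1 6 - 2 * X 0 2 5 - 2 * X 1 2 4 + 2 * X 4 5 6 = 0 := by
    have := hS 1 5
    simp [s1, s2, z1, z2] at this
    linear_combination this
  have h16 : - 2 * X 0 1 5 - 2 * X 0 2 6 - 2 * X 1 2 3 + 2 * X 3 5 6 = 0 := by
    have := hS 1 6
    simp [s1, s2, z1, z2] at this
    linear_combination this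
  have h22 : 4 * X 0 1 2 - 4 * X 2 3 6 - 4 * X 2 4 5 = 0 := by
    have := hS 2 2
    simp [s1, s2, z1, z2] at this
    linear_combination 2 * this
  have h23 : 2 * X 0 1 3 + 2 * X 0 2 4 + 2 * X 1 2 5 - 2 * X 3 4 5 = 0 := by
    have := hS 2 3
    simp [s1, s2, z1, z2] at this
    linear_combination this
  have h24 : 2 * X 0 1 4 - 2 * X 0 2 3 - 2 * X 1 2 6 + 2 * X 3 4 6 = 0 := by
    have := hS 2 4
    simp [s1, s2, z1, z2] at this
    linear_combination this
  have h25 : 2 * X 0 1 5 + 2 * X 0 2 6 - 2 * X 1 2 3 + 2 * X 3 5 6 = 0 := by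
    have := hS 2 5
    simp [s1, s2, z1, z2] at this
    linear_combination this
  have h26 : 2 * X 0 1 6 - 2 * X 0 2 5 + 2 * X 1 2 4 - 2 * X 4 5 6 = 0 := by
    have := hS 2 6
    simp [s1, s2, z1, z2] at this
    linear_combination this
  have h33 : 4 * X 0 3 4 + 4 * X 1 3 5 - 4 * X 2 3 6 = 0 := by
    have := hS 3 3
    simp [s1, s2, z1, z2] at this
    linear_combination 2 * this
  have h34 : - 2 * X 1 3 6 + 2 * X 1 4 5 - 2 * X 2 3 5 - 2 * X 2 4 6 = 0 := by
    have := hS 3 4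
    simp [s1, s2, z1, z2] at this
    linear_combination this
  have h35 : 2 * X 0 3 6 - 2 * X 0 4 5 + 2 * X 2 3 4 - 2 * X 2 5 6 = 0 := by
    have := hS 3 5
    simp [s1, s2, z1, z2] at this
    linear_combination this
  have h36 : - 2 * X 0 3 5 - 2 * X 0 4 6 + 2 * X 1 3 4 - 2 * X 1 5 6 = 0 := by
    have := hS 3 6
    simp [s1, s2, z1, z2] at this
    linear_combination this
  have h44 : 4 * X 0 3 4 - 4 * X 1 4 6 - 4 * X 2 4 5 = 0 := by
    have := hS 4 4
    simp [s1, s2, z1, z2] at this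
    linear_combination 2 * this
  have h45 : 2 * X 0 3 5 + 2 * X 0 4 6 + 2 * X 1 3 4 - 2 * X 1 5 6 = 0 := by
    have := hS 4 5
    simp [s1, s2, z1, z2] at this
    linear_combination this
  have h46 : 2 * X 0 3 6 - 2 * X 0 4 5 - 2 * X 2 3 4 + 2 * X 2 5 6 = 0 := by
    have := hS 4 6
    simp [s1, s2, z1, z2] at this
    linear_combination this
  have h55 : 4 * X 0 5 6 + 4 * X 1 3 5 - 4 * X 2 4 5 = 0 := by
    have := hS 5 5
    simp [s1, s2, z1, z2] at this
    linear_combination 2 * this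
  have h56 : 2 * X 1 3 6 - 2 * X 1 4 5 - 2 * X 2 3 5 - 2 * X 2 4 6 = 0 := by
    have := hS 5 6
    simp [s1, s2, z1, z2] at this
    linear_combination this
  have h66 : 4 * X 0 5 6 - 4 * X 1 4 6 - 4 * X 2 3 6 = 0 := by
    have := hS 6 6
    simp [s1, s2, z1, z2] at this
    linear_combination 2 * this
  -- Each `T_e` is read off from a single component `X_{bcd}` with `ψ_{ebcd} = ±1`; the remaining
  -- components then follow from the 28 equations.
  refine ⟨![-(X 1 3 6 / 2), (X 0 3 6 / 2), (X 0 3 5 / 2), -(X 0 1 6 / 2), -(X 0 1 5 / 2), (X 0 1 4 / 2), (X 0 1 3 / 2)], ?_⟩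
  refine Alt3.ext hX (alt3_twoContractPsi _) ?_
  simp only [twoContractPsi, psiS_eq, Fin.sum_univ_seven]
  apply forall_lt_three
  · simp [psiI, crossIdx, crossSgn]
    linear_combination 1/12 * h00 + 1/12 * h11 + 1/12 * h22 - 1/24 * h33 - 1/24 * h44 - 1/24 * h55 - 1/24 * h66
  · simp [psiI, crossIdx, crossSgn]
    linear_combination 0
  · simp [psiI, crossIdx, crossSgn]
    linear_combination 0
  · simp [psiI, crossIdx, crossSgn]
    linear_combination 0
  · simp [psiI, crossIdx, crossSgn]
    linear_combination 0
  · simp [psiI, crossIdx, crossSgn]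
    linear_combination - 1/4 * h13 - 1/4 * h24
  · simp [psiI, crossIdx, crossSgn]
    linear_combination - 1/4 * h14 + 1/4 * h23
  · simp [psiI, crossIdx, crossSgn]
    linear_combination - 1/4 * h15 - 1/4 * h26
  · simp [psiI, crossIdx, crossSgn]
    linear_combination - 1/4 * h16 + 1/4 * h25
  · simp [psiI, crossIdx, crossSgn]
    linear_combination 1/12 * h00 - 1/24 * h11 - 1/24 * h22 + 1/12 * h33 + 1/12 * h44 - 1/24 * h55 - 1/24 * h66
  · simp [psiI, crossIdx, crossSgn]
    linear_combination 0
  · simp [psiI, crossIdx, crossSgn]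
    linear_combination 0
  · simp [psiI, crossIdx, crossSgn]
    linear_combination - 1/4 * h35 - 1/4 * h46
  · simp [psiI, crossIdx, crossSgn]
    linear_combination - 1/4 * h36 + 1/4 * h45
  · simp [psiI, crossIdx, crossSgn]
    linear_combination 1/12 * h00 - 1/24 * h11 - 1/24 * h22 - 1/24 * h33 - 1/24 * h44 + 1/12 * h55 + 1/12 * h66
  · simp [psiI, crossIdx, crossSgn]
    linear_combination 1/4 * h03 - 1/4 * h25
  · simp [psiI, crossIdx, crossSgn]
    linear_combination 1/4 * h04 + 1/4 * h26
  · simp [psiI, crossIdx, crossSgn]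
    linear_combination 1/4 * h05 + 1/4 * h23
  · simp [psiI, crossIdx, crossSgn]
    linear_combination 1/4 * h06 - 1/4 * h24
  · simp [psiI, crossIdx, crossSgn]
    linear_combination 1/4 * h01 + 1/4 * h45
  · simp [psiI, crossIdx, crossSgn]
    linear_combination - 1/24 * h00 + 1/12 * h11 - 1/24 * h22 + 1/12 * h33 - 1/24 * h44 + 1/12 * h55 - 1/24 * h66
  · simp [psiI, crossIdx, crossSgn]
    linear_combination 0
  · simp [psiI, crossIdx, crossSgn]
    linear_combination 1/4 * h34 - 1/4 * h56
  · simp [psiI, crossIdx, crossSgn]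
    linear_combination 1/24 * h00 - 1/12 * h11 + 1/24 * h22 + 1/24 * h33 - 1/12 * h44 + 1/24 * h55 - 1/12 * h66
  · simp [psiI, crossIdx, crossSgn]
    linear_combination 1/4 * h01 - 1/4 * h36
  · simp [psiI, crossIdx, crossSgn]
    linear_combination 1/4 * h02 - 1/4 * h46
  · simp [psiI, crossIdx, crossSgn]
    linear_combination 1/4 * h12 - 1/4 * h56
  · simp [psiI, crossIdx, crossSgn]
    linear_combination 1/24 * h00 + 1/24 * h11 - 1/12 * h22 - 1/12 * h33 + 1/24 * h44 + 1/24 * h55 - 1/12 * h66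
  · simp [psiI, crossIdx, crossSgn]
    linear_combination 1/24 * h00 + 1/24 * h11 - 1/12 * h22 + 1/24 * h33 - 1/12 * h44 - 1/12 * h55 + 1/24 * h66
  · simp [psiI, crossIdx, crossSgn]
    linear_combination - 1/4 * h12 - 1/4 * h34
  · simp [psiI, crossIdx, crossSgn]
    linear_combination 1/4 * h02 - 1/4 * h35
  · simp [psiI, crossIdx, crossSgn]
    linear_combination 1/4 * h05 - 1/4 * h14
  · simp [psiI, crossIdx, crossSgn]
    linear_combination 1/4 * h06 - 1/4 * h13
  · simp [psiI, crossIdx, crossSgn]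
    linear_combination 1/4 * h03 + 1/4 * h16
  · simp [psiI, crossIdx, crossSgn]
    linear_combination 1/4 * h04 + 1/4 * h15


/-! ## Clifford contractions of a 4-form -/

theorem deltaUp_one (i : Fin 7) : deltaUp 1 i = deltaLow i := by
  refine Prod.ext rfl (funext fun j => ?_)
  simp [deltaUp, deltaLow, Matrix.one_apply, eq_comm]

theorem mulS_deltaLow (b : Fin 7) (A : Bioct) :
    mulS (deltaLow b) A = (-A.2 b, fun a => (if a = b then A.1 else 0) + ∑ m, phiS a b m * A.2 m) := by
  refine Prod.ext ?_ (funext fun a => ?_)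
  · simp [octMul, deltaLow, pair_one]
  · have : ∀ x y m : Fin 7, phiS a x m * (if x = b then (1 : ℂ) else 0) * A.2 m
        = if x = b then phiS a x m * A.2 m else 0 := fun x y m => by split_ifs <;> simp
    simp only [octMul, deltaLow, cross_one, zero_mul, zero_add, mul_ite, mul_one, mul_zero, ite_mul]
    rw [Finset.sum_comm]
    simp

/-- The contraction of a 3-form with the standard 3-form. -/
noncomputable def phiContract (Y : T3) : ℂ := ∑ b, ∑ c, ∑ d, phiS b c d * Y b c d

/-- The contraction of a 3-form with the standard 4-form. -/
noncomputable def psiContract (Y : T3) (l : Fin 7) : ℂ := ∑ b, ∑ c, ∑ d, psiS l b c d * Y b c d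

/-- Here `δ_c δ_d` has scalar part `-δ_{cd}`, which the antisymmetry of `Y` kills, and imaginary
part `φ_{mcd}`. Multiplying by `δ_b` gives the scalar `-φ·Y` and a product `φφ`, which
`sum_psiS_mul` turns into `ψ`. -/
theorem sum_mulS_mulS (Y : T3) (hY : Alt3 Y) :
    ∑ b, ∑ c, ∑ d, Y b c d • mulS (deltaLow b) (mulS (deltaLow c) (mulS (deltaLow d) (1, 0)))
      = (-phiContract Y, psiContract Y) := by
  have e1 : ∀ c d, mulS (deltaLow c) (mulS (deltaLow d) (1, 0))
      = ((if c = d then -1 else 0), fun m => phiS m c d) := by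
    intro c d
    have h1 : mulS (deltaLow d) (1, 0) = deltaLow d :=
      (octMul_scalar_right 1 phiS 1 (deltaLow d)).trans (one_smul ℂ _)
    rw [h1, mulS_deltaLow]
    refine Prod.ext ?_ (funext fun m => ?_)
    · simp only [deltaLow]; split_ifs <;> simp
    · simp [deltaLow]
  have e2 : ∀ b, ∑ c, ∑ d, Y b c d • mulS (deltaLow b) (mulS (deltaLow c) (mulS (deltaLow d) (1, 0)))
      = mulS (deltaLow b) (0, fun m => ∑ c, ∑ d, phiS m c d * Y b c d) := by
    intro b
    have h0 : ∀ c, Y b c c = 0 := fun c => self_eq_neg.1 (hY.swap12 b c c)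
    simp only [e1, ← octMul_smul_right, ← octMul_sum_right]
    congr 1
    refine Prod.ext ?_ (funext fun m => ?_)
    · simp [Prod.fst_sum, h0]
    · simp [Prod.snd_sum, mul_comm]
  simp only [e2]
  simp only [mulS_deltaLow]
  refine Prod.ext ?_ (funext fun a => ?_)
  · simp [Prod.fst_sum, phiContract]
  · simp only [Prod.snd_sum, Finset.sum_apply, psiContract, sum_psiS_mul Y hY]
    simp

theorem Alt4.alt3 {G : T4} (h : Alt4 G) (a : Fin 7) : Alt3 (G a) where
  swap01 b c d := h.swap12 a b c d
  swap12 b c d := h.swap23 a b c d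

theorem opG3_one {G : T4} (h : Alt4 G) (a : Fin 7) : opG3 1 phiS G a (1, 0)
    = (-(1 / 144) : ℂ) • (-phiContract (G a), psiContract (G a)) := by
  rw [opG3]
  simp only [deltaUp_one]
  rw [sum_mulS_mulS _ (h.alt3 a)]

theorem opG4_one {G : T4} (h : Alt4 G) : opG4 1 phiS G (1, 0)
    = (-(1 / 144) : ℂ) • (-∑ b, psiContract (G b) b,
      fun m => -phiContract (G m) + ∑ b, ∑ l, phiS m b l * psiContract (G b) l) := by
  rw [opG4]
  have e : ∀ b, ∑ c, ∑ d, ∑ e, G b c d e • mulS (deltaLow b) (mulS (deltaLow c) (mulS (deltaLow d)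
      (mulS (deltaLow e) (1, 0)))) = mulS (deltaLow b) (-phiContract (G b), psiContract (G b)) := by
    intro b
    rw [← sum_mulS_mulS _ (h.alt3 b)]
    simp only [octMul_sum_right, octMul_smul_right]
  simp only [deltaUp_one, e]
  simp only [mulS_deltaLow]
  congr 1
  refine Prod.ext ?_ (funext fun m => ?_)
  · simp [Prod.fst_sum]
  · simp [Prod.snd_sum, Finset.sum_add_distrib]

theorem Alt3.sum_mul_alt {w : T3} (h : Alt3 w) (K : T3) :
    ∑ b, ∑ c, ∑ d, w b c d * (K b c d - K c b d + K d b c) = 3 * ∑ b, ∑ c, ∑ d, w b c d * K b c d := by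
  have e1 : ∑ b, ∑ c, ∑ d, w b c d * K c b d = -∑ b, ∑ c, ∑ d, w b c d * K b c d := by
    rw [Finset.sum_comm]
    simp only [← Finset.sum_neg_distrib]
    refine Finset.sum_congr rfl fun b _ => Finset.sum_congr rfl fun c _ =>
      Finset.sum_congr rfl fun d _ => ?_
    rw [h.swap01 c b d]; ring
  have e2 : ∑ b, ∑ c, ∑ d, w b c d * K d b c = ∑ b, ∑ c, ∑ d, w b c d * K b c d := by
    have : ∀ b, ∑ c, ∑ d, w b c d * K d b c = ∑ d, ∑ c, w b c d * K d b c :=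
      fun b => Finset.sum_comm
    simp only [this]
    rw [Finset.sum_comm]
    refine Finset.sum_congr rfl fun b _ => Finset.sum_congr rfl fun c _ =>
      Finset.sum_congr rfl fun d _ => ?_
    rw [h.swap12 c d b, h.swap01 c b d, neg_neg]
  simp only [mul_add, mul_sub, Finset.sum_add_distrib, Finset.sum_sub_distrib, e1, e2]
  ring

theorem iota_one (ψ : T4) (h : T2) (a b c d : Fin 7) : iota 1 ψ h a b c d =
    (1 / 4 : ℂ) * (∑ m, h a m * ψ m b c d - (∑ m, h b m * ψ m a c d - ∑ m, h c m * ψ m a b d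
      + ∑ m, h d m * ψ m a b c)) := by
  simp only [iota, inv_one, Matrix.one_apply, ite_mul, one_mul, zero_mul, Finset.sum_ite_eq,
    Finset.mem_univ, if_true, Finset.sum_add_distrib, Finset.sum_sub_distrib]
  ring

theorem alt4_iota_psiS (h : T2) : Alt4 (iota 1 psiS h) := by
  have e1 : ∀ x a b c, ∑ m, h x m * psiS m a b c = -∑ m, h x m * psiS m b a c := fun x a b c => by
    rw [← Finset.sum_neg_distrib]
    exact Finset.sum_congr rfl fun m _ => by rw [alt4_psiS.swap12 m a b c, mul_neg]
  have e2 : ∀ x a b c, ∑ m, h x m * psiS m a b c = -∑ m, h x m * psiS m a c b := fun x a b c => by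
    rw [← Finset.sum_neg_distrib]
    exact Finset.sum_congr rfl fun m _ => by rw [alt4_psiS.swap23 m a b c, mul_neg]
  refine ⟨fun a b c d => ?_, fun a b c d => ?_, fun a b c d => ?_⟩ <;> simp only [iota_one]
  · rw [e1 c a b d, e1 d a b c]; ring
  · rw [e1 a b c d, e2 d a b c]; ring
  · rw [e2 a b c d, e2 b a c d]; ring

/-- In the alternation defining `iota`, the index `a` stands on `h` in one term and on `ψ` in three.
Those three agree after contraction with an alternating tensor, hence the factor 3. -/
theorem sum_alt_mul_iota {w : T3} (hw : Alt3 w) (h : T2) (a : Fin 7) :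
    ∑ b, ∑ c, ∑ d, w b c d * iota 1 psiS h a b c d = (1 / 4 : ℂ) *
      (∑ m, h a m * ∑ b, ∑ c, ∑ d, w b c d * psiS m b c d
        - 3 * ∑ b, ∑ m, h b m * ∑ c, ∑ d, w b c d * psiS m a c d) := by
  have e1 : ∀ b c d, w b c d * iota 1 psiS h a b c d = (1 / 4 : ℂ) *
      (∑ m, h a m * (w b c d * psiS m b c d) - w b c d * ((fun x y z => ∑ m, h x m * psiS m a y z) b c d
        - (fun x y z => ∑ m, h x m * psiS m a y z) c b d
        + (fun x y z => ∑ m, h x m * psiS m a y z) d b c)) := by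
    intro b c d
    rw [iota_one]
    have : ∑ m, h a m * (w b c d * psiS m b c d) = w b c d * ∑ m, h a m * psiS m b c d := by
      rw [Finset.mul_sum]; exact Finset.sum_congr rfl fun m _ => by ring
    rw [this]; ring
  simp only [e1, ← Finset.mul_sum, Finset.sum_sub_distrib]
  rw [hw.sum_mul_alt fun x y z => ∑ m, h x m * psiS m a y z]
  refine congrArg₂ (fun x y => (1 / 4 : ℂ) * (x - 3 * y)) ?_ ?_
  · have e2 : ∀ b c, ∑ d, ∑ m, h a m * (w b c d * psiS m b c d)
        = ∑ m, ∑ d, h a m * (w b c d * psiS m b c d) := fun b c => Finset.sum_comm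
    have e3 : ∀ b, ∑ c, ∑ m, ∑ d, h a m * (w b c d * psiS m b c d)
        = ∑ m, ∑ c, ∑ d, h a m * (w b c d * psiS m b c d) := fun b => Finset.sum_comm
    simp only [e2, e3]
    rw [Finset.sum_comm]
    simp only [Finset.mul_sum]
  · refine Finset.sum_congr rfl fun b _ => ?_
    have e2 : ∀ c, ∑ d, w b c d * ∑ m, h b m * psiS m a c d
        = ∑ m, ∑ d, h b m * (w b c d * psiS m a c d) := fun c => by
      rw [Finset.sum_comm]
      simp only [Finset.mul_sum]
      exact Finset.sum_congr rfl fun d _ => Finset.sum_congr rfl fun m _ => by ring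
    simp only [e2]
    rw [Finset.sum_comm]
    simp only [Finset.mul_sum]

theorem phiContract_iota (h : T2) (a : Fin 7) :
    phiContract (iota 1 psiS h a) = -3 * ∑ b, ∑ m, h b m * phiS b m a := by
  rw [phiContract, sum_alt_mul_iota alt3_phiS]
  simp only [phiS_psiS_contract_three]
  simp only [phiS_psiS_contract_two]
  simp only [mul_left_comm _ (4 : ℂ), ← Finset.mul_sum]
  simp only [mul_zero, Finset.sum_const_zero]
  ring

theorem psiContract_iota (h : T2) (a l : Fin 7) : psiContract (iota 1 psiS h a) l =
    3 * h a l + 3 * (∑ m, h m m) * (if a = l then 1 else 0)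
      - (3 / 2) * ∑ b, ∑ m, h b m * psiS m a l b := by
  rw [psiContract, sum_alt_mul_iota (alt4_psiS.alt3 l)]
  have e1 : ∀ m, ∑ b, ∑ c, ∑ d, psiS l b c d * psiS m b c d = if l = m then 24 else 0 :=
    psiS_contract_three l
  have e2 : ∀ b m, ∑ c, ∑ d, psiS l b c d * psiS m a c d = 4 * (if m = l ∧ a = b then 1 else 0)
      - 4 * (if m = b ∧ a = l then 1 else 0) + 2 * psiS m a l b := fun b m => by
    rw [← psiS_contract_two]; simp only [mul_comm]
  simp only [e1, e2, mul_add, mul_sub, Finset.sum_add_distrib, Finset.sum_sub_distrib]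
  have e3 : ∑ b, ∑ m, h b m * (4 * if m = l ∧ a = b then 1 else 0) = 4 * h a l := by
    rw [Finset.sum_eq_single a, Finset.sum_eq_single l] <;> simp +contextual [mul_comm, eq_comm]
  have e4 : ∑ b, ∑ m, h b m * (4 * if m = b ∧ a = l then 1 else 0)
      = 4 * (∑ m, h m m) * (if a = l then 1 else 0) := by
    split_ifs with hal
    · simp [hal, Finset.mul_sum, mul_comm]
    · simp [hal]
  have e5 : ∑ b, ∑ m, h b m * (2 * psiS m a l b) = 2 * ∑ b, ∑ m, h b m * psiS m a l b := by
    simp only [Finset.mul_sum, mul_left_comm _ (2 : ℂ)]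
  rw [e3, e4, e5]
  simp only [mul_ite, mul_zero, Finset.sum_ite_eq, Finset.mem_univ, if_true, mul_one]
  split_ifs <;> ring

theorem contract_one (q : T1) (w : T3) (a b : Fin 7) : contract 1 q w a b = ∑ c, q c * w c a b := by
  simp [contract, Matrix.one_apply]

/-! ## Decomposition of 4-forms -/

theorem sum_phiI_mul_psiI : ∀ e a b c d, a < b → b < c → c < d →
    ∑ m, (phiI e a m * psiI m b c d - phiI e b m * psiI m a c d + phiI e c m * psiI m a b d
      - phiI e d m * psiI m a b c) = -3 * ((if e = a then 1 else 0) * phiI b c d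
        - (if e = b then 1 else 0) * phiI a c d + (if e = c then 1 else 0) * phiI a b d
        - (if e = d then 1 else 0) * phiI a b c) := by
  decide +kernel

/-- By linearity in `q` and antisymmetry the claim reduces to basis covectors and increasing
indices, where it is `sum_phiI_mul_psiI`; the constant is the `-3` there times the weight `1/4` of
`iota`. -/
theorem wedge13_phiS_eq_iota (q : T1) :
    iota 1 psiS (contract 1 q phiS) = (-(3 / 4) : ℂ) • wedge13 q phiS := by
  have hw : Alt4 ((-(3 / 4) : ℂ) • wedge13 q phiS) := by
    refine ⟨fun a b c d => ?_, fun a b c d => ?_, fun a b c d => ?_⟩ <;>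
      simp only [wedge13, Pi.smul_apply, smul_eq_mul]
    · rw [alt3_phiS.swap01 a b d, alt3_phiS.swap01 a b c]; ring
    · rw [alt3_phiS.swap01 b c d, alt3_phiS.swap12 a b c]; ring
    · rw [alt3_phiS.swap12 b c d, alt3_phiS.swap12 a c d]; ring
  refine (alt4_iota_psiS _).ext hw ?_
  intro a b c d hab hbc hcd
  have key : ∀ e, ∑ m, (phiS e a m * psiS m b c d - phiS e b m * psiS m a c d
      + phiS e c m * psiS m a b d - phiS e d m * psiS m a b c) =
      -3 * ((if e = a then 1 else 0) * phiS b c d - (if e = b then 1 else 0) * phiS a c d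
        + (if e = c then 1 else 0) * phiS a b d - (if e = d then 1 else 0) * phiS a b c) := by
    intro e
    simp only [phiS_eq, psiS_eq]
    exact_mod_cast sum_phiI_mul_psiI e a b c d hab hbc hcd
  have e1 : ∀ x y z w, ∑ m, contract 1 q phiS x m * psiS m y z w
      = ∑ e, q e * ∑ m, phiS e x m * psiS m y z w := fun x y z w => by
    simp only [contract_one, Finset.sum_mul, Finset.mul_sum]
    rw [Finset.sum_comm]
    simp only [mul_assoc]
  have e2 := Finset.sum_congr (rfl : (Finset.univ : Finset (Fin 7)) = _)
    fun e _ => congrArg (q e * ·) (key e)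
  simp only [Finset.sum_add_distrib, Finset.sum_sub_distrib, mul_add, mul_sub, ite_mul, one_mul,
    zero_mul, mul_ite, mul_zero, Finset.sum_ite_eq', Finset.mem_univ, if_true] at e2
  simp only [iota_one, e1, wedge13, Pi.smul_apply, smul_eq_mul]
  linear_combination (1 / 4 : ℂ) * e2


theorem sum_symm_mul_skew {h k : T2} (hh : ∀ a b, h a b = h b a) (hk : ∀ a b, k a b = -k b a) :
    ∑ a, ∑ b, h a b * k a b = 0 := by
  apply self_eq_neg.1
  nth_rw 1 [Finset.sum_comm]
  simp only [← Finset.sum_neg_distrib]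
  exact Finset.sum_congr rfl fun a _ => Finset.sum_congr rfl fun b _ => by rw [hh b a, hk b a, mul_neg]

theorem iota_one_add (ψ : T4) (h k : T2) : iota 1 ψ (h + k) = iota 1 ψ h + iota 1 ψ k := by
  funext a b c d
  simp only [Pi.add_apply, iota_one, add_mul, Finset.sum_add_distrib]; ring

theorem iota_one_smul (ψ : T4) (c : ℂ) (h : T2) : iota 1 ψ (c • h) = c • iota 1 ψ h := by
  funext i j k l
  simp only [Pi.smul_apply, smul_eq_mul, iota_one, mul_assoc, ← Finset.mul_sum]; ring

theorem iota_psiS_delta : iota 1 psiS (fun i j => if i = j then 1 else 0) = psiS := by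
  funext a b c d
  simp only [iota_one, ite_mul, one_mul, zero_mul, Finset.sum_ite_eq, Finset.mem_univ, if_true]
  rw [alt4_psiS.swap01 b a c d, alt4_psiS.swap01 c a b d, alt4_psiS.swap12 a c b d,
    alt4_psiS.swap01 d a b c, alt4_psiS.swap12 a d b c, alt4_psiS.swap23 a b d c]
  ring

/-- The 4-form with components `Q₀, Q₁, Q₂` in the standard frame. -/
noncomputable def fluxS (Q₀ : ℂ) (Q₁ : T1) (Q₂ : T2) : T4 :=
  Q₀ • psiS + wedge13 Q₁ phiS + iota 1 psiS ((4 : ℂ) • Q₂)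

theorem fluxS_eq_iota (Q₀ : ℂ) (Q₁ : T1) (Q₂ : T2) : fluxS Q₀ Q₁ Q₂ = iota 1 psiS
    (Q₀ • (fun i j => if i = j then 1 else 0) + (-(4 / 3) : ℂ) • contract 1 Q₁ phiS + (4 : ℂ) • Q₂) := by
  rw [iota_one_add, iota_one_add, iota_one_smul, iota_one_smul _ _ (contract 1 Q₁ phiS),
    iota_psiS_delta, wedge13_phiS_eq_iota, smul_smul, fluxS]
  norm_num

theorem alt4_fluxS (Q₀ : ℂ) (Q₁ : T1) (Q₂ : T2) : Alt4 (fluxS Q₀ Q₁ Q₂) := by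
  rw [fluxS_eq_iota]; exact alt4_iota_psiS _

/-- Contraction with `φ` sees only the skew part of the tensor inside `iota`, namely `-(4/3) Q₁ ⌟
φ`; the constant is `(-3)(-4/3)·6 = 24`. -/
theorem phiContract_fluxS (Q₀ : ℂ) (Q₁ : T1) {Q₂ : T2} (h : ∀ a b, Q₂ a b = Q₂ b a) (a : Fin 7) :
    phiContract (fluxS Q₀ Q₁ Q₂ a) = 24 * Q₁ a := by
  have hs : ∀ b m, phiS b m a = -phiS m b a := fun b m => alt3_phiS.swap01 b m a
  have e1 : ∑ b, ∑ m, (if b = m then (1 : ℂ) else 0) * phiS b m a = 0 :=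
    sum_symm_mul_skew (fun b m => by simp only [eq_comm]) hs
  have e2 : ∑ b, ∑ m, Q₂ b m * phiS b m a = 0 := sum_symm_mul_skew h hs
  have e3 : ∑ b, ∑ m, contract 1 Q₁ phiS b m * phiS b m a = 6 * Q₁ a := by
    have : ∀ b m, contract 1 Q₁ phiS b m * phiS b m a = ∑ c, Q₁ c * (phiS c b m * phiS a b m) := by
      intro b m
      rw [contract_one, Finset.sum_mul, alt3_phiS.swap12 b m a, alt3_phiS.swap01 b a m, neg_neg]
      simp only [mul_assoc]
    simp only [this]
    rw [Finset.sum_congr rfl fun b _ => Finset.sum_comm, Finset.sum_comm]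
    simp only [← Finset.mul_sum, phiS_contract_two]
    simp [mul_comm]
  rw [fluxS_eq_iota, phiContract_iota]
  simp only [Pi.add_apply, Pi.smul_apply, smul_eq_mul, add_mul, mul_assoc, Finset.sum_add_distrib,
    ← Finset.mul_sum, e1, e2, e3]
  ring

/-- The constants come from `psiContract_iota`: `3 + 3·7 = 24` for the metric, `-(4/3)(3 + 6) = -12`
for `Q₁ ⌟ φ`, and `4·3 = 12` for `Q₂`. -/
theorem psiContract_fluxS (Q₀ : ℂ) (Q₁ : T1) {Q₂ : T2} (h : ∀ a b, Q₂ a b = Q₂ b a)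
    (ht : ∑ i, Q₂ i i = 0) (a l : Fin 7) :
    psiContract (fluxS Q₀ Q₁ Q₂ a) l =
      24 * Q₀ * (if a = l then 1 else 0) - 12 * contract 1 Q₁ phiS a l + 12 * Q₂ a l := by
  have hs : ∀ b m, psiS m a l b = -psiS b a l m := fun b m => by
    rw [alt4_psiS.swap23 b, alt4_psiS.swap12 b, alt4_psiS.swap01 b, alt4_psiS.swap12 m b,
      alt4_psiS.swap23 m a b l]
    ring
  have e1 : ∑ b, ∑ m, (if b = m then (1 : ℂ) else 0) * psiS m a l b = 0 :=
    sum_symm_mul_skew (fun b m => by simp only [eq_comm]) hs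
  have e2 : ∑ b, ∑ m, Q₂ b m * psiS m a l b = 0 := sum_symm_mul_skew h hs
  have e3 : ∑ b, ∑ m, contract 1 Q₁ phiS b m * psiS m a l b = -4 * contract 1 Q₁ phiS a l := by
    have : ∀ b m, contract 1 Q₁ phiS b m * psiS m a l b
        = ∑ c, -(Q₁ c * (phiS c b m * psiS a l b m)) := by
      intro b m
      rw [contract_one, Finset.sum_mul, alt4_psiS.swap01 m a, alt4_psiS.swap12 a m,
        alt4_psiS.swap23 a l m]
      exact Finset.sum_congr rfl fun c _ => by ring
    simp only [this]
    rw [Finset.sum_congr rfl fun b _ => Finset.sum_comm, Finset.sum_comm]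
    simp only [Finset.sum_neg_distrib, ← Finset.mul_sum, phiS_psiS_contract_two, contract_one]
    rw [Finset.mul_sum, ← Finset.sum_neg_distrib]
    exact Finset.sum_congr rfl fun c _ => by ring
  have h0 : ∀ i, contract 1 Q₁ phiS i i = 0 := fun i => by
    rw [contract_one]
    exact Finset.sum_eq_zero fun c _ => by rw [self_eq_neg.1 (alt3_phiS.swap12 c i i), mul_zero]
  rw [fluxS_eq_iota, psiContract_iota]
  simp only [Pi.add_apply, Pi.smul_apply, smul_eq_mul, add_mul, mul_assoc, Finset.sum_add_distrib,
    ← Finset.mul_sum, e1, e2, e3, ht, h0]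
  simp
  split_ifs <;> ring

theorem opG3_fluxS (Q₀ : ℂ) (Q₁ : T1) {Q₂ : T2} (h : ∀ a b, Q₂ a b = Q₂ b a)
    (ht : ∑ i, Q₂ i i = 0) (a : Fin 7) : opG3 1 phiS (fluxS Q₀ Q₁ Q₂) a (1, 0) =
      ((1 / 6) * Q₁ a, fun l => -(1 / 6) * Q₀ * (if a = l then 1 else 0)
        + (1 / 12) * contract 1 Q₁ phiS a l - (1 / 12) * Q₂ a l) := by
  rw [opG3_one (alt4_fluxS Q₀ Q₁ Q₂), phiContract_fluxS Q₀ Q₁ h]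
  refine Prod.ext ?_ (funext fun l => ?_)
  · simp only [Prod.smul_fst, smul_eq_mul]; ring
  · simp only [Prod.smul_snd, Pi.smul_apply, smul_eq_mul, psiContract_fluxS Q₀ Q₁ h ht]; ring

theorem opG4_fluxS (Q₀ : ℂ) (Q₁ : T1) {Q₂ : T2} (h : ∀ a b, Q₂ a b = Q₂ b a)
    (ht : ∑ i, Q₂ i i = 0) : opG4 1 phiS (fluxS Q₀ Q₁ Q₂) (1, 0) =
      ((7 / 6) * Q₀, fun m => (2 / 3) * Q₁ m) := by
  rw [opG4_one (alt4_fluxS Q₀ Q₁ Q₂)]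
  have h0 : ∀ i, contract 1 Q₁ phiS i i = 0 := fun i => by
    rw [contract_one]
    exact Finset.sum_eq_zero fun c _ => by rw [self_eq_neg.1 (alt3_phiS.swap12 c i i), mul_zero]
  have e1 : ∀ m, ∑ b, ∑ l, phiS m b l * (if b = l then (1 : ℂ) else 0) = 0 := fun m => by
    simp [fun b => self_eq_neg.1 (alt3_phiS.swap12 m b b)]
  have e2 : ∀ m, ∑ b, ∑ l, phiS m b l * Q₂ b l = 0 := fun m => by
    simp only [mul_comm (phiS _ _ _)]
    exact sum_symm_mul_skew h fun b l => alt3_phiS.swap12 m b l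
  have e3 : ∀ m, ∑ b, ∑ l, phiS m b l * contract 1 Q₁ phiS b l = 6 * Q₁ m := fun m => by
    have : ∀ b l, phiS m b l * contract 1 Q₁ phiS b l = ∑ c, Q₁ c * (phiS c b l * phiS m b l) :=
      fun b l => by
        rw [contract_one, Finset.mul_sum]; exact Finset.sum_congr rfl fun c _ => by ring
    simp only [this]
    rw [Finset.sum_congr rfl fun b _ => Finset.sum_comm, Finset.sum_comm]
    simp only [← Finset.mul_sum, phiS_contract_two]
    simp [mul_comm]
  refine Prod.ext ?_ (funext fun m => ?_)
  · simp only [Prod.smul_fst, smul_eq_mul, psiContract_fluxS Q₀ Q₁ h ht, h0, Finset.sum_add_distrib,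
      Finset.sum_sub_distrib, ← Finset.mul_sum, ht]
    simp
    ring
  · simp only [Prod.smul_snd, Pi.smul_apply, smul_eq_mul, psiContract_fluxS Q₀ Q₁ h ht,
      phiContract_fluxS Q₀ Q₁ h, mul_add, mul_sub, Finset.sum_add_distrib, Finset.sum_sub_distrib,
      mul_left_comm (phiS _ _ _), ← Finset.mul_sum, mul_assoc, e1, e2, e3]
    ring

/-- The flux term of the Killing equation, applied to the unit. -/
theorem flux_term_fluxS (Q₀ : ℂ) (Q₁ : T1) {Q₂ : T2} (h : ∀ a b, Q₂ a b = Q₂ b a)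
    (ht : ∑ i, Q₂ i i = 0) (a : Fin 7) :
    Complex.I • mulS (deltaLow a) (opG4 1 phiS (fluxS Q₀ Q₁ Q₂) (1, 0))
      + (12 * Complex.I) • opG3 1 phiS (fluxS Q₀ Q₁ Q₂) a (1, 0) =
      ((4 / 3) * Complex.I * Q₁ a, fun m => -((5 / 6) * Complex.I * Q₀ * (if a = m then 1 else 0)
        + contract 1 (-(Complex.I / 3) • Q₁) phiS a m + Complex.I * Q₂ a m)) := by
  -- In units of `i`: the real coefficient of `Q₁` is `-2/3 + 12/6 = 4/3`, the coefficient of `Q₀`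
  -- is `7/6 - 12/6 = -5/6`, and that of `Q₁ ⌟ φ` is `-2/3 + 12/12 = 1/3`.
  rw [opG4_fluxS Q₀ Q₁ h ht, opG3_fluxS Q₀ Q₁ h ht, mulS_deltaLow]
  refine Prod.ext ?_ (funext fun m => ?_)
  · simp; ring
  · have e1 : ∑ l, phiS m a l * (2 / 3 * Q₁ l) = -(2 / 3) * ∑ c, Q₁ c * phiS c a m := by
      rw [Finset.mul_sum]
      refine Finset.sum_congr rfl fun c _ => ?_
      rw [alt3_phiS.swap12 m, alt3_phiS.swap01 m, alt3_phiS.swap12 c m]; ring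
    have e2 : ∑ c, -(Complex.I / 3) * Q₁ c * phiS c a m = -(Complex.I / 3) * ∑ c, Q₁ c * phiS c a m := by
      rw [Finset.mul_sum]; exact Finset.sum_congr rfl fun c _ => by ring
    simp only [Prod.snd_add, Prod.smul_snd, Pi.add_apply, Pi.smul_apply, smul_eq_mul, e1,
      contract_one, e2, eq_comm (a := m)]
    split_ifs <;> ring


set_option maxHeartbeats 4000000 in
/-- Every 4-form has components `Q₀, Q₁, Q₂`. -/
theorem exists_fluxS {G : T4} (hG : Alt4 G) : ∃ (Q₀ : ℂ) (Q₁ : T1) (Q₂ : T2),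
    (∀ a b, Q₂ a b = Q₂ b a) ∧ ∑ i, Q₂ i i = 0 ∧ G = fluxS Q₀ Q₁ Q₂ := by
  -- The witnesses invert `phiContract_fluxS` and `psiContract_fluxS`: `Q₀` is `1/168` of the full
  -- contraction with `ψ`, `Q₁` is `1/24` of the contraction with `φ`, and `Q₂` is `1/12` of the
  -- symmetrised `ψ`-contraction minus `2Q₀` times the metric. The entries of `Q₂` are kept opaque,
  -- so that each of the 35 component checks unfolds only those it needs.
  obtain ⟨q00, e00⟩ : ∃ q : ℂ, q =
      (3 / 14) * (-G 0 1 3 6 - G 0 1 4 5 - G 0 2 3 5 + G 0 2 4 6 - 4/3 * G 1 2 3 4 - 4/3 * G 1 2 5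
      6 - 4/3 * G 3 4 5 6) := ⟨_, rfl⟩
  obtain ⟨q01, e01⟩ : ∃ q : ℂ, q =
      (1 / 4) * (G 0 2 3 4 + G 0 2 5 6 - G 1 2 3 5 + G 1 2 4 6) := ⟨_, rfl⟩
  obtain ⟨q02, e02⟩ : ∃ q : ℂ, q =
      (1 / 4) * (-G 0 1 3 4 - G 0 1 5 6 + G 1 2 3 6 + G 1 2 4 5) := ⟨_, rfl⟩
  obtain ⟨q03, e03⟩ : ∃ q : ℂ, q =
      (1 / 4) * (G 0 1 2 4 + G 0 4 5 6 + G 1 3 4 5 - G 2 3 4 6) := ⟨_, rfl⟩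
  obtain ⟨q04, e04⟩ : ∃ q : ℂ, q =
      (1 / 4) * (-G 0 1 2 3 - G 0 3 5 6 - G 1 3 4 6 - G 2 3 4 5) := ⟨_, rfl⟩
  obtain ⟨q05, e05⟩ : ∃ q : ℂ, q =
      (1 / 4) * (G 0 1 2 6 + G 0 3 4 6 - G 1 3 5 6 + G 2 4 5 6) := ⟨_, rfl⟩
  obtain ⟨q06, e06⟩ : ∃ q : ℂ, q =
      (1 / 4) * (-G 0 1 2 5 - G 0 3 4 5 + G 1 4 5 6 + G 2 3 5 6) := ⟨_, rfl⟩
  obtain ⟨q11, e11⟩ : ∃ q : ℂ, q =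
      (3 / 14) * (-G 0 1 3 6 - G 0 1 4 5 + 4/3 * G 0 2 3 5 - 4/3 * G 0 2 4 6 + G 1 2 3 4 + G 1 2 5
      6 - 4/3 * G 3 4 5 6) := ⟨_, rfl⟩
  obtain ⟨q12, e12⟩ : ∃ q : ℂ, q =
      (1 / 4) * (-G 0 1 3 5 + G 0 1 4 6 - G 0 2 3 6 - G 0 2 4 5) := ⟨_, rfl⟩
  obtain ⟨q13, e13⟩ : ∃ q : ℂ, q =
      (1 / 4) * (G 0 1 2 5 - G 0 3 4 5 + G 1 4 5 6 - G 2 3 5 6) := ⟨_, rfl⟩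
  obtain ⟨q14, e14⟩ : ∃ q : ℂ, q =
      (1 / 4) * (-G 0 1 2 6 + G 0 3 4 6 - G 1 3 5 6 - G 2 4 5 6) := ⟨_, rfl⟩
  obtain ⟨q15, e15⟩ : ∃ q : ℂ, q =
      (1 / 4) * (-G 0 1 2 3 + G 0 3 5 6 + G 1 3 4 6 - G 2 3 4 5) := ⟨_, rfl⟩
  obtain ⟨q16, e16⟩ : ∃ q : ℂ, q =
      (1 / 4) * (G 0 1 2 4 - G 0 4 5 6 - G 1 3 4 5 - G 2 3 4 6) := ⟨_, rfl⟩
  obtain ⟨q22, e22⟩ : ∃ q : ℂ, q =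
      (3 / 14) * (4/3 * G 0 1 3 6 + 4/3 * G 0 1 4 5 - G 0 2 3 5 + G 0 2 4 6 + G 1 2 3 4 + G 1 2 5
      6 - 4/3 * G 3 4 5 6) := ⟨_, rfl⟩
  obtain ⟨q23, e23⟩ : ∃ q : ℂ, q =
      (1 / 4) * (-G 0 1 2 6 + G 0 3 4 6 + G 1 3 5 6 + G 2 4 5 6) := ⟨_, rfl⟩
  obtain ⟨q24, e24⟩ : ∃ q : ℂ, q =
      (1 / 4) * (-G 0 1 2 5 + G 0 3 4 5 + G 1 4 5 6 - G 2 3 5 6) := ⟨_, rfl⟩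
  obtain ⟨q25, e25⟩ : ∃ q : ℂ, q =
      (1 / 4) * (G 0 1 2 4 - G 0 4 5 6 + G 1 3 4 5 + G 2 3 4 6) := ⟨_, rfl⟩
  obtain ⟨q26, e26⟩ : ∃ q : ℂ, q =
      (1 / 4) * (G 0 1 2 3 - G 0 3 5 6 + G 1 3 4 6 - G 2 3 4 5) := ⟨_, rfl⟩
  obtain ⟨q33, e33⟩ : ∃ q : ℂ, q =
      (3 / 14) * (-G 0 1 3 6 + 4/3 * G 0 1 4 5 - G 0 2 3 5 - 4/3 * G 0 2 4 6 + G 1 2 3 4 - 4/3 * G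
      1 2 5 6 + G 3 4 5 6) := ⟨_, rfl⟩
  obtain ⟨q34, e34⟩ : ∃ q : ℂ, q =
      (1 / 4) * (-G 0 1 3 5 - G 0 1 4 6 + G 0 2 3 6 - G 0 2 4 5) := ⟨_, rfl⟩
  obtain ⟨q35, e35⟩ : ∃ q : ℂ, q =
      (1 / 4) * (G 0 1 3 4 - G 0 1 5 6 + G 1 2 3 6 - G 1 2 4 5) := ⟨_, rfl⟩
  obtain ⟨q36, e36⟩ : ∃ q : ℂ, q =
      (1 / 4) * (-G 0 2 3 4 + G 0 2 5 6 - G 1 2 3 5 - G 1 2 4 6) := ⟨_, rfl⟩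
  obtain ⟨q44, e44⟩ : ∃ q : ℂ, q =
      (3 / 14) * (4/3 * G 0 1 3 6 - G 0 1 4 5 + 4/3 * G 0 2 3 5 + G 0 2 4 6 + G 1 2 3 4 - 4/3 * G
      1 2 5 6 + G 3 4 5 6) := ⟨_, rfl⟩
  obtain ⟨q45, e45⟩ : ∃ q : ℂ, q =
      (1 / 4) * (-G 0 2 3 4 + G 0 2 5 6 + G 1 2 3 5 + G 1 2 4 6) := ⟨_, rfl⟩
  obtain ⟨q46, e46⟩ : ∃ q : ℂ, q =
      (1 / 4) * (-G 0 1 3 4 + G 0 1 5 6 + G 1 2 3 6 - G 1 2 4 5) := ⟨_, rfl⟩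
  obtain ⟨q55, e55⟩ : ∃ q : ℂ, q =
      (3 / 14) * (4/3 * G 0 1 3 6 - G 0 1 4 5 - G 0 2 3 5 - 4/3 * G 0 2 4 6 - 4/3 * G 1 2 3 4 + G
      1 2 5 6 + G 3 4 5 6) := ⟨_, rfl⟩
  obtain ⟨q56, e56⟩ : ∃ q : ℂ, q =
      (1 / 4) * (-G 0 1 3 5 - G 0 1 4 6 - G 0 2 3 6 + G 0 2 4 5) := ⟨_, rfl⟩
  obtain ⟨q66, e66⟩ : ∃ q : ℂ, q =
      (3 / 14) * (-G 0 1 3 6 + 4/3 * G 0 1 4 5 + 4/3 * G 0 2 3 5 + G 0 2 4 6 - 4/3 * G 1 2 3 4 + G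
      1 2 5 6 + G 3 4 5 6) := ⟨_, rfl⟩
  refine ⟨(1 / 7) * (-G 0 1 3 6 - G 0 1 4 5 - G 0 2 3 5 + G 0 2 4 6 + G 1 2 3 4 + G 1 2 5 6 + G 3 4 5
      6),
    ![(1 / 4) * (G 0 1 3 5 - G 0 1 4 6 - G 0 2 3 6 - G 0 2 4 5),
      (1 / 4) * (-G 0 1 3 4 - G 0 1 5 6 - G 1 2 3 6 - G 1 2 4 5),
      (1 / 4) * (-G 0 2 3 4 - G 0 2 5 6 - G 1 2 3 5 + G 1 2 4 6),
      (1 / 4) * (-G 0 1 2 3 - G 0 3 5 6 + G 1 3 4 6 + G 2 3 4 5),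
      (1 / 4) * (-G 0 1 2 4 - G 0 4 5 6 + G 1 3 4 5 - G 2 3 4 6),
      (1 / 4) * (-G 0 1 2 5 - G 0 3 4 5 - G 1 4 5 6 - G 2 3 5 6),
      (1 / 4) * (-G 0 1 2 6 - G 0 3 4 6 - G 1 3 5 6 + G 2 4 5 6)],
    ![![q00, q01, q02, q03, q04, q05, q06],
      ![q01, q11, q12, q13, q14, q15, q16],
      ![q02, q12, q22, q23, q24, q25, q26],
      ![q03, q13, q23, q33, q34, q35, q36],
      ![q04, q14, q24, q34, q44, q45, q46],
      ![q05, q15, q25, q35, q45, q55, q56],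
      ![q06, q16, q26, q36, q46, q56, q66]], ?_, ?_, ?_⟩
  · intro a b; fin_cases a <;> fin_cases b <;> rfl
  · simp only [Fin.sum_univ_seven]
    simp [e00, e11, e22, e33, e44, e55, e66]
    ring
  · refine hG.ext (alt4_fluxS _ _ _) ?_
    simp only [fluxS, iota_one, wedge13, Pi.add_apply, Pi.smul_apply, smul_eq_mul, psiS_eq, phiS_eq,
      Fin.sum_univ_seven]
    apply forall_lt_four
    · simp [psiI, phiI, crossIdx, crossSgn, e04, e15, e26]
      ring
    · simp [psiI, phiI, crossIdx, crossSgn, e03, e16, e25]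
      ring
    · simp [psiI, phiI, crossIdx, crossSgn, e06, e13, e24]
      ring
    · simp [psiI, phiI, crossIdx, crossSgn, e05, e14, e23]
      ring
    · simp [psiI, phiI, crossIdx, crossSgn, e02, e35, e46]
      ring
    · simp [psiI, phiI, crossIdx, crossSgn, e12, e34, e56]
      ring
    · simp [psiI, phiI, crossIdx, crossSgn, e00, e11, e33, e66]
      ring
    · simp [psiI, phiI, crossIdx, crossSgn, e00, e11, e44, e55]
      ring
    · simp [psiI, phiI, crossIdx, crossSgn, e12, e34, e56]
      ring
    · simp [psiI, phiI, crossIdx, crossSgn, e02, e35, e46]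
      ring
    · simp [psiI, phiI, crossIdx, crossSgn, e01, e36, e45]
      ring
    · simp [psiI, phiI, crossIdx, crossSgn, e00, e22, e33, e55]
      ring
    · simp [psiI, phiI, crossIdx, crossSgn, e12, e34, e56]
      ring
    · simp [psiI, phiI, crossIdx, crossSgn, e12, e34, e56]
      ring
    · simp [psiI, phiI, crossIdx, crossSgn, e00, e22, e44, e66]
      ring
    · simp [psiI, phiI, crossIdx, crossSgn, e01, e36, e45]
      ring
    · simp [psiI, phiI, crossIdx, crossSgn, e06, e13, e24]
      ring
    · simp [psiI, phiI, crossIdx, crossSgn, e05, e14, e23]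
      ring
    · simp [psiI, phiI, crossIdx, crossSgn, e04, e15, e26]
      ring
    · simp [psiI, phiI, crossIdx, crossSgn, e03, e16, e25]
      ring
    · simp [psiI, phiI, crossIdx, crossSgn, e11, e22, e33, e44]
      ring
    · simp [psiI, phiI, crossIdx, crossSgn, e01, e36, e45]
      ring
    · simp [psiI, phiI, crossIdx, crossSgn, e02, e35, e46]
      ring
    · simp [psiI, phiI, crossIdx, crossSgn, e02, e35, e46]
      ring
    · simp [psiI, phiI, crossIdx, crossSgn, e01, e36, e45]
      ring
    · simp [psiI, phiI, crossIdx, crossSgn, e11, e22, e55, e66]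
      ring
    · simp [psiI, phiI, crossIdx, crossSgn, e03, e16, e25]
      ring
    · simp [psiI, phiI, crossIdx, crossSgn, e04, e15, e26]
      ring
    · simp [psiI, phiI, crossIdx, crossSgn, e05, e14, e23]
      ring
    · simp [psiI, phiI, crossIdx, crossSgn, e06, e13, e24]
      ring
    · simp [psiI, phiI, crossIdx, crossSgn, e04, e15, e26]
      ring
    · simp [psiI, phiI, crossIdx, crossSgn, e03, e16, e25]
      ring
    · simp [psiI, phiI, crossIdx, crossSgn, e06, e13, e24]
      ring
    · simp [psiI, phiI, crossIdx, crossSgn, e05, e14, e23]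
      ring
    · simp [psiI, phiI, crossIdx, crossSgn, e33, e44, e55, e66]
      ring


/-! ## Structures with an adapted complex frame -/

/-- `R` is the coframe matrix (with inverse `P`) of a frame adapted to `g`, `φ`, `vol`. -/
structure IsAdapted (P R g : Mat) (φ : T3) (vol : (Fin 7 → Fin 7) → ℂ) : Prop
    extends IsFrame P R g where
  form_eq : φ = push3 R phiS
  vol_eq : vol = volOf R

theorem conj_fr (P : Mat) (A : Bioct) : conj (fr P A) = fr P (conj A) := by
  refine Prod.ext rfl ?_
  change -(push P.transpose A.2) = push P.transpose (-A.2)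
  rw [map_neg]

namespace IsAdapted

variable {P R g : Mat} {φ : T3} {vol : (Fin 7 → Fin 7) → ℂ} (h : IsAdapted P R g φ vol)
include h

theorem octMul_fr (A B : Bioct) : octMul g φ (fr P A) (fr P B) = fr P (mulS A B) := by
  rw [h.form_eq]; exact h.toIsFrame.octMul_fr phiS A B

theorem hodge_eq : hodge g vol φ = lift4 R psiS := by
  rw [h.form_eq, h.vol_eq, hodge_volOf h.mul_eq h.metric_eq]; rfl

theorem octMul_left_alt (A B : Bioct) :
    octMul g φ A (octMul g φ A B) = octMul g φ (octMul g φ A A) B := by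
  obtain ⟨A, rfl⟩ := h.fr_surjective A
  obtain ⟨B, rfl⟩ := h.fr_surjective B
  simp only [h.octMul_fr, mulS_left_alt]

theorem octMul_conj_octMul (A Z : Bioct) :
    octMul g φ (octMul g φ A (conj Z)) Z = quadN g Z • A := by
  obtain ⟨A, rfl⟩ := h.fr_surjective A
  obtain ⟨Z, rfl⟩ := h.fr_surjective Z
  rw [conj_fr, h.octMul_fr, h.octMul_fr, mulS_conj_mulS, h.quadN_fr, map_smul]

theorem octMul_octMul_conj (A Z : Bioct) :
    octMul g φ (octMul g φ A Z) (conj Z) = quadN g Z • A := by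
  obtain ⟨A, rfl⟩ := h.fr_surjective A
  obtain ⟨Z, rfl⟩ := h.fr_surjective Z
  rw [conj_fr, h.octMul_fr, h.octMul_fr, mulS_mulS_conj, h.quadN_fr, map_smul]

theorem octMul_right_cancel {Z A B : Bioct} (hZ : quadN g Z ≠ 0)
    (hAB : octMul g φ A Z = octMul g φ B Z) : A = B := by
  apply bioct_smul_right_injective hZ
  rw [← h.octMul_octMul_conj, ← h.octMul_octMul_conj, hAB]

theorem sigma_fr (Z : Bioct) : sigma g vol (fr P Z) φ = push3 R (sigmaS Z) := by
  rw [h.form_eq, h.vol_eq, h.toIsFrame.sigma_fr]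

theorem octMul_sigma_octMul {Z : Bioct} (hZ : quadN g Z ≠ 0) (A B : Bioct) :
    octMul g φ (octMul g (sigma g vol Z φ) A B) Z = octMul g φ A (octMul g φ B Z) := by
  obtain ⟨Z, rfl⟩ := h.fr_surjective Z
  obtain ⟨A, rfl⟩ := h.fr_surjective A
  obtain ⟨B, rfl⟩ := h.fr_surjective B
  rw [h.quadN_fr] at hZ
  rw [h.sigma_fr, h.toIsFrame.octMul_fr]
  simp only [h.octMul_fr]
  rw [octMul_sigmaS_mulS hZ]

/-- The form `σ_Z(φ)` has an adapted frame too. -/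
theorem exists_isAdapted_sigma {Z : Bioct} (hZ : quadN g Z ≠ 0) :
    ∃ P' R', IsAdapted P' R' g (sigma g vol Z φ) vol := by
  obtain ⟨Z, rfl⟩ := h.fr_surjective Z
  rw [h.quadN_fr] at hZ
  obtain ⟨F, hF, hs, hd⟩ := exists_oriented_frame_sigmaS hZ
  have hF' : F.transpose * F = 1 := mul_eq_one_comm.1 hF
  -- The frame adapted to `φ` is composed with the orthogonal matrix `F`; `det F = 1` keeps the
  -- volume form unchanged.
  refine ⟨F * P, R * F.transpose, ⟨⟨?_, ?_⟩, ?_, ?_⟩⟩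
  · rw [Matrix.mul_assoc, ← Matrix.mul_assoc P, h.mul_eq, Matrix.one_mul, hF]
  · rw [Matrix.transpose_mul, Matrix.transpose_transpose, Matrix.mul_assoc,
      ← Matrix.mul_assoc F.transpose, hF', Matrix.one_mul, h.metric_eq]
  · rw [h.sigma_fr, hs, push3_push3]
  · funext v
    rw [volOf_mul, Matrix.det_transpose, hd, mul_one, h.vol_eq]

/-- `⟨Z, Z T⟩ = 0` for imaginary `T`. -/
theorem inner_octMul_imag (Z : Bioct) (T : T1) :
    Z.1 * (octMul g φ Z (0, T)).1 + pair g Z.2 (octMul g φ Z (0, T)).2 = 0 := by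
  obtain ⟨Z, rfl⟩ := h.fr_surjective Z
  obtain ⟨T', hT'⟩ := h.fr_surjective (0, T)
  have h0 : T'.1 = 0 := congrArg Prod.fst hT'
  rw [← hT', h.octMul_fr]
  simp only [fr_fst, fr_snd, h.pair_push, pair_one, mulS_eq, h0, Fin.sum_univ_seven]
  simp
  ring

/-- `⟨Z, W Z⟩ = N(Z) Re W`. -/
theorem inner_octMul_self (Z W : Bioct) :
    Z.1 * (octMul g φ W Z).1 + pair g Z.2 (octMul g φ W Z).2 = quadN g Z * W.1 := by
  obtain ⟨Z, rfl⟩ := h.fr_surjective Z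
  obtain ⟨W, rfl⟩ := h.fr_surjective W
  rw [h.octMul_fr, h.quadN_fr]
  simp only [fr_fst, fr_snd, h.pair_push, pair_one, mulS_eq, quadN_one, Fin.sum_univ_seven]
  simp
  ring

theorem alt3 : Alt3 φ := by rw [h.form_eq]; exact alt3_push3 R alt3_phiS

theorem metric_symm (i j : Fin 7) : g i j = g j i := by
  have : g.transpose = g := by
    rw [h.metric_eq, Matrix.transpose_mul, Matrix.transpose_transpose]
  exact congrFun (congrFun this j) i

theorem inv_mul_metric : g⁻¹ * g = 1 := by
  rw [h.inv_eq, Matrix.mul_assoc]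
  rw [h.metric_eq]
  rw [← Matrix.mul_assoc P, h.mul_eq, Matrix.one_mul, ← Matrix.transpose_mul, h.mul_eq',
    Matrix.transpose_one]

theorem metric_mul_inv : g * g⁻¹ = 1 := mul_eq_one_comm.1 h.inv_mul_metric

theorem octMul_cross_fr (X : T3) (A B : Bioct) :
    ((0, cross g (push3 R X) (fr P A).2 (fr P B).2) : Bioct) = fr P (0, cross 1 X A.2 B.2) :=
  Prod.ext rfl (h.cross_push X A.2 B.2)

theorem exists_push3 {X : T3} (hX : Alt3 X) : ∃ Y : T3, Alt3 Y ∧ X = push3 R Y :=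
  ⟨push3 P X, alt3_push3 P hX, by rw [push3_push3, h.mul_eq', push3_one]⟩

theorem raise_torsion (X : T3) :
    (fun m => (1 / 48 : ℂ) * ∑ b, ∑ c, ∑ d, ∑ m', ∑ b', ∑ c', ∑ d', push3 R X b c d *
      (g⁻¹ m m' * g⁻¹ b b' * g⁻¹ c c' * g⁻¹ d d' * hodge g vol φ m' b' c' d'))
      = push P.transpose (fun e => (1 / 48 : ℂ) * ∑ b, ∑ c, ∑ d, psiS e b c d * X b c d) := by
  funext m
  rw [h.hodge_eq, h.sum_raise_push3]
  simp only [push_apply, smul_eq_mul, Finset.mul_sum]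
  refine Finset.sum_congr rfl fun i _ => Finset.sum_congr rfl fun j _ =>
    Finset.sum_congr rfl fun k _ => Finset.sum_congr rfl fun l _ => by ring

end IsAdapted


theorem cross_deltaLow_left (X : T3) (j m : Fin 7) (β : T1) :
    cross 1 X (deltaLow j).2 β m = ∑ n, X m j n * β n := by
  simp only [cross_one, deltaLow, mul_ite, mul_one, mul_zero, ite_mul, zero_mul]
  rw [Finset.sum_comm]
  simp

/-- A variation of the standard 3-form which preserves left alternativity lies in `Λ³₇`. -/
theorem eq_twoContractPsi_of_alternative {X : T3} (hX : Alt3 X) (h : ∀ A B : Bioct,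
    mulS A (0, cross 1 X A.2 B.2) + (0, cross 1 X A.2 (mulS A B).2)
      = (0, cross 1 X (mulS A A).2 B.2)) :
    X = twoContractPsi fun e => (1 / 48 : ℂ) * ∑ b, ∑ c, ∑ d, psiS e b c d * X b c d := by
  refine eq_twoContractPsi_of_symm hX fun i l => ?_
  -- For `A = δ_k` the square `AA` is a scalar, so the right side of the hypothesis vanishes.
  -- Summing over `k` produces the symmetric equations of `eq_twoContractPsi_of_symm`.
  have key : ∀ k, ∑ m, phiS l k m * X m k i + ∑ n, X l k n * phiS n k i = 0 := by
    intro k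
    have h1 := congrFun (congrArg Prod.snd (h (deltaLow k) (deltaLow i))) l
    have h2 : (mulS (deltaLow k) (deltaLow k)).2 = 0 := by
      rw [mulS_deltaLow]
      funext a
      simp [deltaLow, self_eq_neg.1 (alt3_phiS.swap12 a k k)]
    have h3 : (mulS (deltaLow k) (deltaLow i)).2 = fun n => phiS n k i := by
      rw [mulS_deltaLow]
      funext a
      simp [deltaLow]
    rw [h2, h3] at h1
    simp only [Prod.snd_add, mulS_deltaLow, Pi.add_apply, cross_deltaLow_left] at h1
    have hd : ∀ n, (deltaLow i).2 n = if n = i then 1 else 0 := fun _ => rfl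
    simpa [cross_one, hd] using h1
  have h2 := Finset.sum_congr (rfl : (Finset.univ : Finset (Fin 7)) = _) fun k _ => key k
  rw [Finset.sum_add_distrib, Finset.sum_const_zero] at h2
  have e1 : ∑ k, ∑ m, phiS l k m * X m k i = -∑ j, ∑ k, phiS l j k * X i j k := by
    simp only [← Finset.sum_neg_distrib]
    refine Finset.sum_congr rfl fun j _ => Finset.sum_congr rfl fun k _ => ?_
    rw [hX.swap12 k j i, hX.swap01 k i j, hX.swap12 i k j]; ring
  have e2 : ∑ k, ∑ n, X l k n * phiS n k i = -∑ j, ∑ k, phiS i j k * X l j k := by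
    simp only [← Finset.sum_neg_distrib]
    refine Finset.sum_congr rfl fun j _ => Finset.sum_congr rfl fun k _ => ?_
    rw [alt3_phiS.swap12 k j i, alt3_phiS.swap01 k i j, alt3_phiS.swap12 i k j]; ring
  rw [e1, e2] at h2
  linear_combination -h2

namespace IsAdapted

variable {P R g : Mat} {φ : T3} {vol : (Fin 7 → Fin 7) → ℂ} (h : IsAdapted P R g φ vol)
include h

/-- Transport of `eq_twoContractPsi_of_alternative` to an arbitrary frame. The vector in the
associator is the torsion expression, so for `X = ∇_a φ` it is the torsion itself. -/
theorem cross_eq_assoc_of_alternative {X : T3} (hX : Alt3 X) (hXa : ∀ A B : Bioct,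
    octMul g φ A (0, cross g X A.2 B.2) + (0, cross g X A.2 (octMul g φ A B).2)
      = (0, cross g X (octMul g φ A A).2 B.2)) (A B : Bioct) :
    ((0, cross g X A.2 B.2) : Bioct) =
      octMul g φ (octMul g φ A B) (0, fun m => (1 / 48 : ℂ) * ∑ b, ∑ c, ∑ d, ∑ m', ∑ b', ∑ c', ∑ d',
        X b c d * (g⁻¹ m m' * g⁻¹ b b' * g⁻¹ c c' * g⁻¹ d d' * hodge g vol φ m' b' c' d'))
      - octMul g φ A (octMul g φ B (0, fun m => (1 / 48 : ℂ) * ∑ b, ∑ c, ∑ d, ∑ m', ∑ b', ∑ c', ∑ d',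
        X b c d * (g⁻¹ m m' * g⁻¹ b b' * g⁻¹ c c' * g⁻¹ d d' * hodge g vol φ m' b' c' d'))) := by
  obtain ⟨Y, hY, rfl⟩ := h.exists_push3 hX
  rw [h.raise_torsion]
  have hYa : ∀ A B : Bioct, mulS A (0, cross 1 Y A.2 B.2) + (0, cross 1 Y A.2 (mulS A B).2)
      = (0, cross 1 Y (mulS A A).2 B.2) := by
    intro A B
    apply h.fr_injective
    have := hXa (fr P A) (fr P B)
    simpa only [h.octMul_cross_fr, h.octMul_fr, ← map_add] using this
  have hT := eq_twoContractPsi_of_alternative hY hYa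
  set T : T1 := fun e => (1 / 48 : ℂ) * ∑ b, ∑ c, ∑ d, psiS e b c d * Y b c d
  obtain ⟨A, rfl⟩ := h.fr_surjective A
  obtain ⟨B, rfl⟩ := h.fr_surjective B
  rw [h.octMul_cross_fr, show ((0, push P.transpose T) : Bioct) = fr P (0, T) from rfl]
  simp only [h.octMul_fr, ← map_sub]
  rw [hT, cross_twoContractPsi]

/-- Associators with `W` come from `2W ⌟ ψ`, and contracting that with `ψ` gives `2 · 24 · W`, which
the factor `1/48` normalises. This identifies a torsion once its associator is known. -/
theorem raise_torsion_of_assoc {X : T3} (hX : Alt3 X) {W : Bioct} (hW : ∀ A B : Bioct,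
    ((0, cross g X A.2 B.2) : Bioct) =
      octMul g φ (octMul g φ A B) W - octMul g φ A (octMul g φ B W)) (m : Fin 7) :
    (1 / 48 : ℂ) * ∑ b, ∑ c, ∑ d, ∑ m', ∑ b', ∑ c', ∑ d', X b c d *
      (g⁻¹ m m' * g⁻¹ b b' * g⁻¹ c c' * g⁻¹ d d' * hodge g vol φ m' b' c' d') = W.2 m := by
  obtain ⟨Y, hY, rfl⟩ := h.exists_push3 hX
  obtain ⟨W, rfl⟩ := h.fr_surjective W
  have hT : Y = twoContractPsi W.2 := by
    refine eq_twoContractPsi_of_assoc fun A B => h.fr_injective ?_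
    have := hW (fr P A) (fr P B)
    simpa only [h.octMul_cross_fr, h.octMul_fr, ← map_sub] using this
  refine (congrFun (h.raise_torsion Y) m).trans ?_
  rw [fr_snd]
  refine congrFun (congrArg (push P.transpose) (funext fun e => ?_)) m
  have := sum_twoContractPsi_mul_psiS W.2 e
  rw [hT]
  simp only [mul_comm (psiS _ _ _ _), this]
  ring

end IsAdapted

/-! ## Operators transported by `σ_Z` -/

/-- Writing `Z = 1 · Z` and applying the hypothesis to one factor after another moves `Z` to the
right of the whole iterated product, which is then formed with `φ'` and acts on the unit. -/
theorem opG3_eq_octMul {g : Mat} {φ φ' : T3} {Z : Bioct} (h : ∀ A B : Bioct,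
    octMul g φ (octMul g φ' A B) Z = octMul g φ A (octMul g φ B Z)) (G : T4) (a : Fin 7) :
    opG3 g φ G a Z = octMul g φ (opG3 g φ' G a (1, 0)) Z := by
  have h1 : octMul g φ (1, 0) Z = Z := by rw [octMul_scalar_left, one_smul]
  simp only [opG3, octMul_smul_left, octMul_sum_left, h, h1]

theorem opG4_eq_octMul {g : Mat} {φ φ' : T3} {Z : Bioct} (h : ∀ A B : Bioct,
    octMul g φ (octMul g φ' A B) Z = octMul g φ A (octMul g φ B Z)) (G : T4) :
    opG4 g φ G Z = octMul g φ (opG4 g φ' G (1, 0)) Z := by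
  have h1 : octMul g φ (1, 0) Z = Z := by rw [octMul_scalar_left, one_smul]
  simp only [opG4, octMul_smul_left, octMul_sum_left, h, h1]

/-! ## The flux term in a general frame -/

theorem IsFrame.fluxDecomposition_iff {P R g : Mat} (h : IsFrame P R g) (G : T4) (Q₀ : ℂ) (Q₁ : T1)
    (Q₂ : T2) : IsFluxDecomposition g (push3 R phiS) (lift4 R psiS) (lift4 R G) Q₀ (push R Q₁)
      (lift2 R Q₂) ↔ (∀ a b, Q₂ a b = Q₂ b a) ∧ ∑ i, Q₂ i i = 0 ∧ G = fluxS Q₀ Q₁ Q₂ := by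
  have hsum : lift4 R (fluxS Q₀ Q₁ Q₂) = fun a b c d => Q₀ * lift4 R psiS a b c d
      + wedge13 (push R Q₁) (push3 R phiS) a b c d
      + iota g (lift4 R psiS) (fun i j => 4 * lift2 R Q₂ i j) a b c d := by
    have e : (fun i j => 4 * lift2 R Q₂ i j) = lift2 R ((4 : ℂ) • Q₂) :=
      ((lift2L R).map_smul 4 Q₂).symm
    rw [e, wedge13_push, h.iota_lift]
    have e1 : lift4 R (Q₀ • psiS + wedge13 Q₁ phiS + iota 1 psiS ((4 : ℂ) • Q₂)) =
      Q₀ • lift4 R psiS + lift4 R (wedge13 Q₁ phiS) + lift4 R (iota 1 psiS ((4 : ℂ) • Q₂)) := by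
      exact ((lift4L R).map_add _ _).trans (congrArg (· + _)
        (((lift4L R).map_add _ _).trans (congrArg (· + _) ((lift4L R).map_smul _ _))))
    exact e1
  have hinj : ∀ F F' : T4, lift4 R F = lift4 R F' → F = F' := fun F F' e => by
    have := congrArg (lift4 P) e
    rwa [lift4_lift4, lift4_lift4, h.mul_eq, lift4_one, lift4_one] at this
  have hsymm : (∀ a b, lift2 R Q₂ a b = lift2 R Q₂ b a) ↔ ∀ a b, Q₂ a b = Q₂ b a := by
    constructor
    · intro hs a b
      have e : lift2 R (fun i j => Q₂ j i) = lift2 R Q₂ := by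
        funext i j; rw [lift2_swap, hs]
      have := congrArg (lift2 P) e
      rw [lift2_lift2, lift2_lift2, h.mul_eq, lift2_one, lift2_one] at this
      exact (congrFun (congrFun this b) a)
    · intro hs a b
      rw [← lift2_swap R Q₂ b a]
      congr 1; funext i j; exact hs j i
  constructor
  · rintro ⟨h1, h2, h3⟩
    rw [h.trace_lift2] at h3
    exact ⟨hsymm.1 h2, h3, hinj _ _ (by rw [hsum]; funext a b c d; exact h1 a b c d)⟩
  · rintro ⟨h2, h3, rfl⟩
    refine ⟨fun a b c d => by rw [hsum], hsymm.2 h2, by rw [h.trace_lift2, h3]⟩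

namespace IsAdapted

variable {P R g : Mat} {φ : T3} {vol : (Fin 7 → Fin 7) → ℂ} (h : IsAdapted P R g φ vol)
include h

theorem exists_fluxDecomposition {F : T4} (hF : Alt4 F) :
    ∃ Q₀ Q₁ Q₂, IsFluxDecomposition g φ (hodge g vol φ) F Q₀ Q₁ Q₂ := by
  obtain ⟨Q₀, Q₁, Q₂, hQ⟩ := exists_fluxS (alt4_lift4 P hF)
  have := (h.toIsFrame.fluxDecomposition_iff _ Q₀ Q₁ Q₂).2 hQ
  rw [lift4_lift4, h.mul_eq', lift4_one, ← h.form_eq, ← h.hodge_eq] at this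
  exact ⟨_, _, _, this⟩

theorem flux_term {F : T4} {Q₀ : ℂ} {Q₁ : T1} {Q₂ : T2}
    (hQ : IsFluxDecomposition g φ (hodge g vol φ) F Q₀ Q₁ Q₂) (a : Fin 7) :
    (Complex.I • octMul g φ (deltaLow a) (opG4 g φ F (1, 0))
      + (12 * Complex.I) • opG3 g φ F a (1, 0)).1 = (4 / 3) * Complex.I * Q₁ a ∧
    ∀ b, ∑ m, g b m * (Complex.I • octMul g φ (deltaLow a) (opG4 g φ F (1, 0))
      + (12 * Complex.I) • opG3 g φ F a (1, 0)).2 m = -((5 / 6) * Complex.I * Q₀ * g a b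
        + contract g (-(Complex.I / 3) • Q₁) φ a b + Complex.I * Q₂ a b) := by
  obtain ⟨G, rfl⟩ : ∃ G, F = lift4 R G := ⟨lift4 P F, by rw [lift4_lift4, h.mul_eq', lift4_one]⟩
  obtain ⟨q, rfl⟩ : ∃ q, Q₁ = push R q := ⟨push P Q₁, by rw [push_push, h.mul_eq', push_one]⟩
  obtain ⟨k, rfl⟩ : ∃ k, Q₂ = lift2 R k := ⟨lift2 P Q₂, by rw [lift2_lift2, h.mul_eq', lift2_one]⟩
  rw [h.hodge_eq] at hQ
  simp only [h.form_eq] at hQ ⊢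
  obtain ⟨hs, ht, rfl⟩ := (h.toIsFrame.fluxDecomposition_iff _ _ _ _).1 hQ
  set J : Fin 7 → Bioct := fun i => ((4 / 3) * Complex.I * q i,
    fun m => -((5 / 6) * Complex.I * Q₀ * (if i = m then 1 else 0)
        + contract 1 (-(Complex.I / 3) • q) phiS i m + Complex.I * k i m)) with hJ
  have key : Complex.I • octMul g (push3 R phiS) (deltaLow a)
        (opG4 g (push3 R phiS) (lift4 R (fluxS Q₀ q k)) (1, 0))
      + (12 * Complex.I) • opG3 g (push3 R phiS) (lift4 R (fluxS Q₀ q k)) a (1, 0)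
      = push R (fun i => fr P (J i)) a := by
    have e1 : ((1, 0) : Bioct) = fr P (1, 0) := Prod.ext rfl (by rw [fr_snd, map_zero])
    have e2 : ∀ i, J i = Complex.I • mulS (deltaLow i) (opG4 1 phiS (fluxS Q₀ q k) (1, 0))
      + (12 * Complex.I) • opG3 1 phiS (fluxS Q₀ q k) i (1, 0) := fun i =>
        (flux_term_fluxS Q₀ q hs ht i).symm
    rw [e1, h.toIsFrame.opG4_fr, h.toIsFrame.opG3_fr, h.deltaLow_eq, octMul_push_left]
    simp only [e2, map_add, map_smul, push_apply, smul_add, Finset.sum_add_distrib,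
      h.toIsFrame.octMul_fr, Finset.smul_sum, smul_comm (R a _)]
  rw [key]
  constructor
  · simp only [push_apply, Prod.fst_sum, Prod.smul_fst, fr_fst, hJ, smul_eq_mul, Finset.mul_sum]
    exact Finset.sum_congr rfl fun i _ => by ring
  · intro b
    have e1 : (push R (fun i => fr P (J i)) a).2 = push P.transpose (push R (fun i => (J i).2) a) := by
      rw [map_push (push P.transpose)]
      simp [push_apply, Prod.snd_sum, fr_snd]
    have e2 : ∑ m, g b m * push P.transpose (push R (fun i => (J i).2) a) m
        = lift2 R (fun i => (J i).2) a b := by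
      have : ∑ m, g b m * push P.transpose (push R (fun i => (J i).2) a) m
        = push g (push P.transpose (push R (fun i => (J i).2) a)) b := rfl
      rw [this, push_push, h.metric_mul, lift2, map_push (push R)]
    have e3 : (fun i => (J i).2) = (-((5 / 6) * Complex.I * Q₀)) • (fun i j => if i = j then (1 : ℂ) else 0)
        + (-1 : ℂ) • contract 1 (-(Complex.I / 3) • q) phiS + (-Complex.I) • k := by
      funext i j
      simp [hJ]; ring
    obtain ⟨gT, hgT⟩ : ∃ gT : T2, gT = g := ⟨g, rfl⟩
    have e4 : lift2 R (fun i j => if i = j then (1 : ℂ) else 0) = gT := by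
      funext i j
      rw [lift2_apply, hgT, h.metric_eq]
      simp [Matrix.mul_apply]
    have e5 : lift2 R (fun i => (J i).2) = (-((5 / 6) * Complex.I * Q₀)) • gT
        + (-1 : ℂ) • lift2 R (contract 1 (-(Complex.I / 3) • q) phiS) + (-Complex.I) • lift2 R k := by
      rw [e3]
      exact ((lift2L R).map_add _ _).trans (congrArg₂ (· + ·) (((lift2L R).map_add _ _).trans
        (congrArg₂ (· + ·) (((lift2L R).map_smul _ _).trans (congrArg _ e4))
          ((lift2L R).map_smul _ _))) ((lift2L R).map_smul _ _))
    rw [e1, e2, e5, ← h.toIsFrame.contract_push, map_smul]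
    simp only [Pi.add_apply, Pi.smul_apply, smul_eq_mul,
      show gT a b = g a b from by rw [hgT]]
    ring

end IsAdapted


/-! ## Partial derivatives -/

section PartialD

variable {f f' : E7 → ℂ} {x : E7} (a : Fin 7)

theorem partialD_congr (h : f =ᶠ[𝓝 x] f') : partialD a f x = partialD a f' x := by
  rw [partialD, partialD, h.fderiv_eq]

theorem partialD_add (h : DifferentiableAt ℝ f x) (h' : DifferentiableAt ℝ f' x) :
    partialD a (fun y => f y + f' y) x = partialD a f x + partialD a f' x := by
  simp only [partialD]; rw [fderiv_fun_add h h']; rfl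

theorem partialD_sub (h : DifferentiableAt ℝ f x) (h' : DifferentiableAt ℝ f' x) :
    partialD a (fun y => f y - f' y) x = partialD a f x - partialD a f' x := by
  simp only [partialD]; rw [fderiv_fun_sub h h']; rfl

theorem partialD_neg : partialD a (fun y => -f y) x = -partialD a f x := by
  simp only [partialD]; rw [fderiv_fun_neg]; rfl

theorem partialD_mul (h : DifferentiableAt ℝ f x) (h' : DifferentiableAt ℝ f' x) :
    partialD a (fun y => f y * f' y) x = partialD a f x * f' x + f x * partialD a f' x := by
  simp only [partialD]; rw [fderiv_fun_mul h h']; simp; ring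

theorem partialD_sum {ι : Type*} (s : Finset ι) {f : ι → E7 → ℂ}
    (h : ∀ i ∈ s, DifferentiableAt ℝ (f i) x) :
    partialD a (fun y => ∑ i ∈ s, f i y) x = ∑ i ∈ s, partialD a (f i) x := by
  simp only [partialD]; rw [fderiv_fun_sum h]; simp

end PartialD

/-- A trilinear form applied to three vectors. -/
def tri (w : T3) (α β γ : T1) : ℂ := ∑ b, ∑ c, ∑ d, w b c d * (α b * β c * γ d)

/-- A matrix applied to a vector. -/
def act (Γ : T2) (α : T1) : T1 := fun m => ∑ b, Γ m b * α b

theorem partialD_tri {w : E7 → T3} {α β γ : E7 → T1} {x : E7} (a : Fin 7)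
    (hw : ∀ b c d, DifferentiableAt ℝ (fun y => w y b c d) x)
    (hα : ∀ b, DifferentiableAt ℝ (fun y => α y b) x)
    (hβ : ∀ b, DifferentiableAt ℝ (fun y => β y b) x)
    (hγ : ∀ b, DifferentiableAt ℝ (fun y => γ y b) x) :
    partialD a (fun y => tri (w y) (α y) (β y) (γ y)) x =
      tri (fun b c d => partialD a (fun y => w y b c d) x) (α x) (β x) (γ x)
      + tri (w x) (fun b => partialD a (fun y => α y b) x) (β x) (γ x)
      + tri (w x) (α x) (fun b => partialD a (fun y => β y b) x) (γ x)
      + tri (w x) (α x) (β x) (fun b => partialD a (fun y => γ y b) x) := by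
  have h1 : ∀ b c d, DifferentiableAt ℝ (fun y => w y b c d * (α y b * β y c * γ y d)) x :=
    fun b c d => (hw b c d).fun_mul (((hα b).fun_mul (hβ c)).fun_mul (hγ d))
  have h2 : ∀ b c, DifferentiableAt ℝ (fun y => ∑ d, w y b c d * (α y b * β y c * γ y d)) x :=
    fun b c => DifferentiableAt.fun_sum fun d _ => h1 b c d
  have h3 : ∀ b, DifferentiableAt ℝ (fun y => ∑ c, ∑ d, w y b c d * (α y b * β y c * γ y d)) x :=
    fun b => DifferentiableAt.fun_sum fun c _ => h2 b c
  simp only [tri]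
  rw [partialD_sum a _ fun b _ => h3 b]
  simp only [← Finset.sum_add_distrib]
  refine Finset.sum_congr rfl fun b _ => ?_
  rw [partialD_sum a _ fun c _ => h2 b c]
  refine Finset.sum_congr rfl fun c _ => ?_
  rw [partialD_sum a _ fun d _ => h1 b c d]
  refine Finset.sum_congr rfl fun d _ => ?_
  rw [partialD_mul a (hw b c d) (((hα b).fun_mul (hβ c)).fun_mul (hγ d)),
    partialD_mul a ((hα b).fun_mul (hβ c)) (hγ d), partialD_mul a (hα b) (hβ c)]
  ring

theorem partialD_pair {g : E7 → Mat} {α β : E7 → T1} {x : E7} (a : Fin 7)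
    (hg : ∀ b c, DifferentiableAt ℝ (fun y => g y b c) x)
    (hα : ∀ b, DifferentiableAt ℝ (fun y => α y b) x)
    (hβ : ∀ b, DifferentiableAt ℝ (fun y => β y b) x) :
    partialD a (fun y => pair (g y) (α y) (β y)) x =
      pair (Matrix.of fun b c => partialD a (fun y => g y b c) x) (α x) (β x)
      + pair (g x) (fun b => partialD a (fun y => α y b) x) (β x)
      + pair (g x) (α x) (fun b => partialD a (fun y => β y b) x) := by
  have h1 : ∀ b c, DifferentiableAt ℝ (fun y => g y b c * α y b * β y c) x :=
    fun b c => ((hg b c).fun_mul (hα b)).fun_mul (hβ c)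
  simp only [pair, Matrix.of_apply]
  rw [partialD_sum a _ fun b _ => DifferentiableAt.fun_sum fun c _ => h1 b c]
  simp only [← Finset.sum_add_distrib]
  refine Finset.sum_congr rfl fun b _ => ?_
  rw [partialD_sum a _ fun c _ => h1 b c]
  refine Finset.sum_congr rfl fun c _ => ?_
  rw [partialD_mul a ((hg b c).fun_mul (hα b)) (hβ c), partialD_mul a (hg b c) (hα b)]
  ring

theorem tri_eq_sum_left (w : T3) (α β γ : T1) :
    tri w α β γ = ∑ b, α b * ∑ c, ∑ d, w b c d * (β c * γ d) := by
  simp only [tri, Finset.mul_sum]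
  refine Finset.sum_congr rfl fun b _ => Finset.sum_congr rfl fun c _ => Finset.sum_congr rfl
    fun d _ => by ring

theorem tri_eq_sum_middle (w : T3) (α β γ : T1) :
    tri w α β γ = ∑ c, β c * ∑ b, ∑ d, w b c d * (α b * γ d) := by
  rw [tri, Finset.sum_comm]
  simp only [Finset.mul_sum]
  refine Finset.sum_congr rfl fun b _ => Finset.sum_congr rfl fun c _ => Finset.sum_congr rfl
    fun d _ => by ring

theorem tri_eq_sum_right (w : T3) (α β γ : T1) :
    tri w α β γ = ∑ d, γ d * ∑ b, ∑ c, w b c d * (α b * β c) := by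
  rw [tri, Finset.sum_congr rfl fun b _ => Finset.sum_comm, Finset.sum_comm]
  simp only [Finset.mul_sum]
  refine Finset.sum_congr rfl fun b _ => Finset.sum_congr rfl fun c _ => Finset.sum_congr rfl
    fun d _ => by ring

theorem sum_mul_sum_act (Γ : T2) (α f : T1) :
    ∑ b, α b * ∑ e, Γ e b * f e = ∑ e, act Γ α e * f e := by
  simp only [act, Finset.mul_sum, Finset.sum_mul]
  rw [Finset.sum_comm]
  refine Finset.sum_congr rfl fun b _ => Finset.sum_congr rfl fun c _ => by ring

theorem sum_sum_sum_mul (F : Fin 7 → Fin 7 → Fin 7 → ℂ) (Γ : T1) (k : T2) :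
    ∑ c, ∑ d, (∑ e, Γ e * F e c d) * k c d = ∑ e, Γ e * ∑ c, ∑ d, F e c d * k c d := by
  simp only [Finset.sum_mul, Finset.mul_sum]
  rw [Finset.sum_congr rfl fun c _ => Finset.sum_comm, Finset.sum_comm]
  simp only [mul_assoc]

theorem tri_act_left (w : T3) (Γ : T2) (α β γ : T1) :
    tri (fun b c d => ∑ e, Γ e b * w e c d) α β γ = tri w (act Γ α) β γ := by
  rw [tri_eq_sum_left, tri_eq_sum_left, ← sum_mul_sum_act]
  exact Finset.sum_congr rfl fun b _ => congrArg (α b * ·) (sum_sum_sum_mul w (Γ · b) _)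

theorem tri_act_middle (w : T3) (Γ : T2) (α β γ : T1) :
    tri (fun b c d => ∑ e, Γ e c * w b e d) α β γ = tri w α (act Γ β) γ := by
  rw [tri_eq_sum_middle, tri_eq_sum_middle, ← sum_mul_sum_act]
  exact Finset.sum_congr rfl fun b _ => congrArg (β b * ·)
    (sum_sum_sum_mul (fun e c d => w c e d) (Γ · b) _)

theorem tri_act_right (w : T3) (Γ : T2) (α β γ : T1) :
    tri (fun b c d => ∑ e, Γ e d * w b c e) α β γ = tri w α β (act Γ γ) := by
  rw [tri_eq_sum_right, tri_eq_sum_right, ← sum_mul_sum_act]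
  exact Finset.sum_congr rfl fun b _ => congrArg (γ b * ·)
    (sum_sum_sum_mul (fun e c d => w c d e) (Γ · b) _)

theorem tri_nablaForm (g : E7 → Mat) (w : E7 → T3) (x : E7) (a : Fin 7) (α β γ : T1) :
    tri (nablaForm g w x a) α β γ = tri (fun b c d => partialD a (fun y => w y b c d) x) α β γ
      - tri (w x) (act (fun m b => christoffel g x m a b) α) β γ
      - tri (w x) α (act (fun m b => christoffel g x m a b) β) γ
      - tri (w x) α β (act (fun m b => christoffel g x m a b) γ) := by
  rw [← tri_act_left, ← tri_act_middle, ← tri_act_right]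
  simp only [tri, nablaForm, ← Finset.sum_sub_distrib]
  refine Finset.sum_congr rfl fun b _ => Finset.sum_congr rfl fun c _ => Finset.sum_congr rfl
    fun d _ => ?_
  rw [Finset.sum_add_distrib, Finset.sum_add_distrib]
  ring

theorem nablaOct_snd (g : E7 → Mat) (A : E7 → Bioct) (x : E7) (a : Fin 7) :
    (nablaOct g A x a).2 = (fun b => partialD a (fun y => (A y).2 b) x)
      + act (fun m b => christoffel g x m a b) (A x).2 := rfl

theorem tri_add_left (w : T3) (α α' β γ : T1) :
    tri w (α + α') β γ = tri w α β γ + tri w α' β γ := by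
  simp only [tri_eq_sum_left, Pi.add_apply, add_mul, Finset.sum_add_distrib]

theorem tri_add_middle (w : T3) (α β β' γ : T1) :
    tri w α (β + β') γ = tri w α β γ + tri w α β' γ := by
  simp only [tri_eq_sum_middle, Pi.add_apply, add_mul, Finset.sum_add_distrib]

theorem tri_add_right (w : T3) (α β γ γ' : T1) :
    tri w α β (γ + γ') = tri w α β γ + tri w α β γ' := by
  simp only [tri_eq_sum_right, Pi.add_apply, add_mul, Finset.sum_add_distrib]

/-- The Leibniz rule for a 3-form applied to three vector fields. -/
theorem partialD_tri_eq (g : E7 → Mat) {w : E7 → T3} {A B C : E7 → Bioct} {x : E7} (a : Fin 7)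
    (hw : ∀ b c d, DifferentiableAt ℝ (fun y => w y b c d) x)
    (hA : ∀ b, DifferentiableAt ℝ (fun y => (A y).2 b) x)
    (hB : ∀ b, DifferentiableAt ℝ (fun y => (B y).2 b) x)
    (hC : ∀ b, DifferentiableAt ℝ (fun y => (C y).2 b) x) :
    partialD a (fun y => tri (w y) (A y).2 (B y).2 (C y).2) x =
      tri (nablaForm g w x a) (A x).2 (B x).2 (C x).2
      + tri (w x) (nablaOct g A x a).2 (B x).2 (C x).2
      + tri (w x) (A x).2 (nablaOct g B x a).2 (C x).2
      + tri (w x) (A x).2 (B x).2 (nablaOct g C x a).2 := by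
  rw [partialD_tri a hw hA hB hC, tri_nablaForm]
  simp only [nablaOct_snd, tri_add_left, tri_add_middle, tri_add_right]
  ring

/-- The Levi-Civita connection is metric. -/
theorem partialD_metric {g : E7 → Mat} {x : E7} (hs : ∀ᶠ y in 𝓝 x, ∀ i j, g y i j = g y j i)
    (hg : (g x)⁻¹ * g x = 1) (a i j : Fin 7) : partialD a (fun y => g y i j) x =
      ∑ e, christoffel g x e a i * g x e j + ∑ e, christoffel g x e a j * g x i e := by
  have hsx : ∀ i j, g x i j = g x j i := hs.self_of_nhds
  have hp : ∀ a i j, partialD a (fun y => g y i j) x = partialD a (fun y => g y j i) x :=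
    fun a i j => partialD_congr a (hs.mono fun y hy => hy i j)
  -- The Christoffel symbol with lowered index. Adding the same expression with `i` and `j`
  -- exchanged cancels the other two derivatives and doubles the wanted one.
  have key : ∀ i j, ∑ e, christoffel g x e a i * g x e j = (1 / 2 : ℂ) *
      (partialD a (fun y => g y i j) x + partialD i (fun y => g y a j) x
        - partialD j (fun y => g y a i) x) := by
    intro i j
    have hinv : (g x)⁻¹.transpose = (g x)⁻¹ := by
      rw [Matrix.transpose_nonsing_inv]
      congr 1
      ext i j; exact hsx j i
    have h1 : ∀ l, ∑ e, (g x)⁻¹ e l * g x e j = if l = j then 1 else 0 := fun l => by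
      have := congrFun (congrFun hg l) j
      rw [← hinv] at this
      simpa [Matrix.mul_apply, Matrix.one_apply] using this
    simp only [christoffel, mul_assoc, ← Finset.mul_sum, Finset.sum_mul]
    rw [Finset.sum_comm]
    congr 1
    simp only [mul_comm _ (g x _ j), ← mul_assoc]
    simp only [mul_comm (g x _ j), ← Finset.sum_mul, h1]
    simp
  rw [key, Finset.sum_congr rfl fun e _ => by rw [hsx i e], key, hp a j i]
  ring

theorem pair_act {g : E7 → Mat} {x : E7} (hs : ∀ᶠ y in 𝓝 x, ∀ i j, g y i j = g y j i)
    (hg : (g x)⁻¹ * g x = 1) (a : Fin 7) (α β : T1) :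
    pair (Matrix.of fun b c => partialD a (fun y => g y b c) x) α β =
      pair (g x) (act (fun m b => christoffel g x m a b) α) β
        + pair (g x) α (act (fun m b => christoffel g x m a b) β) := by
  have e1 : pair (g x) (act (fun m b => christoffel g x m a b) α) β
      = ∑ b, ∑ c, (∑ e, christoffel g x e a b * g x e c) * α b * β c := by
    simp only [pair, act, Finset.sum_mul, Finset.mul_sum]
    rw [Finset.sum_congr rfl fun e _ => Finset.sum_comm, Finset.sum_comm]
    refine Finset.sum_congr rfl fun b _ => ?_
    rw [Finset.sum_comm]
    refine Finset.sum_congr rfl fun c _ => Finset.sum_congr rfl fun e _ => by ring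
  have e2 : pair (g x) α (act (fun m b => christoffel g x m a b) β)
      = ∑ b, ∑ c, (∑ e, christoffel g x e a c * g x b e) * α b * β c := by
    simp only [pair, act, Finset.sum_mul, Finset.mul_sum]
    refine Finset.sum_congr rfl fun b _ => ?_
    rw [Finset.sum_comm]
    refine Finset.sum_congr rfl fun c _ => Finset.sum_congr rfl fun e _ => by ring
  rw [e1, e2]
  simp only [pair, Matrix.of_apply, partialD_metric hs hg, add_mul, Finset.sum_add_distrib]

/-- The Leibniz rule for the metric pairing of two vector fields. -/
theorem partialD_pair_eq {g : E7 → Mat} {A B : E7 → Bioct} {x : E7} (a : Fin 7)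
    (hs : ∀ᶠ y in 𝓝 x, ∀ i j, g y i j = g y j i) (hi : (g x)⁻¹ * g x = 1)
    (hg : ∀ b c, DifferentiableAt ℝ (fun y => g y b c) x)
    (hA : ∀ b, DifferentiableAt ℝ (fun y => (A y).2 b) x)
    (hB : ∀ b, DifferentiableAt ℝ (fun y => (B y).2 b) x) :
    partialD a (fun y => pair (g y) (A y).2 (B y).2) x =
      pair (g x) (nablaOct g A x a).2 (B x).2 + pair (g x) (A x).2 (nablaOct g B x a).2 := by
  rw [partialD_pair a hg hA hB, pair_act hs hi]
  simp only [nablaOct_snd, pair_add_left, pair_add_right]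
  ring

/-- By Cramer's rule: the determinant and the cofactors are polynomials in the entries. -/
theorem differentiableAt_inv_apply {g : E7 → Mat} {x : E7} (hi : IsUnit (g x).det)
    (hg : ∀ b c, DifferentiableAt ℝ (fun y => g y b c) x) (b c : Fin 7) :
    DifferentiableAt ℝ (fun y => (g y)⁻¹ b c) x := by
  have hdet : ∀ m : E7 → Mat, (∀ b c, DifferentiableAt ℝ (fun y => m y b c) x) →
      DifferentiableAt ℝ (fun y => (m y).det) x := by
    intro m hm
    simp only [Matrix.det_apply']
    refine DifferentiableAt.fun_sum fun σ _ => (differentiableAt_const _).fun_mul ?_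
    exact (HasFDerivAt.finsetProd fun i _ => (hm (σ i) i).hasFDerivAt).differentiableAt
  simp only [Matrix.inv_def, Ring.inverse_eq_inv', Matrix.smul_apply, Matrix.adjugate_apply, smul_eq_mul]
  refine ((hdet g hg).fun_inv hi.ne_zero).fun_mul (hdet _ fun i j => ?_)
  by_cases hic : i = c
  · subst hic
    simp
  · simpa [Matrix.updateRow_ne hic] using hg i j

theorem pair_cross {g : Mat} (φ : T3) (hg : g * g⁻¹ = 1) (γ α β : T1) :
    pair g γ (cross g φ α β) = tri φ γ α β := by
  have e : pair g γ (cross g φ α β) = ∑ i, γ i * ∑ d, (g * g⁻¹) i d * ∑ b, ∑ c, φ d b c * (α b * β c) := by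
    simp only [pair, cross, Matrix.mul_apply, Finset.mul_sum, Finset.sum_mul]
    refine Finset.sum_congr rfl fun i _ => ?_
    rw [Finset.sum_comm]
    refine Finset.sum_congr rfl fun d _ => ?_
    rw [Finset.sum_comm]
    refine Finset.sum_congr rfl fun b _ => ?_
    rw [Finset.sum_comm]
    refine Finset.sum_congr rfl fun c _ => Finset.sum_congr rfl fun e _ => by ring
  rw [e, hg, tri_eq_sum_left]
  simp [Matrix.one_apply]

theorem eq_of_pair_eq {g : Mat} (hg : g⁻¹ * g = 1) {α β : T1} (h : ∀ γ, pair g γ α = pair g γ β) :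
    α = β := by
  have e : g *ᵥ α = g *ᵥ β := by
    funext i
    have := h (Pi.single i 1)
    simpa [pair, Pi.single_apply, Matrix.mulVec, dotProduct] using this
  rw [← Matrix.one_mulVec α, ← hg, ← Matrix.mulVec_mulVec, e, Matrix.mulVec_mulVec, hg,
    Matrix.one_mulVec]


/-! ### Differentiation of fields of `G₂`-structures. -/

/-- A field of (complex) `G₂`-structures near `x`, differentiable at `x`. -/
structure LocalG2 (g : E7 → Mat) (vol : E7 → (Fin 7 → Fin 7) → ℂ) (φ : E7 → T3) (x : E7) :
    Prop where
  diff_metric : ∀ i j, DifferentiableAt ℝ (fun y => g y i j) x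
  diff_form : ∀ i j k, DifferentiableAt ℝ (fun y => φ y i j k) x
  adapted : ∀ᶠ y in 𝓝 x, ∃ P R, IsAdapted P R (g y) (φ y) (vol y)

theorem DifferentiableAt.snd_bioct {A : E7 → Bioct} {x : E7} (h : DifferentiableAt ℝ A x)
    (i : Fin 7) : DifferentiableAt ℝ (fun y => (A y).2 i) x := differentiableAt_pi.1 h.snd i

theorem nablaOct_congr {g : E7 → Mat} {A B : E7 → Bioct} {x : E7} (h : A =ᶠ[𝓝 x] B) (a : Fin 7) :
    nablaOct g A x a = nablaOct g B x a := by
  simp only [nablaOct, h.self_of_nhds]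
  rw [partialD_congr a (h.mono fun y hy => congrArg Prod.fst hy)]
  refine Prod.ext rfl (funext fun m => ?_)
  simp only
  rw [partialD_congr a (h.mono fun y hy => congrFun (congrArg Prod.snd hy) m)]

theorem pair_comm {g : Mat} (h : ∀ i j, g i j = g j i) (α β : T1) : pair g α β = pair g β α := by
  rw [pair, pair, Finset.sum_comm]
  exact Finset.sum_congr rfl fun i _ => Finset.sum_congr rfl fun j _ => by rw [h j i]; ring

namespace LocalG2

variable {g : E7 → Mat} {vol : E7 → (Fin 7 → Fin 7) → ℂ} {φ : E7 → T3} {x : E7}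
  (h : LocalG2 g vol φ x)
include h

theorem symm : ∀ᶠ y in 𝓝 x, ∀ i j, g y i j = g y j i :=
  h.adapted.mono fun _ ⟨_, _, hy⟩ => hy.metric_symm

theorem inv_mul : (g x)⁻¹ * g x = 1 :=
  let ⟨_, _, hx⟩ := h.adapted.self_of_nhds
  hx.inv_mul_metric

theorem diff_inv (b c : Fin 7) : DifferentiableAt ℝ (fun y => (g y)⁻¹ b c) x :=
  differentiableAt_inv_apply (Matrix.isUnit_det_of_left_inverse h.inv_mul) h.diff_metric b c

theorem diff_pair {A B : E7 → Bioct} (hA : DifferentiableAt ℝ A x) (hB : DifferentiableAt ℝ B x) :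
    DifferentiableAt ℝ (fun y => pair (g y) (A y).2 (B y).2) x := by
  simp only [pair]
  exact DifferentiableAt.fun_sum fun b _ => DifferentiableAt.fun_sum fun c _ =>
    ((h.diff_metric b c).fun_mul (DifferentiableAt.snd_bioct hA b)).fun_mul
      (DifferentiableAt.snd_bioct hB c)

theorem diff_cross {A B : E7 → Bioct} (hA : DifferentiableAt ℝ A x) (hB : DifferentiableAt ℝ B x)
    (m : Fin 7) : DifferentiableAt ℝ (fun y => cross (g y) (φ y) (A y).2 (B y).2 m) x := by
  simp only [cross]
  exact DifferentiableAt.fun_sum fun d _ => DifferentiableAt.fun_sum fun b _ =>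
    DifferentiableAt.fun_sum fun c _ => (((h.diff_inv m d).fun_mul (h.diff_form d b c)).fun_mul
      (DifferentiableAt.snd_bioct hA b)).fun_mul (DifferentiableAt.snd_bioct hB c)

theorem diff_octMul {A B : E7 → Bioct} (hA : DifferentiableAt ℝ A x)
    (hB : DifferentiableAt ℝ B x) :
    DifferentiableAt ℝ (fun y => octMul (g y) (φ y) (A y) (B y)) x := by
  refine DifferentiableAt.prodMk ((hA.fst.fun_mul hB.fst).fun_sub (h.diff_pair hA hB))
    (differentiableAt_pi.2 fun m => ?_)
  exact ((hA.fst.fun_mul (DifferentiableAt.snd_bioct hB m)).fun_add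
    (hB.fst.fun_mul (DifferentiableAt.snd_bioct hA m))).fun_add (h.diff_cross hA hB m)

/-- The Leibniz rule for the octonion product. -/
theorem nablaOct_octMul {A B : E7 → Bioct} (hA : DifferentiableAt ℝ A x)
    (hB : DifferentiableAt ℝ B x) (a : Fin 7) :
    nablaOct g (fun y => octMul (g y) (φ y) (A y) (B y)) x a =
      octMul (g x) (φ x) (nablaOct g A x a) (B x) + octMul (g x) (φ x) (A x) (nablaOct g B x a)
        + (0, cross (g x) (nablaForm g φ x a) (A x).2 (B x).2) := by
  have hA1 := hA.fst
  have hB1 := hB.fst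
  have hA2 := DifferentiableAt.snd_bioct hA
  have hB2 := DifferentiableAt.snd_bioct hB
  have hmul := mul_eq_one_comm.1 h.inv_mul
  refine Prod.ext ?_ (eq_of_pair_eq h.inv_mul fun γ => ?_)
  · change partialD a (fun y => (A y).1 * (B y).1 - pair (g y) (A y).2 (B y).2) x = _
    rw [partialD_sub a (hA1.fun_mul hB1) (h.diff_pair hA hB), partialD_mul a hA1 hB1,
      partialD_pair_eq a h.symm h.inv_mul h.diff_metric hA2 hB2]
    simp only [Prod.fst_add, octMul]
    simp only [nablaOct]
    ring
  -- The imaginary part is tested against constant vectors `γ`. Pairing turns the cross product into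
  -- the trilinear form `φ`, so the derivative of the inverse metric never has to be computed.
  · set C : E7 → Bioct := fun y => octMul (g y) (φ y) (A y) (B y) with hC
    have hCd : DifferentiableAt ℝ C x := h.diff_octMul hA hB
    set G : E7 → Bioct := fun _ => (0, γ) with hG
    have hGd : DifferentiableAt ℝ G x := differentiableAt_const _
    have hG2 := DifferentiableAt.snd_bioct hGd
    have expand : ∀ y, g y * (g y)⁻¹ = 1 → ∀ γ, pair (g y) γ (C y).2 = (A y).1 * pair (g y) γ (B y).2
        + (B y).1 * pair (g y) γ (A y).2 + tri (φ y) γ (A y).2 (B y).2 := by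
      intro y hy γ
      have e : (C y).2 = (A y).1 • (B y).2 + (B y).1 • (A y).2 + cross (g y) (φ y) (A y).2 (B y).2 :=
        rfl
      rw [e, pair_add_right, pair_add_right, pair_smul_right, pair_smul_right, pair_cross _ hy]
    have htri : DifferentiableAt ℝ (fun y => tri (φ y) (G y).2 (A y).2 (B y).2) x := by
      simp only [tri]
      exact DifferentiableAt.fun_sum fun b _ => DifferentiableAt.fun_sum fun c _ =>
        DifferentiableAt.fun_sum fun d _ => (h.diff_form b c d).fun_mul
          (((hG2 b).fun_mul (hA2 c)).fun_mul (hB2 d))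
    have hev : (fun y => pair (g y) (G y).2 (C y).2) =ᶠ[𝓝 x] fun y =>
        (A y).1 * pair (g y) (G y).2 (B y).2 + (B y).1 * pair (g y) (G y).2 (A y).2
          + tri (φ y) (G y).2 (A y).2 (B y).2 :=
      h.adapted.mono fun y ⟨_, _, hy⟩ => expand y hy.metric_mul_inv γ
    have e1 := partialD_congr a hev
    rw [partialD_pair_eq a h.symm h.inv_mul h.diff_metric hG2 (DifferentiableAt.snd_bioct hCd),
      partialD_add a ((hA1.fun_mul (h.diff_pair hGd hB)).fun_add (hB1.fun_mul (h.diff_pair hGd hA))) htri,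
      partialD_add a (hA1.fun_mul (h.diff_pair hGd hB)) (hB1.fun_mul (h.diff_pair hGd hA)),
      partialD_mul a hA1 (h.diff_pair hGd hB), partialD_mul a hB1 (h.diff_pair hGd hA),
      partialD_pair_eq a h.symm h.inv_mul h.diff_metric hG2 hB2,
      partialD_pair_eq a h.symm h.inv_mul h.diff_metric hG2 hA2,
      partialD_tri_eq g a h.diff_form hG2 hA2 hB2, expand x hmul] at e1
    have e2 : (octMul (g x) (φ x) (nablaOct g A x a) (B x) + octMul (g x) (φ x) (A x) (nablaOct g B x a)
        + (0, cross (g x) (nablaForm g φ x a) (A x).2 (B x).2)).2 =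
      ((nablaOct g A x a).1 • (B x).2 + (B x).1 • (nablaOct g A x a).2
          + cross (g x) (φ x) (nablaOct g A x a).2 (B x).2)
        + ((A x).1 • (nablaOct g B x a).2 + (nablaOct g B x a).1 • (A x).2
          + cross (g x) (φ x) (A x).2 (nablaOct g B x a).2)
        + cross (g x) (nablaForm g φ x a) (A x).2 (B x).2 := rfl
    rw [e2]
    simp only [pair_add_right, pair_smul_right, pair_cross _ hmul]
    have hA' : (nablaOct g A x a).1 = partialD a (fun y => (A y).1) x := rfl
    have hB' : (nablaOct g B x a).1 = partialD a (fun y => (B y).1) x := rfl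
    rw [hA', hB']
    linear_combination e1

theorem partialD_quadN {Z : E7 → Bioct} (hZ : DifferentiableAt ℝ Z x) (a : Fin 7) :
    partialD a (fun y => quadN (g y) (Z y)) x =
      2 * ((Z x).1 * (nablaOct g Z x a).1 + pair (g x) (Z x).2 (nablaOct g Z x a).2) := by
  have hZ1 := hZ.fst
  have hZ2 := DifferentiableAt.snd_bioct hZ
  simp only [quadN, sq]
  rw [partialD_add a (hZ1.fun_mul hZ1) (h.diff_pair hZ hZ), partialD_mul a hZ1 hZ1,
    partialD_pair_eq a h.symm h.inv_mul h.diff_metric hZ2 hZ2,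
    pair_comm h.symm.self_of_nhds (nablaOct g Z x a).2]
  change partialD a (fun y => (Z y).1) x * (Z x).1 + _ + _ =
    2 * ((Z x).1 * partialD a (fun y => (Z y).1) x + _)
  ring

theorem alt3_nablaForm (a : Fin 7) : Alt3 (nablaForm g φ x a) := by
  obtain ⟨_, _, hx⟩ := h.adapted.self_of_nhds
  refine ⟨fun b c d => ?_, fun b c d => ?_⟩
  · have e1 : partialD a (fun y => φ y b c d) x = -partialD a (fun y => φ y c b d) x := by
      rw [← partialD_neg]
      exact partialD_congr a (h.adapted.mono fun y ⟨_, _, hy⟩ => hy.alt3.swap01 b c d)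
    have e2 : ∑ e, (christoffel g x e a b * φ x e c d + christoffel g x e a c * φ x b e d
        + christoffel g x e a d * φ x b c e) = -∑ e, (christoffel g x e a c * φ x e b d
        + christoffel g x e a b * φ x c e d + christoffel g x e a d * φ x c b e) := by
      rw [← Finset.sum_neg_distrib]
      refine Finset.sum_congr rfl fun e _ => ?_
      rw [hx.alt3.swap01 e c d, hx.alt3.swap01 b e d, hx.alt3.swap01 b c e]
      ring
    simp only [nablaForm, e1, e2]
    ring
  · have e1 : partialD a (fun y => φ y b c d) x = -partialD a (fun y => φ y b d c) x := by
      rw [← partialD_neg]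
      exact partialD_congr a (h.adapted.mono fun y ⟨_, _, hy⟩ => hy.alt3.swap12 b c d)
    have e2 : ∑ e, (christoffel g x e a b * φ x e c d + christoffel g x e a c * φ x b e d
        + christoffel g x e a d * φ x b c e) = -∑ e, (christoffel g x e a b * φ x e d c
        + christoffel g x e a d * φ x b e c + christoffel g x e a c * φ x b d e) := by
      rw [← Finset.sum_neg_distrib]
      refine Finset.sum_congr rfl fun e _ => ?_
      rw [hx.alt3.swap12 e c d, hx.alt3.swap12 b e d, hx.alt3.swap12 b c e]
      ring
    simp only [nablaForm, e1, e2]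
    ring

/-- `∇_a φ` is the associator with the torsion. -/
theorem cross_nablaForm (a : Fin 7) (A B : Bioct) :
    ((0, cross (g x) (nablaForm g φ x a) A.2 B.2) : Bioct) =
      octMul (g x) (φ x) (octMul (g x) (φ x) A B) (0, torsionUp g vol φ x a)
      - octMul (g x) (φ x) A (octMul (g x) (φ x) B (0, torsionUp g vol φ x a)) := by
  obtain ⟨P, R, hx⟩ := h.adapted.self_of_nhds
  have hX := h.alt3_nablaForm a
  refine hx.cross_eq_assoc_of_alternative hX (fun A B => ?_) A B
  have hXX : ∀ α, cross (g x) (nablaForm g φ x a) α α = 0 := by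
    obtain ⟨Y, hY, hXY⟩ := hx.exists_push3 hX
    intro α
    obtain ⟨U, hU⟩ := hx.fr_surjective (0, α)
    have e : α = push P.transpose U.2 := (congrArg Prod.snd hU).symm
    rw [hXY, e, hx.cross_push, self_eq_neg.1 (cross_swap hY U.2 U.2), map_zero]
  have hA : DifferentiableAt ℝ (fun _ : E7 => A) x := differentiableAt_const A
  have hB : DifferentiableAt ℝ (fun _ : E7 => B) x := differentiableAt_const B
  -- Left alternativity holds on a neighbourhood, so both sides can be differentiated. The fields
  -- with constant components `A` and `B` need not be parallel; their covariant derivatives are `U`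
  -- and `V` below.
  have hev : (fun y => octMul (g y) (φ y) A (octMul (g y) (φ y) A B)) =ᶠ[𝓝 x]
      fun y => octMul (g y) (φ y) (octMul (g y) (φ y) A A) B :=
    h.adapted.mono fun y ⟨_, _, hy⟩ => hy.octMul_left_alt A B
  have e := nablaOct_congr (g := g) hev a
  rw [h.nablaOct_octMul hA (h.diff_octMul hA hB), h.nablaOct_octMul hA hB,
    h.nablaOct_octMul (h.diff_octMul hA hA) hB, h.nablaOct_octMul hA hA] at e
  simp only [hXX] at e
  set U := nablaOct g (fun _ => A) x a
  set V := nablaOct g (fun _ => B) x a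
  -- Polarised alternativity removes the terms with `U`, and `l3` those with `V`. What remains is
  -- the linearised alternativity required of `∇_a φ`.
  have pol := hx.octMul_left_alt (A + U) B
  have l1 := hx.octMul_left_alt A B
  have l2 := hx.octMul_left_alt U B
  have l3 := hx.octMul_left_alt A V
  have z : ((0, 0) : Bioct) = 0 := rfl
  simp only [octMul_add_left, octMul_add_right, z, add_zero] at e pol
  rw [l1, l2] at pol
  rw [l3] at e
  linear_combination e - pol

end LocalG2


/-! ### The torsion of the transformed 3-form. -/

theorem cross_sigma_conj {P R g : Mat} {φ : T3} {vol : (Fin 7 → Fin 7) → ℂ}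
    (h : IsAdapted P R g φ vol) {Z : Bioct} (hZ : quadN g Z ≠ 0) (A B : Bioct) :
    octMul g (sigma g vol Z φ) A B =
      (quadN g Z)⁻¹ • octMul g φ (octMul g φ A (octMul g φ B Z)) (conj Z) := by
  rw [← h.octMul_sigma_octMul hZ, h.octMul_octMul_conj, inv_smul_smul₀ hZ]

theorem tri_deltaLow (w : T3) (b c d : Fin 7) :
    tri w (deltaLow b).2 (deltaLow c).2 (deltaLow d).2 = w b c d := by
  simp [tri, deltaLow]

namespace LocalG2

variable {g : E7 → Mat} {vol : E7 → (Fin 7 → Fin 7) → ℂ} {φ : E7 → T3} {x : E7}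
  (h : LocalG2 g vol φ x) {Z : E7 → Bioct} (hZ : DifferentiableAt ℝ Z x)
  (hN : quadN (g x) (Z x) ≠ 0)
include h hZ

theorem diff_quadN : DifferentiableAt ℝ (fun y => quadN (g y) (Z y)) x := by
  simp only [quadN, sq]
  exact (hZ.fst.fun_mul hZ.fst).fun_add (h.diff_pair hZ hZ)

include hN

theorem quadN_ne_zero : ∀ᶠ y in 𝓝 x, quadN (g y) (Z y) ≠ 0 :=
  (h.diff_quadN hZ).continuousAt.eventually_ne hN

/-- The field `σ_Z(φ)` is a field of `G₂`-structures. -/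
theorem sigma : LocalG2 g vol (fun y => G2Flux.sigma (g y) (vol y) (Z y) (φ y)) x where
  diff_metric := h.diff_metric
  diff_form b c d := by
    have hd : ∀ e, DifferentiableAt ℝ (fun _ : E7 => deltaLow e) x := fun e => differentiableAt_const _
    have hconj : DifferentiableAt ℝ (fun y => conj (Z y)) x :=
      DifferentiableAt.prodMk hZ.fst
        (differentiableAt_pi.2 fun i => (DifferentiableAt.snd_bioct hZ i).fun_neg)
    -- `LocalG2` contains no differentiability of the volume form, which enters `sigma` through the
    -- Hodge star. Writing the components through `(A(BZ)) conj Z` uses only the metric, `φ` and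
    -- `Z`.
    have hev : (fun y => G2Flux.sigma (g y) (vol y) (Z y) (φ y) b c d) =ᶠ[𝓝 x] fun y =>
        (quadN (g y) (Z y))⁻¹ * pair (g y) (deltaLow b).2 (octMul (g y) (φ y)
          (octMul (g y) (φ y) (deltaLow c) (octMul (g y) (φ y) (deltaLow d) (Z y))) (conj (Z y))).2 := by
      filter_upwards [h.adapted, h.quadN_ne_zero hZ hN] with y hy hNy
      obtain ⟨P, R, hy⟩ := hy
      rw [← pair_smul_right, ← Prod.smul_snd, ← cross_sigma_conj hy hNy]
      have e : (octMul (g y) (G2Flux.sigma (g y) (vol y) (Z y) (φ y)) (deltaLow c) (deltaLow d)).2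
          = cross (g y) (G2Flux.sigma (g y) (vol y) (Z y) (φ y)) (deltaLow c).2 (deltaLow d).2 := by
        funext m; simp [octMul, deltaLow]
      rw [e, pair_cross _ hy.metric_mul_inv, tri_deltaLow]
    refine DifferentiableAt.congr_of_eventuallyEq ?_ hev
    exact ((h.diff_quadN hZ).fun_inv hN).fun_mul (h.diff_pair (hd b)
      (h.diff_octMul (h.diff_octMul (hd c) (h.diff_octMul (hd d) hZ)) hconj))
  adapted := by
    filter_upwards [h.adapted, h.quadN_ne_zero hZ hN] with y hy hNy
    obtain ⟨P, R, hy⟩ := hy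
    exact hy.exists_isAdapted_sigma hNy

omit hZ hN in
/-- The bioctonion `(D_a Z) Z⁻¹`. -/
theorem octMul_covD_conj {Z : E7 → Bioct} (hN : quadN (g x) (Z x) ≠ 0) (a : Fin 7) :
    octMul (g x) (φ x) ((quadN (g x) (Z x))⁻¹ •
      octMul (g x) (φ x) (covD g vol φ Z x a) (conj (Z x))) (Z x) = covD g vol φ Z x a := by
  obtain ⟨_, _, hx⟩ := h.adapted.self_of_nhds
  rw [octMul_smul_left, hx.octMul_conj_octMul, inv_smul_smul₀ hN]

/-- Differentiate `(A ∘ B)Z = A(BZ)` and substitute `∇_a Z = WZ + ZT`. With `∇φ` written as an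
associator, the terms in `T` collapse to `((A ∘ B)Z)T` on the left and `(A(BZ))T` on the right,
which are equal. What is left is `YZ = A(B(WZ)) - (A ∘ B)(WZ)`, with `Y` the contribution of `∇φ_Z`.
Pulling `Z` out and cancelling it makes `Y` the associator of `∘` with `-W`. -/
theorem cross_nablaForm_sigma {a : Fin 7} {W : Bioct}
    (hW : octMul (g x) (φ x) W (Z x) = covD g vol φ Z x a) (A B : Bioct) :
    ((0, cross (g x) (nablaForm g (fun y => G2Flux.sigma (g y) (vol y) (Z y) (φ y)) x a) A.2 B.2) :
      Bioct) =
      octMul (g x) (G2Flux.sigma (g x) (vol x) (Z x) (φ x))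
        (octMul (g x) (G2Flux.sigma (g x) (vol x) (Z x) (φ x)) A B) (-W)
      - octMul (g x) (G2Flux.sigma (g x) (vol x) (Z x) (φ x)) A
        (octMul (g x) (G2Flux.sigma (g x) (vol x) (Z x) (φ x)) B (-W)) := by
  obtain ⟨P, R, hx⟩ := h.adapted.self_of_nhds
  have hs := h.sigma hZ hN
  have hA : DifferentiableAt ℝ (fun _ : E7 => A) x := differentiableAt_const A
  have hB : DifferentiableAt ℝ (fun _ : E7 => B) x := differentiableAt_const B
  set φ' : E7 → T3 := fun y => G2Flux.sigma (g y) (vol y) (Z y) (φ y) with hφ'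
  have key : ∀ A B, octMul (g x) (φ x) (octMul (g x) (φ' x) A B) (Z x)
      = octMul (g x) (φ x) A (octMul (g x) (φ x) B (Z x)) := hx.octMul_sigma_octMul hN
  have hev : (fun y => octMul (g y) (φ y) (octMul (g y) (φ' y) A B) (Z y)) =ᶠ[𝓝 x]
      fun y => octMul (g y) (φ y) A (octMul (g y) (φ y) B (Z y)) := by
    filter_upwards [h.adapted, h.quadN_ne_zero hZ hN] with y hy hNy
    obtain ⟨P, R, hy⟩ := hy
    exact hy.octMul_sigma_octMul hNy A B
  have e := nablaOct_congr (g := g) hev a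
  rw [h.nablaOct_octMul (hs.diff_octMul hA hB) hZ, hs.nablaOct_octMul hA hB,
    h.nablaOct_octMul hA (h.diff_octMul hB hZ), h.nablaOct_octMul hB hZ,
    h.cross_nablaForm a (octMul (g x) (φ' x) A B) (Z x), h.cross_nablaForm a B (Z x),
    h.cross_nablaForm a A (octMul (g x) (φ x) B (Z x))] at e
  set U := nablaOct g (fun _ => A) x a
  set V := nablaOct g (fun _ => B) x a
  set T : Bioct := (0, torsionUp g vol φ x a)
  have hD : nablaOct g Z x a = octMul (g x) (φ x) W (Z x) + octMul (g x) (φ x) (Z x) T := by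
    rw [hW, covD, sub_add_cancel]
  set Y : Bioct := (0, cross (g x) (nablaForm g φ' x a) A.2 B.2) with hY
  apply hx.octMul_right_cancel hN
  have e1 := key A (octMul (g x) (φ' x) B W)
  have e2 := key (octMul (g x) (φ' x) A B) W
  have e3 := key B W
  have e4 := key U B
  have e5 := key A V
  have e6 := key A B
  rw [e3] at e1
  simp only [hD, octMul_add_left, octMul_add_right, octMul_sub_right, e4, e5, e6] at e
  have n1 : ∀ w A, octMul (g x) w A (-W) = -octMul (g x) w A W := fun w A =>
    (octMulL (g x) w A).map_neg W
  have n2 : ∀ A, octMul (g x) (φ' x) A (-octMul (g x) (φ' x) B W)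
    = -octMul (g x) (φ' x) A (octMul (g x) (φ' x) B W) := fun A =>
    (octMulL (g x) (φ' x) A).map_neg _
  have n3 : ∀ A, octMul (g x) (φ x) (-A) (Z x) = -octMul (g x) (φ x) A (Z x) := fun A =>
    (octMulL (g x) (φ x)).map_neg₂ A _
  rw [show G2Flux.sigma (g x) (vol x) (Z x) (φ x) = φ' x from rfl]
  simp only [n1, n2, octMul_sub_left, n3]
  linear_combination e - e1 + e2

/-- The torsion of `σ_Z(φ)` is `-Im ((D_a Z) Z⁻¹)`. -/
theorem torsionUp_sigma {a : Fin 7} {W : Bioct}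
    (hW : octMul (g x) (φ x) W (Z x) = covD g vol φ Z x a) (m : Fin 7) :
    torsionUp g vol (fun y => G2Flux.sigma (g y) (vol y) (Z y) (φ y)) x a m = -W.2 m := by
  have hs := h.sigma hZ hN
  obtain ⟨P, R, hx⟩ := hs.adapted.self_of_nhds
  exact hx.raise_torsion_of_assoc (hs.alt3_nablaForm a) (h.cross_nablaForm_sigma hZ hN hW) m

/-- `d log N(Z) = 2 Re ((D_a Z) Z⁻¹)`. -/
theorem partialD_quadN_eq {a : Fin 7} {W : Bioct}
    (hW : octMul (g x) (φ x) W (Z x) = covD g vol φ Z x a) :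
    (quadN (g x) (Z x))⁻¹ * partialD a (fun y => quadN (g y) (Z y)) x = 2 * W.1 := by
  obtain ⟨P, R, hx⟩ := h.adapted.self_of_nhds
  have hD : nablaOct g Z x a = octMul (g x) (φ x) W (Z x)
      + octMul (g x) (φ x) (Z x) (0, torsionUp g vol φ x a) := by
    rw [hW, covD, sub_add_cancel]
  -- The torsion part `ZT` of `∇_a Z` is orthogonal to `Z`, so only `⟨Z, WZ⟩ = N(Z) Re W`
  -- contributes to the derivative of the norm.
  have e1 := hx.inner_octMul_imag (Z x) (torsionUp g vol φ x a)
  have e2 := hx.inner_octMul_self (Z x) W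
  rw [h.partialD_quadN hZ, hD, Prod.fst_add, Prod.snd_add, pair_add_right]
  rw [inv_mul_eq_iff_eq_mul₀ hN]
  linear_combination 2 * e1 + 2 * e2

end LocalG2


/-! ### The exterior derivative and the torsion form of the Killing equation. -/

theorem iota_add (g : Mat) (ψ : T4) (h k : T2) : iota g ψ (h + k) = iota g ψ h + iota g ψ k := by
  funext a b c d
  simp only [iota, Pi.add_apply, mul_add, add_mul, Finset.sum_add_distrib, Finset.sum_sub_distrib]
  ring

theorem iota_smul (g : Mat) (ψ : T4) (r : ℂ) (h : T2) : iota g ψ (r • h) = r • iota g ψ h := by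
  have e : ∀ m a, ∑ n, g⁻¹ m n * (r * h a n) = r * ∑ n, g⁻¹ m n * h a n := fun m a => by
    simp only [mul_left_comm _ r, ← Finset.mul_sum]
  funext a b c d
  simp only [iota, Pi.smul_apply, smul_eq_mul, e]
  rw [mul_left_comm r]
  congr 1
  rw [Finset.mul_sum]
  exact Finset.sum_congr rfl fun m _ => by ring

theorem eq_of_lower_eq {g : Mat} (hg : g⁻¹ * g = 1) {α β : T1}
    (h : ∀ b, ∑ m, g b m * α m = ∑ m, g b m * β m) : α = β := by
  refine eq_of_pair_eq hg fun γ => ?_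
  have e : ∀ δ, pair g γ δ = ∑ b, γ b * ∑ m, g b m * δ m := fun δ => by
    simp only [pair, Finset.mul_sum]
    exact Finset.sum_congr rfl fun _ _ => Finset.sum_congr rfl fun _ _ => by ring
  rw [e, e]
  exact Finset.sum_congr rfl fun b _ => by rw [h]

namespace IsAdapted

variable {P R g : Mat} {φ : T3} {vol : (Fin 7 → Fin 7) → ℂ} (h : IsAdapted P R g φ vol)
include h

theorem iota_metric : iota g (hodge g vol φ) (fun a b => g a b) = hodge g vol φ := by
  have e : (fun a b => g a b) = lift2 R (fun i j => if i = j then (1 : ℂ) else 0) := by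
    funext i j
    rw [lift2_apply, h.metric_eq]
    simp [Matrix.mul_apply]
  rw [e, h.hodge_eq, h.toIsFrame.iota_lift, iota_psiS_delta]

theorem iota_contract (q : T1) : iota g (hodge g vol φ) (contract g q φ)
    = (-(3 / 4) : ℂ) • wedge13 q φ := by
  obtain ⟨q, rfl⟩ : ∃ u, q = push R u := ⟨push P q, by rw [push_push, h.mul_eq', push_one]⟩
  rw [h.hodge_eq, h.form_eq, h.toIsFrame.contract_push, h.toIsFrame.iota_lift, wedge13_phiS_eq_iota,
    wedge13_push]
  exact (lift4L R).map_smul _ _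

theorem eq_sum_hodge_of_assoc {X : T3} (hX : Alt3 X) {W : Bioct} (hW : ∀ A B : Bioct,
    ((0, cross g X A.2 B.2) : Bioct) =
      octMul g φ (octMul g φ A B) W - octMul g φ A (octMul g φ B W)) (b c d : Fin 7) :
    X b c d = 2 * ∑ e, W.2 e * hodge g vol φ e b c d := by
  obtain ⟨Y, hY, rfl⟩ := h.exists_push3 hX
  obtain ⟨W, rfl⟩ := h.fr_surjective W
  have hT : Y = twoContractPsi W.2 := by
    refine eq_twoContractPsi_of_assoc fun A B => h.fr_injective ?_
    have := hW (fr P A) (fr P B)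
    simpa only [h.octMul_cross_fr, h.octMul_fr, ← map_sub] using this
  have hPR : P.transpose.transpose * R = 1 := h.transpose_mul
  have e := sum_push_smul_push hPR W.2 (fun i => push3 R (psiS i))
  rw [hT, h.hodge_eq, fr_snd]
  have e1 : twoContractPsi W.2 = (2 : ℂ) • ∑ i, W.2 i • psiS i := by
    funext b c d; simp [twoContractPsi]
  have e2 : push3 R (twoContractPsi W.2) = (2 : ℂ) • ∑ i, W.2 i • push3 R (psiS i) := by
    rw [e1]
    refine ((push3L R).map_smul _ _).trans (congrArg _ ?_)
    exact (map_sum (push3L R) _ _).trans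
      (Finset.sum_congr rfl fun i _ => (push3L R).map_smul _ _)
  rw [e2, ← e]
  simp [lift4]

end IsAdapted

theorem christoffel_comm {g : E7 → Mat} {x : E7} (hs : ∀ᶠ y in 𝓝 x, ∀ i j, g y i j = g y j i)
    (k i j : Fin 7) : christoffel g x k i j = christoffel g x k j i := by
  simp only [christoffel]
  congr 1
  refine Finset.sum_congr rfl fun l _ => ?_
  rw [partialD_congr l (hs.mono fun y hy => hy i j)]
  ring

/-- The Christoffel symbols are symmetric in their lower indices and the form is alternating, so the
connection terms cancel in pairs. -/
theorem extD_eq_nablaForm {g : E7 → Mat} {w : E7 → T3} {x : E7}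
    (hs : ∀ᶠ y in 𝓝 x, ∀ i j, g y i j = g y j i) (hw : Alt3 (w x)) (a b c d : Fin 7) :
    extD w x a b c d = nablaForm g w x a b c d - nablaForm g w x b a c d + nablaForm g w x c a b d
      - nablaForm g w x d a b c := by
  have e : ∑ e, (christoffel g x e a b * w x e c d + christoffel g x e a c * w x b e d
        + christoffel g x e a d * w x b c e)
      - ∑ e, (christoffel g x e b a * w x e c d + christoffel g x e b c * w x a e d
        + christoffel g x e b d * w x a c e)
      + ∑ e, (christoffel g x e c a * w x e b d + christoffel g x e c b * w x a e d
        + christoffel g x e c d * w x a b e)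
      - ∑ e, (christoffel g x e d a * w x e b c + christoffel g x e d b * w x a e c
        + christoffel g x e d c * w x a b e) = 0 := by
    simp only [← Finset.sum_add_distrib, ← Finset.sum_sub_distrib]
    refine Finset.sum_eq_zero fun e _ => ?_
    rw [christoffel_comm hs e b a, christoffel_comm hs e c a, christoffel_comm hs e c b,
      christoffel_comm hs e d a, christoffel_comm hs e d b, christoffel_comm hs e d c,
      hw.swap01 e b d, hw.swap12 a c e, hw.swap01 e b c, hw.swap12 b e c]
    ring
  simp only [extD, nablaForm]
  linear_combination e

/-- The Killing equation for given components of the flux. -/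
theorem killing_iff_of_isAdapted {P R P' R' g : Mat} {φ φ' : T3} {vol : (Fin 7 → Fin 7) → ℂ}
    (hx : IsAdapted P R g φ vol) (hx' : IsAdapted P' R' g φ' vol) {Z : Bioct} (hN : quadN g Z ≠ 0)
    (key : ∀ A B, octMul g φ (octMul g φ' A B) Z = octMul g φ A (octMul g φ B Z))
    {F : T4} {Q₀ : ℂ} {Q₁ : T1} {Q₂ : T2}
    (hQ : IsFluxDecomposition g φ' (hodge g vol φ') F Q₀ Q₁ Q₂) (c : ℂ) (W : Bioct) (a : Fin 7) :
    octMul g φ W Z = (-(c / 2)) • octMul g φ (deltaLow a) Z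
      + Complex.I • octMul g φ (deltaLow a) (opG4 g φ F Z) + (12 * Complex.I) • opG3 g φ F a Z ↔
    (∀ b, -∑ m, g b m * W.2 m = (c / 2 + (5 / 6) * Complex.I * Q₀) * g a b
      + contract g (-(Complex.I / 3) • Q₁) φ' a b + Complex.I * Q₂ a b) ∧
    W.1 = (4 / 3) * Complex.I * Q₁ a := by
  obtain ⟨hJ1, hJ2⟩ := hx'.flux_term hQ a
  -- The whole right side is a single element times `Z`. Since `N(Z) ≠ 0`, the equation says that
  -- `W` equals this element, and the two conditions are its imaginary and real parts.
  have hK : (-(c / 2)) • octMul g φ (deltaLow a) Z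
      + Complex.I • octMul g φ (deltaLow a) (opG4 g φ F Z) + (12 * Complex.I) • opG3 g φ F a Z
      = octMul g φ ((-(c / 2)) • deltaLow a + (Complex.I • octMul g φ' (deltaLow a)
        (opG4 g φ' F (1, 0)) + (12 * Complex.I) • opG3 g φ' F a (1, 0))) Z := by
    rw [opG4_eq_octMul key, opG3_eq_octMul key, ← key]
    simp only [octMul_add_left, octMul_smul_left, add_assoc]
  rw [hK]
  generalize Complex.I • octMul g φ' (deltaLow a) (opG4 g φ' F (1, 0))
    + (12 * Complex.I) • opG3 g φ' F a (1, 0) = J at hJ1 hJ2 ⊢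
  have hd : ∀ b, ∑ m, g b m * (((-(c / 2)) • deltaLow a + J).2 m) =
      -(c / 2) * g a b + ∑ m, g b m * J.2 m := by
    intro b
    simp only [Prod.snd_add, Prod.smul_snd, Pi.add_apply, Pi.smul_apply, smul_eq_mul, mul_add,
      Finset.sum_add_distrib, deltaLow]
    simp [hx.metric_symm b a, mul_comm]
  have h1 : ((-(c / 2)) • deltaLow a + J).1 = (4 / 3) * Complex.I * Q₁ a := by
    rw [Prod.fst_add, hJ1]; simp [deltaLow]
  constructor
  · intro hW
    have hWJ := hx.octMul_right_cancel hN hW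
    refine ⟨fun b => ?_, by rw [hWJ, h1]⟩
    rw [hWJ, hd, hJ2]; ring
  · rintro ⟨ht, hq⟩
    have hWJ : W = (-(c / 2)) • deltaLow a + J := by
      refine Prod.ext (by rw [h1, hq]) (eq_of_lower_eq hx.inv_mul_metric fun b => ?_)
      rw [hd, hJ2]
      linear_combination -ht b
    rw [hWJ]

namespace LocalG2

variable {g : E7 → Mat} {vol : E7 → (Fin 7 → Fin 7) → ℂ} {φ : E7 → T3} {x : E7}
  (h : LocalG2 g vol φ x)
include h

theorem raise_torsionLow (a m : Fin 7) :
    ∑ n, (g x)⁻¹ m n * torsionLow g vol φ x a n = torsionUp g vol φ x a m := by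
  have : ∑ n, (g x)⁻¹ m n * torsionLow g vol φ x a n
      = ((g x)⁻¹ * g x).mulVec (torsionUp g vol φ x a) m := by
    rw [← Matrix.mulVec_mulVec]
    rfl
  rw [this, h.inv_mul, Matrix.one_mulVec]

/-- `dφ = 8 ι_ψ(T)`. -/
theorem extD_eq_iota (a b c d : Fin 7) : extD φ x a b c d =
    8 * iota (g x) (hodge (g x) (vol x) (φ x)) (torsionLow g vol φ x) a b c d := by
  obtain ⟨P, R, hx⟩ := h.adapted.self_of_nhds
  have e : ∀ a b c d, nablaForm g φ x a b c d = 2 * ∑ e, torsionUp g vol φ x a e *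
      hodge (g x) (vol x) (φ x) e b c d := fun a b c d =>
    hx.eq_sum_hodge_of_assoc (h.alt3_nablaForm a) (h.cross_nablaForm a) b c d
  -- The factor 8 is the 2 in `∇_a φ = 2 T_a ⌟ ψ` times 4, which undoes the weight-one alternation
  -- in `iota`.
  rw [extD_eq_nablaForm h.symm hx.alt3]
  simp only [iota, h.raise_torsionLow, e, Finset.sum_add_distrib, Finset.sum_sub_distrib]
  ring

/-- The Killing equation in terms of the torsion of `σ_Z(φ)`, for given components of the flux. -/
theorem killing_iff_torsionLow {Z : E7 → Bioct} (hZ : DifferentiableAt ℝ Z x)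
    (hN : quadN (g x) (Z x) ≠ 0) {F : T4} {Q₀ : ℂ} {Q₁ : T1} {Q₂ : T2}
    (hQ : IsFluxDecomposition (g x) (G2Flux.sigma (g x) (vol x) (Z x) (φ x))
      (hodge (g x) (vol x) (G2Flux.sigma (g x) (vol x) (Z x) (φ x))) F Q₀ Q₁ Q₂) (c : ℂ) :
    (∀ a, covD g vol φ Z x a = (-(c / 2)) • octMul (g x) (φ x) (deltaLow a) (Z x)
      + Complex.I • octMul (g x) (φ x) (deltaLow a) (opG4 (g x) (φ x) F (Z x))
      + (12 * Complex.I) • opG3 (g x) (φ x) F a (Z x)) ↔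
    (∀ a b, torsionLow g vol (fun y => G2Flux.sigma (g y) (vol y) (Z y) (φ y)) x a b =
      (c / 2 + (5 / 6) * Complex.I * Q₀) * g x a b + contract (g x) (-(Complex.I / 3) • Q₁)
        (G2Flux.sigma (g x) (vol x) (Z x) (φ x)) a b + Complex.I * Q₂ a b) ∧
    ∀ a, -(Complex.I / 3) * Q₁ a = -(1 / 8) * ((quadN (g x) (Z x))⁻¹ *
      partialD a (fun y => quadN (g y) (Z y)) x) := by
  obtain ⟨_, _, hx⟩ := h.adapted.self_of_nhds
  obtain ⟨_, _, hx'⟩ := hx.exists_isAdapted_sigma hN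
  have key := hx.octMul_sigma_octMul hN
  obtain ⟨W, hW⟩ : ∃ W : Fin 7 → Bioct, ∀ a, octMul (g x) (φ x) (W a) (Z x) = covD g vol φ Z x a :=
    ⟨_, h.octMul_covD_conj hN⟩
  have hT : ∀ a b, torsionLow g vol (fun y => G2Flux.sigma (g y) (vol y) (Z y) (φ y)) x a b
      = -∑ m, g x b m * (W a).2 m := by
    intro a b
    simp only [torsionLow, h.torsionUp_sigma hZ hN (hW a), mul_neg, Finset.sum_neg_distrib]
  simp only [hT, fun a => h.partialD_quadN_eq hZ hN (hW a), ← hW,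
    fun a => killing_iff_of_isAdapted hx hx' hN key hQ c (W a) a, forall_and]
  -- Since `d log N(Z) = 2 Re W`, the equation `-(i/3)Q₁ = -(1/8) d log N(Z)` is the real part
  -- condition `Re W = (4/3)iQ₁` divided by `-4`.
  refine and_congr_right fun _ => forall_congr' fun a => ?_
  constructor
  · intro e; rw [e]; ring
  · intro e; linear_combination 4 * e

end LocalG2

namespace LocalG2

variable {g : E7 → Mat} {vol : E7 → (Fin 7 → Fin 7) → ℂ} {φ : E7 → T3} {x : E7}
  (h : LocalG2 g vol φ x) {Z : E7 → Bioct} (hZ : DifferentiableAt ℝ Z x)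
  (hN : quadN (g x) (Z x) ≠ 0)
include h hZ hN

/-- The Killing equation is equivalent to the torsion equations. -/
theorem killing_iff {F : T4} (hF : Alt4 F) (c : ℂ) :
    (∀ a, covD g vol φ Z x a = (-(c / 2)) • octMul (g x) (φ x) (deltaLow a) (Z x)
      + Complex.I • octMul (g x) (φ x) (deltaLow a) (opG4 (g x) (φ x) F (Z x))
      + (12 * Complex.I) • opG3 (g x) (φ x) F a (Z x)) ↔
    ∃ (Q₀ : ℂ) (Q₁ : T1) (Q₂ : T2) (τ₁ : ℂ) (τ₇ : T1) (τ₁₄ τ₂₇ : T2),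
      IsFluxDecomposition (g x) (G2Flux.sigma (g x) (vol x) (Z x) (φ x))
        (hodge (g x) (vol x) (G2Flux.sigma (g x) (vol x) (Z x) (φ x))) F Q₀ Q₁ Q₂ ∧
      IsTorsionDecomposition (g x) (G2Flux.sigma (g x) (vol x) (Z x) (φ x))
        (torsionLow g vol (fun y => G2Flux.sigma (g y) (vol y) (Z y) (φ y)) x) τ₁ τ₇ τ₁₄ τ₂₇ ∧
      τ₁ = c / 2 + (5 / 6) * Complex.I * Q₀ ∧
      (∀ a, τ₇ a = -(Complex.I / 3) * Q₁ a) ∧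
      (∀ a, τ₇ a = -(1 / 8) * ((quadN (g x) (Z x))⁻¹ *
        partialD a (fun y => quadN (g y) (Z y)) x)) ∧
      (∀ a b, τ₁₄ a b = 0) ∧ (∀ a b, τ₂₇ a b = Complex.I * Q₂ a b) := by
  constructor
  · intro hcov
    obtain ⟨_, _, hx⟩ := h.adapted.self_of_nhds
    obtain ⟨_, _, hx'⟩ := hx.exists_isAdapted_sigma hN
    obtain ⟨Q₀, Q₁, Q₂, hQ⟩ := hx'.exists_fluxDecomposition hF
    obtain ⟨hT, hq⟩ := (h.killing_iff_torsionLow hZ hN hQ c).1 hcov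
    refine ⟨Q₀, Q₁, Q₂, _, -(Complex.I / 3) • Q₁, 0, fun a b => Complex.I * Q₂ a b, hQ,
      ⟨fun a b => ?_, fun a b => ?_, fun c => ?_, fun a b => ?_, ?_⟩, rfl, fun a => rfl,
      fun a => hq a, fun a b => rfl, fun a b => rfl⟩
    · rw [hT]; simp
    · simp
    · simp
    · rw [hQ.symm]
    · simp only [mul_left_comm _ Complex.I, ← Finset.mul_sum, hQ.traceless, mul_zero]
  · rintro ⟨Q₀, Q₁, Q₂, τ₁, τ₇, τ₁₄, τ₂₇, hQ, hT, h1, h7, hd, h14, h27⟩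
    have e7 : τ₇ = -(Complex.I / 3) • Q₁ := funext h7
    refine (h.killing_iff_torsionLow hZ hN hQ c).2 ⟨fun a b => ?_, fun a => ?_⟩
    · rw [hT.sum_eq, h14, h27, h1, e7, add_zero]
    · rw [← h7, hd]

/-- The Killing equation for the flux determined by the torsion of `σ_Z(φ)`. -/
theorem killing_of_torsion {F : T4} (c : ℂ) {τ₁ : ℂ} {τ₇ : T1} {τ₂₇ : T2}
    (hT : IsTorsionDecomposition (g x) (G2Flux.sigma (g x) (vol x) (Z x) (φ x))
      (torsionLow g vol (fun y => G2Flux.sigma (g y) (vol y) (Z y) (φ y)) x) τ₁ τ₇ 0 τ₂₇)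
    (hd : ∀ a, τ₇ a = -(1 / 8) * ((quadN (g x) (Z x))⁻¹ *
        partialD a (fun y => quadN (g y) (Z y)) x))
    (hF : ∀ a b c' d, F a b c' d = -(Complex.I / 2) *
        extD (fun y => G2Flux.sigma (g y) (vol y) (Z y) (φ y)) x a b c' d
      + (Complex.I / 5) * (14 * τ₁ + 3 * c) *
        hodge (g x) (vol x) (G2Flux.sigma (g x) (vol x) (Z x) (φ x)) a b c' d) (a : Fin 7) :
    covD g vol φ Z x a = (-(c / 2)) • octMul (g x) (φ x) (deltaLow a) (Z x)
      + Complex.I • octMul (g x) (φ x) (deltaLow a) (opG4 (g x) (φ x) F (Z x))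
      + (12 * Complex.I) • opG3 (g x) (φ x) F a (Z x) := by
  obtain ⟨_, _, hx⟩ := h.adapted.self_of_nhds
  obtain ⟨_, _, hx'⟩ := hx.exists_isAdapted_sigma hN
  have hs := h.sigma hZ hN
  have e2 := hs.extD_eq_iota
  have I2 := Complex.I_sq
  have eT : torsionLow g vol (fun y => G2Flux.sigma (g y) (vol y) (Z y) (φ y)) x =
      τ₁ • (fun a b => g x a b) + contract (g x) τ₇ (G2Flux.sigma (g x) (vol x) (Z x) (φ x)) + τ₂₇ := by
    funext a b
    rw [hT.sum_eq]
    simp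
  have eI : iota (g x) (hodge (g x) (vol x) (G2Flux.sigma (g x) (vol x) (Z x) (φ x)))
      (torsionLow g vol (fun y => G2Flux.sigma (g y) (vol y) (Z y) (φ y)) x) =
      τ₁ • hodge (g x) (vol x) (G2Flux.sigma (g x) (vol x) (Z x) (φ x))
        + (-(3 / 4) : ℂ) • wedge13 τ₇ (G2Flux.sigma (g x) (vol x) (Z x) (φ x))
        + iota (g x) (hodge (g x) (vol x) (G2Flux.sigma (g x) (vol x) (Z x) (φ x))) τ₂₇ := by
    rw [eT, iota_add, iota_add, iota_smul, hx'.iota_metric, hx'.iota_contract]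
  -- Components read off from `dφ_Z = 8 ι_ψ(T)`: `-4iτ₁ + (14/5)iτ₁ = -(6/5)iτ₁` for `ψ_Z`,
  -- `(-4i)(-3/4) = 3i` for `τ₇`, and `-4i = 4·(-i)` for `τ₂₇`. The coefficient of `ψ_Z` is exactly
  -- the solution `Q₀` of `τ₁ = c/2 + (5/6)iQ₀`.
  have hQ : IsFluxDecomposition (g x) (G2Flux.sigma (g x) (vol x) (Z x) (φ x))
      (hodge (g x) (vol x) (G2Flux.sigma (g x) (vol x) (Z x) (φ x))) F
      (-(6 / 5) * Complex.I * τ₁ + (3 / 5) * Complex.I * c) ((3 * Complex.I) • τ₇)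
      ((-Complex.I) • τ₂₇) := by
    refine ⟨fun i j k l => ?_, fun i j => ?_, ?_⟩
    · have e3 : (fun i j => 4 * ((-Complex.I) • τ₂₇) i j) = (-4 * Complex.I) • τ₂₇ := by
        funext i j; simp; ring
      have e4 : wedge13 ((3 * Complex.I) • τ₇) (G2Flux.sigma (g x) (vol x) (Z x) (φ x)) i j k l
          = (3 * Complex.I) * wedge13 τ₇ (G2Flux.sigma (g x) (vol x) (Z x) (φ x)) i j k l := by
        simp only [wedge13, Pi.smul_apply, smul_eq_mul]; ring
      rw [hF, e2, eI, e3, iota_smul, e4]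
      simp only [Pi.add_apply, Pi.smul_apply, smul_eq_mul]
      ring
    · simp only [Pi.smul_apply, hT.symm i j]
    · simp only [Pi.smul_apply, smul_eq_mul, mul_left_comm _ (-Complex.I), ← Finset.mul_sum,
        hT.traceless, mul_zero]
  refine (h.killing_iff_torsionLow hZ hN hQ c).2 ⟨fun i j => ?_, fun i => ?_⟩ a
  · have e7 : -(Complex.I / 3) • (3 * Complex.I) • τ₇ = τ₇ := by
      rw [smul_smul, show -(Complex.I / 3) * (3 * Complex.I) = 1 by linear_combination -I2, one_smul]
    rw [e7, eT]
    simp only [Pi.add_apply, Pi.smul_apply, smul_eq_mul]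
    linear_combination (τ₁ * g x i j - (1 / 2) * c * g x i j + τ₂₇ i j) * I2
  · rw [← hd]
    simp only [Pi.smul_apply, smul_eq_mul]
    linear_combination -τ₇ i * I2

end LocalG2


/-! ### Smooth fields on the manifold and their components in a chart. -/

section Manifold

variable {M : Type*} [TopologicalSpace M] [ChartedSpace E7 M] [IsManifold (𝓡 7) ∞ M]

omit [IsManifold (𝓡 7) ∞ M] in
theorem pointAt_center (p : M) : pointAt p (center p) = p := extChartAt_to_inv p

omit [IsManifold (𝓡 7) ∞ M] in
theorem target_mem_nhds_center (p : M) : (extChartAt (𝓡 7) p).target ∈ 𝓝 (center p) :=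
  extChartAt_target_mem_nhds p

theorem mem_baseSet {p : M} {x : E7} (hx : x ∈ (extChartAt (𝓡 7) p).target) :
    pointAt p x ∈ (trivializationAt E7 (TangentSpace (𝓡 7) : M → Type _) p).baseSet := by
  have := (extChartAt (𝓡 7) p).map_target hx
  rw [extChartAt_source] at this
  exact this

theorem contMDiffAt_pointAt (p : M) : ContMDiffAt 𝓘(ℝ, E7) (𝓡 7) ∞ (pointAt p) (center p) :=
  (contMDiffOn_extChartAt_symm p).contMDiffAt (target_mem_nhds_center p)

theorem differentiableAt_comp_pointAt {V : Type*} [NormedAddCommGroup V] [NormedSpace ℝ V]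
    {f : M → V} {p : M} (hf : ContMDiffAt (𝓡 7) 𝓘(ℝ, V) ∞ f p) :
    DifferentiableAt ℝ (fun x => f (pointAt p x)) (center p) := by
  have h1 : ContMDiffAt 𝓘(ℝ, E7) 𝓘(ℝ, V) ∞ (fun x => f (pointAt p x)) (center p) := by
    refine ContMDiffAt.comp (center p) (g := f) ?_ (contMDiffAt_pointAt p)
    rw [pointAt_center]; exact hf
  exact (contMDiffAt_iff_contDiffAt.1 h1).differentiableAt (by simp)

theorem contMDiffAt_inner (S : G2Structure M) {ξ η : ∀ q : M, TangentSpace (𝓡 7) q} {p : M}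
    (hξ : ContMDiffAt (𝓡 7) (𝓡 7).tangent ∞ (fun q => (⟨q, ξ q⟩ : TangentBundle (𝓡 7) M)) p)
    (hη : ContMDiffAt (𝓡 7) (𝓡 7).tangent ∞ (fun q => (⟨q, η q⟩ : TangentBundle (𝓡 7) M)) p) :
    ContMDiffAt (𝓡 7) 𝓘(ℝ, ℝ) ∞ (fun q => S.metric.inner q (ξ q) (η q)) p := by
  have h := ContMDiffAt.clm_bundle_apply₂ (F₃ := ℝ) (E₃ := Bundle.Trivial M ℝ) (b := fun q : M => q)
    (S.metric.contMDiff p) hξ hη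
  simp only [Bundle.contMDiffAt_totalSpace] at h
  exact h.2

/-- In the trivialization at `p` this vector field is the constant `v`. -/
theorem contMDiffAt_coordVector (p : M) (v : E7) : ContMDiffAt (𝓡 7) (𝓡 7).tangent ∞
    (fun q => (⟨q, (trivializationAt E7 (TangentSpace (𝓡 7) : M → Type _) p).symmL ℝ q v⟩ :
      TangentBundle (𝓡 7) M)) p := by
  rw [Bundle.contMDiffAt_section]
  refine (contMDiffAt_const (c := v)).congr_of_eventuallyEq ?_
  filter_upwards [(trivializationAt E7 (TangentSpace (𝓡 7) : M → Type _) p).open_baseSet.mem_nhds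
    (FiberBundle.mem_baseSet_trivializationAt' p)] with q hq
  have := (trivializationAt E7 (TangentSpace (𝓡 7) : M → Type _) p).continuousLinearMapAt_symmL (R := ℝ) hq v
  rw [Bundle.Trivialization.continuousLinearMapAt_apply, Bundle.Trivialization.linearMapAt_apply, if_pos hq] at this
  exact this

theorem diff_gC (S : G2Structure M) (p : M) (i j : Fin 7) :
    DifferentiableAt ℝ (fun x => S.gC p x i j) (center p) := by
  have h := differentiableAt_comp_pointAt (contMDiffAt_inner S
    (contMDiffAt_coordVector p (EuclideanSpace.single i 1))
    (contMDiffAt_coordVector p (EuclideanSpace.single j 1)))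
  exact (Complex.ofRealCLM.differentiableAt.comp _ h)

theorem diff_phiC (S : G2Structure M) (p : M) (i j k : Fin 7) :
    DifferentiableAt ℝ (fun x => S.phiC p x i j k) (center p) := by
  have h := ((S.smooth_form p ![i, j, k]).contDiffAt (target_mem_nhds_center p)).differentiableAt
    (by simp)
  exact (Complex.ofRealCLM.differentiableAt.comp _ h)

theorem diff_vecCoord {ξ : ∀ q : M, TangentSpace (𝓡 7) q} {p : M}
    (hξ : ContMDiffAt (𝓡 7) (𝓡 7).tangent ∞ (fun q => (⟨q, ξ q⟩ : TangentBundle (𝓡 7) M)) p) :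
    DifferentiableAt ℝ (vecCoord ξ p) (center p) :=
  differentiableAt_comp_pointAt ((Bundle.contMDiffAt_section p).1 hξ)

theorem diff_coord (Z : BioctonionSection M) (p : M) :
    DifferentiableAt ℝ (Z.coord p) (center p) := by
  have h1 := diff_vecCoord (Z.smooth_vecRe p)
  have h2 := diff_vecCoord (Z.smooth_vecIm p)
  refine DifferentiableAt.prodMk (differentiableAt_comp_pointAt (Z.smooth_scalar p))
    (differentiableAt_pi.2 fun i => ?_)
  have e : ∀ {f : E7 → E7}, DifferentiableAt ℝ f (center p) →
      DifferentiableAt ℝ (fun x => ((f x i : ℝ) : ℂ)) (center p) := fun hf =>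
    Complex.ofRealCLM.differentiableAt.comp _ ((EuclideanSpace.proj (𝕜 := ℝ) i).differentiableAt.comp _ hf)
  exact (e h1).fun_add ((e h2).const_mul _)

end Manifold


/-! ### From real adapted bases to complexified coframe matrices. -/

section LinearAlgebra

variable {E : Type*} [AddCommGroup E] [Module ℝ E]

theorem alternating_three_eq_sum (b : Module.Basis (Fin 7) ℝ E) (w : E [⋀^Fin 3]→ₗ[ℝ] ℝ)
    (u v z : E) : w ![u, v, z] =
      ∑ i, b.repr u i * ∑ j, b.repr v j * ∑ k, b.repr z k * w ![b i, b j, b k] := by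
  have e (f : E →ₗ[ℝ] ℝ) (y : E) : f y = ∑ i, b.repr y i * f (b i) := by
    conv_lhs => rw [← b.sum_repr y, map_sum]
    simp only [map_smul, smul_eq_mul]
  have h3 (u v z : E) : w ![u, v, z] = ∑ k, b.repr z k * w ![u, v, b k] :=
    e ((w.toMultilinearMap.toLinearMap ![u, v, 0] 2).copy (fun y => w ![u, v, y]) (by
      funext y; simp [MultilinearMap.toLinearMap]; congr 1; funext i; fin_cases i <;> rfl)) z
  have h2 (u v z : E) : w ![u, v, z] = ∑ k, b.repr v k * w ![u, b k, z] :=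
    e ((w.toMultilinearMap.toLinearMap ![u, 0, z] 1).copy (fun y => w ![u, y, z]) (by
      funext y; simp [MultilinearMap.toLinearMap]; congr 1; funext i; fin_cases i <;> rfl)) v
  have h1 (u v z : E) : w ![u, v, z] = ∑ k, b.repr u k * w ![b k, v, z] :=
    e ((w.toMultilinearMap.toLinearMap ![0, v, z] 0).copy (fun y => w ![y, v, z]) (by
      funext y; simp [MultilinearMap.toLinearMap]; congr 1; funext i; fin_cases i <;> rfl)) u
  rw [h1]
  refine Finset.sum_congr rfl fun i _ => ?_
  rw [h2]
  congr 1
  refine Finset.sum_congr rfl fun j _ => ?_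
  rw [h3]

/-- The rows of `R` are the coordinates of the vectors `c i` in the adapted basis `b`. The volume
form has value one on `b`, so it is the determinant in that basis and its components in `c` are the
minors of `R`. -/
theorem exists_isAdapted_of_basis (B : E →ₗ[ℝ] E →ₗ[ℝ] ℝ) (w : E [⋀^Fin 3]→ₗ[ℝ] ℝ)
    (vol : E [⋀^Fin 7]→ₗ[ℝ] ℝ) (b c : Module.Basis (Fin 7) ℝ E)
    (hB : ∀ i j, B (b i) (b j) = if i = j then 1 else 0)
    (hw : ∀ i j k, w ![b i, b j, b k] = phi0 i j k) (hvol : vol b = 1) :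
    ∃ P R, IsAdapted P R (Matrix.of fun i j => (B (c i) (c j) : ℂ))
      (fun i j k => (w ![c i, c j, c k] : ℂ)) (fun v => (vol (fun j => c (v j)) : ℂ)) := by
  refine ⟨((c.toMatrix b).transpose).map Complex.ofReal, (b.toMatrix c).transpose.map Complex.ofReal,
    ⟨⟨?_, ?_⟩, ?_, ?_⟩⟩
  · have h1 : (c.toMatrix b).transpose * (b.toMatrix c).transpose = 1 := by
      rw [← Matrix.transpose_mul, b.toMatrix_mul_toMatrix_flip c, Matrix.transpose_one]
    have := congrArg (fun m : Matrix (Fin 7) (Fin 7) ℝ => m.map Complex.ofRealHom) h1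
    simp only [Matrix.map_mul] at this
    refine this.trans ?_
    simp
  · ext i j
    have : B (c i) (c j) = ∑ k, b.repr (c i) k * b.repr (c j) k := by
      conv_lhs => rw [← b.sum_repr (c i), ← b.sum_repr (c j)]
      simp only [map_sum, map_smul, LinearMap.sum_apply, LinearMap.smul_apply, hB, smul_eq_mul,
        mul_ite, mul_one, mul_zero, Finset.sum_ite_eq', Finset.mem_univ, if_true]
      exact Finset.sum_congr rfl fun k _ => mul_comm _ _
    simp [this, Matrix.mul_apply, Module.Basis.toMatrix_apply]
  · funext i j k
    simp [alternating_three_eq_sum b w (c i), push3_apply, hw, phiS, Module.Basis.toMatrix_apply]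
  · funext v
    have : vol = b.det := by rw [vol.eq_smul_basis_det b, hvol, one_smul]
    rw [this, b.det_apply, volOf, ← Matrix.det_transpose, ← Complex.ofRealHom_eq_coe, RingHom.map_det]
    rfl

end LinearAlgebra

/-! ### Adapted frames, the norm of `Z` and its logarithm in charts. -/

section Manifold

variable {M : Type*} [TopologicalSpace M] [ChartedSpace E7 M] [IsManifold (𝓡 7) ∞ M]

theorem exists_basis_coordFrame {p : M} {x : E7} (hx : x ∈ (extChartAt (𝓡 7) p).target) :
    ∃ c : Module.Basis (Fin 7) ℝ (TangentSpace (𝓡 7) (pointAt p x)), ⇑c = coordFrame p x := by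
  refine ⟨(EuclideanSpace.basisFun (Fin 7) ℝ).toBasis.map
    ((trivializationAt E7 (TangentSpace (𝓡 7) : M → Type _) p).continuousLinearEquivAt ℝ _
      (mem_baseSet hx)).symm.toLinearEquiv, funext fun i => ?_⟩
  rw [Module.Basis.map_apply]
  simp only [OrthonormalBasis.coe_toBasis, EuclideanSpace.basisFun_apply]
  exact congrFun (Bundle.Trivialization.symm_continuousLinearEquivAt_eq _ (mem_baseSet hx)) _

theorem exists_isAdapted_coord (S : G2Structure M) {p : M} {x : E7}
    (hx : x ∈ (extChartAt (𝓡 7) p).target) :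
    ∃ P R, IsAdapted P R (S.gC p x) (S.phiC p x) (S.volC p x) := by
  obtain ⟨b, h1, h2, h3⟩ := S.adapted (pointAt p x)
  obtain ⟨c, hc⟩ := exists_basis_coordFrame hx
  obtain ⟨P, R, h⟩ := exists_isAdapted_of_basis
    (LinearMap.mk₂ ℝ (fun u v => S.metric.inner (pointAt p x) u v) (by simp) (by simp) (by simp)
      (by simp)) (S.form (pointAt p x)) (S.vol (pointAt p x)) b c h1 h2 h3
  refine ⟨P, R, ?_⟩
  convert h using 1
  · ext i j
    simp [G2Structure.gC, hc]
  · funext i j k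
    simp only [G2Structure.phiC, formCoord, hc]
    congr 2
    funext l
    fin_cases l <;> rfl
  · funext v
    simp only [G2Structure.volC, formCoord, hc]

theorem localG2_coord (S : G2Structure M) (p : M) :
    LocalG2 (S.gC p) (S.volC p) (S.phiC p) (center p) where
  diff_metric := diff_gC S p
  diff_form := diff_phiC S p
  adapted := by
    filter_upwards [target_mem_nhds_center p] with y hy using exists_isAdapted_coord S hy

theorem section_eq_sum (ξ : ∀ q : M, TangentSpace (𝓡 7) q) {p : M} {x : E7}
    (hx : x ∈ (extChartAt (𝓡 7) p).target) :
    ξ (pointAt p x) = ∑ i, vecCoord ξ p x i • coordFrame p x i := by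
  have hq := mem_baseSet hx
  have h1 := (trivializationAt E7 (TangentSpace (𝓡 7) : M → Type _) p).symmL_continuousLinearMapAt
    (R := ℝ) hq (ξ (pointAt p x))
  have h2 : (trivializationAt E7 (TangentSpace (𝓡 7) : M → Type _) p).continuousLinearMapAt ℝ
      (pointAt p x) (ξ (pointAt p x)) = vecCoord ξ p x := by
    rw [Bundle.Trivialization.continuousLinearMapAt_apply,
      Bundle.Trivialization.linearMapAt_apply, if_pos hq]
    rfl
  rw [h2] at h1
  rw [← h1]
  conv_lhs => rw [← (EuclideanSpace.basisFun (Fin 7) ℝ).sum_repr (vecCoord ξ p x), map_sum]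
  simp only [map_smul, EuclideanSpace.basisFun_apply, EuclideanSpace.basisFun_repr]
  rfl

theorem inner_eq_sum (S : G2Structure M) (ξ η : ∀ q : M, TangentSpace (𝓡 7) q) {p : M} {x : E7}
    (hx : x ∈ (extChartAt (𝓡 7) p).target) :
    (S.metric.inner (pointAt p x) (ξ (pointAt p x)) (η (pointAt p x)) : ℂ) =
      pair (S.gC p x) (fun i => (vecCoord ξ p x i : ℂ)) (fun i => (vecCoord η p x i : ℂ)) := by
  rw [section_eq_sum ξ hx, section_eq_sum η hx]
  simp only [map_sum, map_smul, _root_.sum_apply, _root_.smul_apply, pair,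
    G2Structure.gC, Matrix.of_apply, smul_eq_mul, Complex.ofReal_sum, Complex.ofReal_mul, Finset.mul_sum]
  rw [Finset.sum_comm]
  refine Finset.sum_congr rfl fun i _ => Finset.sum_congr rfl fun j _ => ?_
  ring

theorem normZ_pointAt (S : G2Structure M) (Z : BioctonionSection M) {p : M} {x : E7}
    (hx : x ∈ (extChartAt (𝓡 7) p).target) :
    S.normZ Z (pointAt p x) = quadN (S.gC p x) (Z.coord p x) := by
  have hs := S.metric.symm (pointAt p x) (Z.vecRe (pointAt p x)) (Z.vecIm (pointAt p x))
  -- The mixed term is split into its two symmetric halves, to match the bilinear expansion of the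
  -- pairing of `Re + i Im` with itself.
  have h2 : (2 : ℂ) * Complex.I * (S.metric.inner (pointAt p x) (Z.vecRe (pointAt p x))
      (Z.vecIm (pointAt p x)) : ℂ) = Complex.I * pair (S.gC p x)
        (fun i => (vecCoord Z.vecRe p x i : ℂ)) (fun i => (vecCoord Z.vecIm p x i : ℂ)) +
      Complex.I * pair (S.gC p x)
        (fun i => (vecCoord Z.vecIm p x i : ℂ)) (fun i => (vecCoord Z.vecRe p x i : ℂ)) := by
    rw [← inner_eq_sum S _ _ hx, ← inner_eq_sum S _ _ hx, hs]
    ring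
  rw [G2Structure.normZ, h2, inner_eq_sum S _ _ hx, inner_eq_sum S _ _ hx]
  simp only [quadN, BioctonionSection.coord, pair, Finset.mul_sum, ← Finset.sum_add_distrib,
    ← Finset.sum_sub_distrib]
  congr 1
  refine Finset.sum_congr rfl fun i _ => Finset.sum_congr rfl fun j _ => ?_
  linear_combination (-(S.gC p x i j) * vecCoord Z.vecIm p x i * vecCoord Z.vecIm p x j) *
    Complex.I_sq

omit [IsManifold (𝓡 7) ∞ M] in
theorem center_mem_target (p : M) : center p ∈ (extChartAt (𝓡 7) p).target :=
  mem_extChartAt_target p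

theorem normZ_eq_quadN (S : G2Structure M) (Z : BioctonionSection M) (p : M) :
    S.normZ Z p = quadN (S.gC p (center p)) (Z.coord p (center p)) := by
  rw [← normZ_pointAt S Z (center_mem_target p), pointAt_center]

theorem dlogN_eq (S : G2Structure M) (Z : BioctonionSection M) (p : M) (a : Fin 7) :
    S.dlogN Z p a = (quadN (S.gC p (center p)) (Z.coord p (center p)))⁻¹ *
      partialD a (fun y => quadN (S.gC p y) (Z.coord p y)) (center p) := by
  rw [G2Structure.dlogN, normZ_eq_quadN, dFun]
  congr 1
  have h : (fun y => S.normZ Z (pointAt p y)) =ᶠ[𝓝 (center p)]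
      fun y => quadN (S.gC p y) (Z.coord p y) := by
    filter_upwards [target_mem_nhds_center p] with y hy using normZ_pointAt S Z hy
  exact partialD_congr a h

/-- If `N(Z) = 0`, then `Z · conj Z = 0`, so the conjugate exhibits `Z` as a zero divisor. If the
conjugate is zero, then so is `Z`, and the unit is a witness. -/
theorem quadN_ne_zero (S : G2Structure M) (Z : BioctonionSection M) {p : M}
    (h : ¬ S.IsZeroDivisorAt Z p) : quadN (S.gC p (center p)) (Z.coord p (center p)) ≠ 0 := by
  intro hN
  obtain ⟨P, R, hA⟩ := exists_isAdapted_coord S (center_mem_target p)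
  by_cases hc : conj (Z.coord p (center p)) = 0
  · refine h ⟨(1, 0), by simp, Or.inr ?_⟩
    rw [octMul_scalar_left, one_smul]
    have := congrArg conj hc
    simpa [conj, Prod.ext_iff, funext_iff] using this
  · refine h ⟨_, hc, Or.inl ?_⟩
    have := hA.octMul_octMul_conj (1, 0) (Z.coord p (center p))
    rwa [octMul_scalar_left, one_smul, hN, zero_smul] at this

theorem alt4_fluxCoord (G : FormField M 4) (p : M) : Alt4 (fluxCoord G p) := by
  have e (v : Fin 4 → Fin 7) (i j : Fin 4) (hij : i ≠ j) :
      (formCoord G p (center p) (v ∘ Equiv.swap i j) : ℂ) = -formCoord G p (center p) v := by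
    have := (G (pointAt p (center p))).map_swap (fun k => coordFrame p (center p) (v k)) hij
    rw [← Complex.ofReal_neg]
    exact congrArg Complex.ofReal this
  refine ⟨fun a b c d => ?_, fun a b c d => ?_, fun a b c d => ?_⟩
  · rw [fluxCoord, fluxCoord, ← neg_eq_iff_eq_neg, ← e _ 0 1 (by decide)]
    congr 2; funext k; fin_cases k <;> rfl
  · rw [fluxCoord, fluxCoord, ← neg_eq_iff_eq_neg, ← e _ 1 2 (by decide)]
    congr 2; funext k; fin_cases k <;> rfl
  · rw [fluxCoord, fluxCoord, ← neg_eq_iff_eq_neg, ← e _ 2 3 (by decide)]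
    congr 2; funext k; fin_cases k <;> rfl

theorem contMDiff_normZ (S : G2Structure M) (Z : BioctonionSection M) :
    ContMDiff (𝓡 7) 𝓘(ℝ, ℂ) ∞ (S.normZ Z) := by
  intro p
  have e {f : M → ℝ} (hf : ContMDiffAt (𝓡 7) 𝓘(ℝ, ℝ) ∞ f p) :
      ContMDiffAt (𝓡 7) 𝓘(ℝ, ℂ) ∞ (fun q => (f q : ℂ)) p :=
    (Complex.ofRealCLM.contDiff.contMDiff.contMDiffAt).comp p hf
  have f (F : ℂ × ℂ × ℂ × ℂ → ℂ) (hF : ContDiff ℝ ∞ F) {f0 f1 f2 f3 : M → ℂ}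
      (h0 : ContMDiffAt (𝓡 7) 𝓘(ℝ, ℂ) ∞ f0 p) (h1 : ContMDiffAt (𝓡 7) 𝓘(ℝ, ℂ) ∞ f1 p)
      (h2 : ContMDiffAt (𝓡 7) 𝓘(ℝ, ℂ) ∞ f2 p) (h3 : ContMDiffAt (𝓡 7) 𝓘(ℝ, ℂ) ∞ f3 p) :
      ContMDiffAt (𝓡 7) 𝓘(ℝ, ℂ) ∞ (fun q => F (f0 q, f1 q, f2 q, f3 q)) p :=
    hF.contMDiff.contMDiffAt.comp p
      (h0.prodMk_space (h1.prodMk_space (h2.prodMk_space h3)))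
  exact f (fun w => w.1 ^ 2 + (w.2.1 - w.2.2.1 + 2 * Complex.I * w.2.2.2)) (by fun_prop)
    (Z.smooth_scalar p) (e (contMDiffAt_inner S (Z.smooth_vecRe p) (Z.smooth_vecRe p)))
    (e (contMDiffAt_inner S (Z.smooth_vecIm p) (Z.smooth_vecIm p)))
    (e (contMDiffAt_inner S (Z.smooth_vecRe p) (Z.smooth_vecIm p)))

/-- A nowhere vanishing smooth complex function has a smooth logarithm near every point. -/
theorem exists_local_log {f : M → ℂ} (hf : ContMDiff (𝓡 7) 𝓘(ℝ, ℂ) ∞ f) (h0 : ∀ q, f q ≠ 0)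
    (p : M) : ∃ U : Set M, IsOpen U ∧ p ∈ U ∧ ∃ ℓ : M → ℂ, ContMDiffOn (𝓡 7) 𝓘(ℝ, ℂ) ∞ ℓ U ∧
      ∀ q ∈ U, Complex.exp (ℓ q) = f q ∧ (fun a => (f q)⁻¹ * dFun f q a) = dFun ℓ q := by
  have hU : IsOpen {q | f q / f p ∈ Complex.slitPlane} :=
    Complex.isOpen_slitPlane.preimage (hf.continuous.div_const _)
  have hexp (q : M) : Complex.exp (Complex.log (f q / f p) + Complex.log (f p)) = f q := by
    rw [Complex.exp_add, Complex.exp_log (div_ne_zero (h0 q) (h0 p)), Complex.exp_log (h0 p),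
      div_mul_cancel₀ _ (h0 p)]
  have hsmooth (q : M) (hq : f q / f p ∈ Complex.slitPlane) : ContMDiffAt (𝓡 7) 𝓘(ℝ, ℂ) ∞
      (fun q => Complex.log (f q / f p) + Complex.log (f p)) q := by
    have h1 : ContDiffAt ℝ ∞ (fun w : ℂ => Complex.log (w / f p) + Complex.log (f p)) (f q) := by
      refine ContDiffAt.add ?_ contDiffAt_const
      exact ((Complex.contDiffAt_log hq).restrict_scalars ℝ).comp (f q)
        (contDiffAt_id.div_const _)
    exact h1.contMDiffAt.comp q (hf q)
  -- Dividing by `f p` makes the value at `p` equal to 1, inside the slit plane. The exponential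
  -- identity holds everywhere since `f` has no zeros; the slit plane is needed only for smoothness.
  refine ⟨_, hU, ?_, fun q => Complex.log (f q / f p) + Complex.log (f p),
    fun q hq => (hsmooth q hq).contMDiffWithinAt, fun q hq => ⟨hexp q, funext fun a => ?_⟩⟩
  · simp [div_self (h0 p), Complex.one_mem_slitPlane]
  · have hd := differentiableAt_comp_pointAt (hsmooth q hq)
    have h2 := hd.hasFDerivAt.cexp
    simp only [hexp] at h2
    rw [dFun, dFun, partialD, partialD, h2.fderiv, pointAt_center]
    simp [inv_mul_cancel_left₀ (h0 q)]

end Manifold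
end G2Flux

/-! ### Assembly of the local results at each point. -/

theorem mainTheorem1 {M : Type*} [TopologicalSpace M] [ChartedSpace G2Flux.E7 M]
    [IsManifold (𝓡 7) ∞ M] (S : G2Flux.G2Structure M) (Z : G2Flux.BioctonionSection M)
    (hZ : ∀ p, ¬ S.IsZeroDivisorAt Z p)
    (μ : ℝ) (Δ : M → ℝ) (hΔ : ContMDiff (𝓡 7) 𝓘(ℝ, ℝ) ∞ Δ) :
    -- `N(Z)` vanishes nowhere, and near every point `N(Z)⁻¹ dN(Z)` is the differential of a
    -- smooth logarithm of `N(Z)`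
    ((∀ p, S.normZ Z p ≠ 0) ∧
      ∀ p, ∃ U : Set M, IsOpen U ∧ p ∈ U ∧ ∃ ℓ : M → ℂ, ContMDiffOn (𝓡 7) 𝓘(ℝ, ℂ) ∞ ℓ U ∧
        ∀ q ∈ U, Complex.exp (ℓ q) = S.normZ Z q ∧ S.dlogN Z q = G2Flux.dFun ℓ q) ∧
    -- the internal Killing equation with flux `G` is equivalent to the torsion equations
    (∀ G : G2Flux.FormField M 4,
      S.InternalKilling Z G μ Δ ↔
        ∀ p, ∃ (Q₀ : ℂ) (Q₁ : G2Flux.T1) (Q₂ : G2Flux.T2)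
          (τ₁ : ℂ) (τ₇ : G2Flux.T1) (τ₁₄ τ₂₇ : G2Flux.T2),
          G2Flux.IsFluxDecomposition (S.gC p (G2Flux.center p))
            (S.phiZ Z p (G2Flux.center p)) (S.psiZ Z p) (G2Flux.fluxCoord G p) Q₀ Q₁ Q₂ ∧
          G2Flux.IsTorsionDecomposition (S.gC p (G2Flux.center p))
            (S.phiZ Z p (G2Flux.center p)) (S.torsionZ Z p) τ₁ τ₇ τ₁₄ τ₂₇ ∧
          τ₁ = (1 / 2) * μ * Real.exp (-4 * Δ p) + (5 / 6) * Complex.I * Q₀ ∧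
          (∀ a, τ₇ a = -(Complex.I / 3) * Q₁ a) ∧
          (∀ a, τ₇ a = -(1 / 8) * S.dlogN Z p a) ∧
          (∀ a b, τ₁₄ a b = 0) ∧
          (∀ a b, τ₂₇ a b = Complex.I * Q₂ a b)) ∧
    -- converse: torsion class `1 ⊕ 7 ⊕ 27`, the equation for `τ₇`, and reality of the 4-form
    -- `-(i/2) dφ_Z + (i/5) (14 τ₁ + 3 μ e^{-4Δ}) ψ_Z`
    (∀ G : G2Flux.FormField M 4,
      (∀ p, ∃ (τ₁ : ℂ) (τ₇ : G2Flux.T1) (τ₂₇ : G2Flux.T2),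
        G2Flux.IsTorsionDecomposition (S.gC p (G2Flux.center p))
          (S.phiZ Z p (G2Flux.center p)) (S.torsionZ Z p) τ₁ τ₇ 0 τ₂₇ ∧
        (∀ a, τ₇ a = -(1 / 8) * S.dlogN Z p a) ∧
        (∀ a b c d, G2Flux.fluxCoord G p a b c d =
          -(Complex.I / 2) * G2Flux.extD (S.phiZ Z p) (G2Flux.center p) a b c d
            + (Complex.I / 5) * (14 * τ₁ + 3 * μ * Real.exp (-4 * Δ p))
              * S.psiZ Z p a b c d)) →
      S.InternalKilling Z G μ Δ) := by
  have hN (p : M) := G2Flux.quadN_ne_zero S Z (hZ p)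
  have hn (p : M) : S.normZ Z p ≠ 0 := by
    rw [G2Flux.normZ_eq_quadN]
    exact hN p
  refine ⟨⟨hn, fun p => G2Flux.exists_local_log (G2Flux.contMDiff_normZ S Z) hn p⟩,
    fun G => forall_congr' fun p => ?_, fun G h p => ?_⟩
  -- The equivalence is pointwise. At the centre of the chart of `p` only the number `c = μ
  -- e^{-4Δ(p)}` enters, up to the arrangement of constants.
  · have key := (G2Flux.localG2_coord S p).killing_iff (G2Flux.diff_coord Z p) (hN p)
      (G2Flux.alt4_fluxCoord G p) (μ * Real.exp (-4 * Δ p))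
    have e1 : (-(1 / 2) * μ * Real.exp (-4 * Δ p) : ℂ) = -((μ * Real.exp (-4 * Δ p)) / 2) := by ring
    have e2 : (1 / 2 * μ * Real.exp (-4 * Δ p) : ℂ) = μ * Real.exp (-4 * Δ p) / 2 := by ring
    rw [e1, e2]
    simp only [G2Flux.dlogN_eq]
    exact key
  · obtain ⟨τ₁, τ₇, τ₂₇, hT, hd, hF⟩ := h p
    have e1 : (-(1 / 2) * μ * Real.exp (-4 * Δ p) : ℂ) = -((μ * Real.exp (-4 * Δ p)) / 2) := by ring
    simp only [G2Flux.dlogN_eq] at hd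
    intro a
    rw [e1]
    refine (G2Flux.localG2_coord S p).killing_of_torsion (G2Flux.diff_coord Z p) (hN p)
      (μ * Real.exp (-4 * Δ p)) hT hd (fun a b c d => ?_) a
    rw [hF, mul_assoc (3 : ℂ)]
    rfl
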